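/- Let $G=\mathrm{SL}(2,\mathbb R)$, let $H=\{\mathrm{diag}(t,t^{-1}):t\in\mathbb R^\times\}$, let $N$ (resp. $\overline N=\{\overline n_x=\left(\begin{smallmatrix}1&0\\x&1\end{smallmatrix}\right)\}$) be the upper (resp. lower) triangular unipotent subgroup, $P=HN$, $K=\mathrm{SO}(2)$, $w_0=\left(\begin{smallmatrix}0&1\\-1&0\end{smallmatrix}\right)$, and $|t|^s_\varepsilon=\mathrm{sgn}(t)^\varepsilon|t|^s$. Elements of $\mathbb Z/2\mathbb Z$ in numerical formulas are read as numbers in $\{0,1\}$, and $[m]_2\in\{0,1\}$ is the residue of $m$ modulo $2$. Let $\varepsilon,\xi\in\mathbb Z/2\mathbb Z$, $\lambda\in i\mathbb R$ and $\mu\in\mathbb C$. * $\mathrm{Ind}_P^G(\varepsilon\otimes e^\mu\otimes1)$ is the space of $f\in C^\infty(G)$ with $f(g\,\mathrm{diag}(t,t^{-1})\,n)=|t|_\varepsilon^{-\mu-1}f(g)$ for all $t\in\mathbb R^\times$, $n\in N$. * $C_c^\infty\text{-}\mathrm{Ind}_H^G(\varepsilon\otimes e^\lambda)$ is the space of $f\in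 C^\infty(G)$ with $f(g\,\mathrm{diag}(t,t^{-1}))=(|t|_\varepsilon^{\lambda})^{-1}f(g)$ whose support is compact modulo $H$. * The Knapp–Stein operator on $\mathrm{Ind}_P^G(\varepsilon\otimes e^\mu\otimes1)$ is $$T^\varepsilon_\mu f(g)=\frac1{\Gamma(\frac{\mu+\varepsilon}2)}\int_{\mathbb R}f(g w_0\overline n_x)\,dx\qquad(\mathrm{Re}\,\mu>0),$$ continued holomorphically to $\mu\in\mathbb C$ along families of functions with fixed restriction to $K$. * For $K^\xi_{\lambda,\mu}(g)=|g_{11}|^{\frac{\lambda+\mu-1}2}_{\xi+\varepsilon}|g_{21}|^{\frac{\mu-\lambda-1}2}_\xi$ and $f\in C_c^\infty\text{-}\mathrm{Ind}_H^G(\varepsilon\otimes e^\lambda)$, set $$A^\xi_{\lambda,\mu}f(g)=\int_{G/H}K^\xi_{-\lambda,-\mu}(x^{-1}g)f(x)\,d(xH)\qquad(\mathrm{Re}\,\mu<1),$$ continued meromorphically to $\mu\in\mathbb C$. Here the invariant measure is $d(xH)=\cosh(2u)\,du\,d\theta$ in the coordinates $xH=k_\theta b_uH$, $(\theta,u)\in[0,\pi)\times\mathbb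 R$, with $k_\theta=\left(\begin{smallmatrix}\cos\theta&\sin\theta\\-\sin\theta&\cos\theta\end{smallmatrix}\right)$, $b_u=\left(\begin{smallmatrix}\cosh u&\sinh u\\\sinh u&\cosh u\end{smallmatrix}\right)$. Put $\gamma^\xi_{\lambda,\mu}=\Gamma\big(\tfrac{1-\lambda-\mu+2[\xi+\varepsilon]_2}4\big)\Gamma\big(\tfrac{1+\lambda-\mu+2\xi}4\big)$ and let $f\in C_c^\infty\text{-}\mathrm{Ind}_H^G(\varepsilon\otimes e^\lambda)$. Then: 1. For every $g\in G$ the integral for $A^\xi_{\lambda,\mu}f(g)$ converges absolutely for $\mathrm{Re}\,\mu<1$, and $\widetilde A^\xi_{\lambda,\mu}f(g):=(\gamma^\xi_{\lambda,\mu})^{-1}A^\xi_{\lambda,\mu}f(g)$ extends to an entire function of $\mu$. For every $\mu\in\mathbb C$ we have $\widetilde A^\xi_{\lambda,\mu}f\in\mathrm{Ind}_P^G(\varepsilon\otimes e^\mu\otimes1)$, and $T^\varepsilon_\mu$ is defined on this function: the integrals converge absolutely for parameters of positive real part and have an entire continuation. 2. For every $\mu\in\mathbb C$ at which neither $\gamma^\xi_{\lambda,\mu}$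 nor $\gamma^{\xi+\varepsilon}_{\lambda,-\mu}$ has a pole, $$T^\varepsilon_\mu\big(A^\xi_{\lambda,\mu}f\big)=d^\xi_{\lambda,\mu}\,A^{\xi+\varepsilon}_{\lambda,-\mu}f,$$ where $$d^\xi_{\lambda,\mu}=(-1)^{\lfloor\frac{\varepsilon+\xi}2\rfloor}\sqrt\pi\,\frac{\Gamma\big(\frac{1-\lambda-\mu+2[\xi+\varepsilon]_2}4\big)\Gamma\big(\frac{1+\lambda-\mu+2\xi}4\big)}{\Gamma\big(\frac{1+\lambda+\mu+2[\xi+\varepsilon]_2}4\big)\Gamma\big(\frac{1-\lambda+\mu+2\xi}4\big)\Gamma\big(\frac{1-\mu+\varepsilon}2\big)}.$$ 3. For every $\mu\in\mathbb C$, $$T^\varepsilon_\mu\big(\widetilde A^\xi_{\lambda,\mu}f\big)=(-1)^{\lfloor\frac{\varepsilon+\xi}2\rfloor}\frac{\sqrt\pi}{\Gamma\big(\frac{1-\mu+\varepsilon}2\big)}\,\widetilde A^{\xi+\varepsilon}_{\lambda,-\mu}f.$$ (Here $1/\Gamma$ is read as $0$ at the poles of $\Gamma$.) -/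

import Mathlib

open MeasureTheory Set
open scoped ContDiff

noncomputable section

namespace SLTwo

/-- The group `SL(2, ℝ)`, with its topology as a subspace of the real matrices. -/
abbrev G : Type := Matrix.SpecialLinearGroup (Fin 2) ℝ

/-- The element `diag(t, t⁻¹)` of `H = MA`, for `t ∈ ℝˣ`. -/
def diagG (t : ℝˣ) : G :=
  ⟨!![(t : ℝ), 0; 0, (t : ℝ)⁻¹], by simp [Matrix.det_fin_two]⟩

/-- The upper triangular unipotent element of `N`. -/
def nG (x : ℝ) : G := ⟨!![1, x; 0, 1], by simp [Matrix.det_fin_two]⟩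

/-- The lower triangular unipotent element of `N̄`. -/
def nbarG (x : ℝ) : G := ⟨!![1, 0; x, 1], by simp [Matrix.det_fin_two]⟩

/-- The rotation `k_θ`. -/
def kG (θ : ℝ) : G :=
  ⟨!![Real.cos θ, Real.sin θ; -Real.sin θ, Real.cos θ], by
    have h := Real.cos_sq_add_sin_sq θ
    simp only [Matrix.det_fin_two_of]
    nlinarith [h]⟩

/-- The hyperbolic element `b_u`. -/
def bG (u : ℝ) : G :=
  ⟨!![Real.cosh u, Real.sinh u; Real.sinh u, Real.cosh u], by
    have h := Real.cosh_sq u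
    simp only [Matrix.det_fin_two_of]
    nlinarith [h]⟩

/-- The Weyl group representative `w₀`. -/
def w0 : G := ⟨!![0, 1; -1, 0], by simp [Matrix.det_fin_two]⟩

/-- `|t|^s_ε = sgn(t)^ε |t|^s`, where `ε ∈ ℤ/2` is read as a number in `{0, 1}`. -/
def spow (ε : ZMod 2) (s : ℂ) (t : ℝ) : ℂ :=
  ((Real.sign t : ℝ) : ℂ) ^ ε.val * ((|t| : ℝ) : ℂ) ^ s

/-- Smooth functions on `SL(2, ℝ)`, a closed submanifold of the space of real `2 × 2` matrices:
restrictions of functions that are smooth on a neighbourhood of `SL(2, ℝ)`. -/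
def SmoothG (f : G → ℂ) : Prop :=
  ∃ (U : Set (Fin 2 → Fin 2 → ℝ)) (F : (Fin 2 → Fin 2 → ℝ) → ℂ),
    IsOpen U ∧ ContDiffOn ℝ ∞ F U ∧
      ∀ g : G, (fun i j => g i j) ∈ U ∧ F (fun i j => g i j) = f g

/-- The principal series `Ind_P^G(ε ⊗ e^μ ⊗ 1)`. -/
def IndP (ε : ZMod 2) (μ : ℂ) : Set (G → ℂ) :=
  {f | SmoothG f ∧ ∀ (g : G) (t : ℝˣ) (x : ℝ),
    f (g * (diagG t * nG x)) = spow ε (-μ - 1) t * f g}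

/-- The space `C_c^∞-Ind_H^G(ε ⊗ e^l)`: smooth functions with `f(gh) = χ_{ε,l}(h)⁻¹ f(g)` whose
support is compact modulo `H` (such functions are automatically square integrable on `G/H`). -/
def IndHc (ε : ZMod 2) (l : ℂ) : Set (G → ℂ) :=
  {f | SmoothG f ∧
    (∀ (g : G) (t : ℝˣ), f (g * diagG t) = (spow ε l t)⁻¹ * f g) ∧
    ∃ C : Set G, IsCompact C ∧ ∀ g : G, f g ≠ 0 → ∃ c ∈ C, ∃ t : ℝˣ, g = c * diagG t}

/-- The domain `[0, π) × ℝ` of the global coordinates `(θ, u) ↦ k_θ b_u H` on `G/H`. -/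
def coordDomain : Set (ℝ × ℝ) := Ico 0 Real.pi ×ˢ univ

/-- A right `H`-invariant function on `G`, in the coordinates `(θ, u)`, times the density
`cosh(2u)` of the invariant measure `d(xH) = cosh(2u) du dθ` of `G/H`. -/
def coordDensity (F : G → ℂ) (p : ℝ × ℝ) : ℂ :=
  F (kG p.1 * bG p.2) * ((Real.cosh (2 * p.2) : ℝ) : ℂ)

/-- The integral over `G/H` of a right `H`-invariant function on `G`. -/
def integralGH (F : G → ℂ) : ℂ := ∫ p in coordDomain, coordDensity F p

/-- Integrability over `G/H` of a right `H`-invariant function on `G`. -/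
def IntegrableGH (F : G → ℂ) : Prop := IntegrableOn (coordDensity F) coordDomain

/-- `E` is an entire function that agrees with `F` on `U`. -/
def IsEntireExt (U : Set ℂ) (F E : ℂ → ℂ) : Prop := Differentiable ℂ E ∧ EqOn E F U

theorem IsEntireExt.unique {U : Set ℂ} {F E E' : ℂ → ℂ} (hU : IsOpen U) (hne : U.Nonempty)
    (h : IsEntireExt U F E) (h' : IsEntireExt U F E') : E = E' := by
  obtain ⟨z, hz⟩ := hne
  refine AnalyticOnNhd.eq_of_eventuallyEq (𝕜 := ℂ) (z₀ := z)
    (fun w _ => h.1.analyticAt w) (fun w _ => h'.1.analyticAt w) ?_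
  filter_upwards [hU.mem_nhds hz] with w hw
  rw [h.2 hw, h'.2 hw]

open Classical in
/-- The entire function extending `F` from `U` (zero if there is none); it is unique when `U`
is open and non-empty. -/
def entireExt (U : Set ℂ) (F : ℂ → ℂ) : ℂ → ℂ :=
  if h : ∃ E, IsEntireExt U F E then h.choose else 0

/-- For `f ∈ Ind_P^G(ε ⊗ e^μ ⊗ 1)`, the element of `Ind_P^G(ε ⊗ e^ν ⊗ 1)` with the same
restriction to `K` as `f`. -/
def flatSection (μ ν : ℂ) (f : G → ℂ) (g : G) : ℂ :=
  ((g 0 0 ^ 2 + g 1 0 ^ 2 : ℝ) : ℂ) ^ ((μ - ν) / 2) * f g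

/-- The integral defining the Knapp–Stein operator with parameter `ν`, `Re ν > 0`, on the element
of `Ind_P^G(ε ⊗ e^ν ⊗ 1)` with the same restriction to `K` as `f ∈ Ind_P^G(ε ⊗ e^μ ⊗ 1)`. -/
def knappSteinIntegral (ε : ZMod 2) (μ : ℂ) (f : G → ℂ) (g : G) (ν : ℂ) : ℂ :=
  (Complex.Gamma ((ν + (ε.val : ℂ)) / 2))⁻¹ * ∫ x : ℝ, flatSection μ ν f (g * w0 * nbarG x)

/-- The normalized Knapp–Stein operator `T_μ^ε`, for all `μ ∈ ℂ`. For `Re μ > 0` it is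
`Γ((μ+ε)/2)⁻¹ ∫ f(g w₀ n̄) dn̄`; in general it is the holomorphic continuation of these integrals
along sections with constant restriction to `K`. -/
def knappStein (ε : ZMod 2) (μ : ℂ) (f : G → ℂ) (g : G) : ℂ :=
  entireExt {ν | 0 < ν.re} (knappSteinIntegral ε μ f g) μ

/-- The integrals defining `T_μ^ε f` converge and have the holomorphic continuation. -/
def KnappSteinDefined (ε : ZMod 2) (μ : ℂ) (f : G → ℂ) : Prop :=
  ∀ g : G,
    (∀ ν : ℂ, 0 < ν.re → Integrable fun x : ℝ => flatSection μ ν f (g * w0 * nbarG x)) ∧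
    ∃ E, IsEntireExt {ν | 0 < ν.re} (knappSteinIntegral ε μ f g) E

/-- The kernel `K_{l,μ}^ξ` (for the parity `ε`). -/
def kernelK (ε ξ : ZMod 2) (l μ : ℂ) (g : G) : ℂ :=
  spow (ξ + ε) ((l + μ - 1) / 2) (g 0 0) * spow ξ ((μ - l - 1) / 2) (g 1 0)

/-- The integrand of `A_{l,μ}^ξ f(g)`. -/
def integrandA (ε ξ : ZMod 2) (l μ : ℂ) (f : G → ℂ) (g x : G) : ℂ :=
  kernelK ε ξ (-l) (-μ) (x⁻¹ * g) * f x

/-- The product of Gamma functions that carries the poles in `μ` of `A_{l,μ}^ξ`. -/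
def gammaA (ε ξ : ZMod 2) (l μ : ℂ) : ℂ :=
  Complex.Gamma ((1 - l - μ + 2 * ((ξ + ε).val : ℂ)) / 4) *
    Complex.Gamma ((1 + l - μ + 2 * (ξ.val : ℂ)) / 4)

/-- `μ` is not a pole of `gammaA`. -/
def RegularA (ε ξ : ZMod 2) (l μ : ℂ) : Prop :=
  ∀ n : ℕ, (1 - l - μ + 2 * ((ξ + ε).val : ℂ)) / 4 ≠ -(n : ℂ) ∧
    (1 + l - μ + 2 * (ξ.val : ℂ)) / 4 ≠ -(n : ℂ)

/-- The integral for `A_{l,ν}^ξ f(g)`, divided by `gammaA`. -/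
def normIntegralA (ε ξ : ZMod 2) (l : ℂ) (f : G → ℂ) (g : G) (ν : ℂ) : ℂ :=
  (gammaA ε ξ l ν)⁻¹ * integralGH (integrandA ε ξ l ν f g)

/-- The normalized operator `A_{l,μ}^ξ / gammaA`, for all `μ ∈ ℂ`: the entire continuation in `μ`
of the integral, which converges for `Re μ < 1`. -/
def normOpA (ε ξ : ZMod 2) (l μ : ℂ) (f : G → ℂ) (g : G) : ℂ :=
  entireExt {ν | ν.re < 1} (normIntegralA ε ξ l f g) μ

/-- The operator `A_{l,μ}^ξ`: the integral `∫_{G/H} K_{-l,-μ}^ξ(x⁻¹ g) f(x) d(xH)` for `Re μ < 1`,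
and its meromorphic continuation for other `μ`. It is meaningful where `RegularA ε ξ l μ`. -/
def opA (ε ξ : ZMod 2) (l μ : ℂ) (f : G → ℂ) (g : G) : ℂ :=
  gammaA ε ξ l μ * normOpA ε ξ l μ f g

/-- The integrals defining `A_{l,μ}^ξ f` converge and have the holomorphic continuation. -/
def OpADefined (ε ξ : ZMod 2) (l : ℂ) (f : G → ℂ) : Prop :=
  ∀ g : G,
    (∀ ν : ℂ, ν.re < 1 → IntegrableGH (integrandA ε ξ l ν f g)) ∧
    ∃ E, IsEntireExt {ν | ν.re < 1} (normIntegralA ε ξ l f g) E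

/-- The constant `d_{l,μ}^ξ` (for the parity `ε`). -/
def dConst (ε ξ : ZMod 2) (l μ : ℂ) : ℂ :=
  (-1) ^ ((ε.val + ξ.val) / 2) * ((Real.sqrt Real.pi : ℝ) : ℂ) *
    (Complex.Gamma ((1 - l - μ + 2 * ((ξ + ε).val : ℂ)) / 4) *
      Complex.Gamma ((1 + l - μ + 2 * (ξ.val : ℂ)) / 4)) /
    (Complex.Gamma ((1 + l + μ + 2 * ((ξ + ε).val : ℂ)) / 4) *
      Complex.Gamma ((1 - l + μ + 2 * (ξ.val : ℂ)) / 4) *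
      Complex.Gamma ((1 - μ + (ε.val : ℂ)) / 2))

end SLTwo

end

open SLTwo

noncomputable section

namespace SLTwo

/-! The identity is proved in the strip 0 < Re μ < 1 and continued to all μ.

In the strip the integrals over N̄ and over G/H converge absolutely, so by Fubini the composite has
the kernel h ↦ ∫ K^ξ_{-λ,-μ}(h w₀ n̄_x) dx with h = y⁻¹g, y ∈ G/H. The first column of h w₀ n̄_x is
affine in x. An affine substitution sends the zeros of its two entries to 0 and 1, and the kernel
becomes B · K^{ξ+ε}_{-λ,μ}(h) (`kernelK_w0_nbar`). Here B is the integral over ℝ of |y|^{s₁-1}_{ξ+ε}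
|y-1|^{s₂-1}_ξ with s₁ = (1-λ-μ)/2, s₂ = (1+λ-μ)/2. With s₃ = μ the three parameters sum to 1.
Cutting the line at 0 and 1 gives three Beta integrals, which reflection, duplication and
`trig_identity` combine into a sign times √π times three quotients Γ((s+δ)/2)/Γ((1-s+δ)/2)
(`integral_spow_mul_spow_eq`). Dividing by γ and by Γ((μ+ε)/2) leaves only 1/Γ((1-μ+ε)/2)
(`knappSteinIntegral_normOpA`).

For the continuation both operators are reduced to the distributions |x|^s_ε / Γ((s+1+ε)/2), which
are entire in s (`riesz`). On G/H the kernel is singular along two disjoint curves. A partition of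
unity separates them, and in a suitable chart (b, c) each part of the kernel is a single power of c.
Integrating out b leaves such a distribution applied to a smooth compactly supported family in the
angle θ of K (`normOpK`). On sections with fixed restriction to K, the Knapp–Stein integral is
convolution on the circle with |sin τ|^{ν-1}_ε (`IndP.knappSteinIntegral_eq`). Near τ = 0 this is
again such a distribution, and away from 0 its weight is regular (`circT`).

In T_μ(Ã_μ f) the parameter enters both the operator and the function, so separate holomorphy is not
enough. `Fam.differentiable_circT_riesz` moves the circle convolution inside the pairing with |c|^s
and differentiates an absolutely convergent integral. Both sides are then entire in μ and agree on
the strip (`knappStein_normOpA`). The unnormalized identity follows by multiplying with Gamma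
factors. -/

/-! ### Powers |x|^s, smooth families and integration by parts -/

/-- The even power `|x|^s`. -/
def apow (s : ℂ) (x : ℝ) : ℂ := ((|x| : ℝ) : ℂ) ^ s

lemma apow_eq_exp (s : ℂ) {x : ℝ} (hx : x ≠ 0) :
    apow s x = Complex.exp (s * (Real.log x : ℂ)) := by
  have h : ((|x| : ℝ) : ℂ) ≠ 0 := by simpa using hx
  rw [apow, Complex.cpow_def_of_ne_zero h, ← Complex.ofReal_log (abs_nonneg x), Real.log_abs,
    mul_comm]

lemma norm_apow (s : ℂ) {x : ℝ} (hx : x ≠ 0) : ‖apow s x‖ = |x| ^ s.re := by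
  rw [apow, Complex.norm_cpow_eq_rpow_re_of_pos (abs_pos.2 hx)]

lemma apow_neg (s : ℂ) (x : ℝ) : apow s (-x) = apow s x := by simp [apow]

lemma apow_add {x : ℝ} (hx : x ≠ 0) (s t : ℂ) : apow (s + t) x = apow s x * apow t x := by
  rw [apow_eq_exp _ hx, apow_eq_exp _ hx, apow_eq_exp _ hx, add_mul, Complex.exp_add]

lemma apow_add_two {x : ℝ} (hx : x ≠ 0) (s : ℂ) :
    apow (s + 2) x = apow s x * (x : ℂ) ^ 2 := by
  rw [apow_add hx]
  congr 1
  rw [apow]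
  norm_cast
  rw [sq_abs]

lemma measurable_apow (s : ℂ) : Measurable (apow s) := by
  unfold apow
  fun_prop

lemma locallyIntegrable_abs_rpow {r : ℝ} (hr : -1 < r) :
    LocallyIntegrable (fun x : ℝ => |x| ^ r) := by
  have key : ∀ R : ℝ, 0 ≤ R → IntervalIntegrable (fun x : ℝ => |x| ^ r) volume 0 R := by
    intro R hR
    refine (intervalIntegral.intervalIntegrable_rpow' (a := 0) (b := R) hr).congr ?_
    intro x hx
    rw [uIoc_of_le hR] at hx
    simp [abs_of_pos hx.1]
  rw [locallyIntegrable_iff]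
  intro k hk
  obtain ⟨R, hR⟩ := hk.isBounded.subset_closedBall 0
  have h1 := key |R| (abs_nonneg R)
  have h2 : IntervalIntegrable (fun x : ℝ => |x| ^ r) volume (-|R|) 0 := by
    simpa using ((IntervalIntegrable.iff_comp_neg (by simp)).1 h1).symm
  have h3 := (intervalIntegrable_iff_integrableOn_Icc_of_le
    (by linarith [abs_nonneg R] : -|R| ≤ |R|)).1 (h2.trans h1)
  refine h3.mono_set (hR.trans ?_)
  intro x hx
  rw [Real.closedBall_eq_Icc] at hx
  exact ⟨by linarith [hx.1, le_abs_self R], by linarith [hx.2, le_abs_self R]⟩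

lemma locallyIntegrable_apow {s : ℂ} (hs : -1 < s.re) : LocallyIntegrable (apow s) := by
  refine (locallyIntegrable_abs_rpow hs).mono (measurable_apow s).aestronglyMeasurable ?_
  filter_upwards [compl_mem_ae_iff.2 (measure_singleton (μ := volume) (0 : ℝ))] with x hx
  rw [norm_apow s hx, Real.norm_of_nonneg (by positivity)]

/-- Smooth families of functions on the line, supported in `[-R, R]`. -/
structure Fam {E : Type*} [NormedAddCommGroup E] [NormedSpace ℝ E] (R : ℝ) (h : E → ℝ → ℂ) :
    Prop where
  pos : 0 < R
  smooth : ContDiff ℝ ∞ (fun q : E × ℝ => h q.1 q.2)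
  supp : ∀ p x, R < |x| → h p x = 0

section Family

variable {E : Type*} [NormedAddCommGroup E] [NormedSpace ℝ E] {R : ℝ} {h : E → ℝ → ℂ}

lemma Fam.contDiff_slice (H : Fam R h) (p : E) : ContDiff ℝ ∞ (h p) :=
  H.smooth.comp (contDiff_prodMk_right p)

lemma Fam.hasCompactSupport (H : Fam R h) (p : E) : HasCompactSupport (h p) := by
  refine HasCompactSupport.intro (isCompact_Icc (a := -R) (b := R)) fun x hx => H.supp p x ?_
  by_contra! hlt
  exact hx (abs_le.1 hlt)

lemma Fam.comp {E' : Type*} [NormedAddCommGroup E'] [NormedSpace ℝ E'] (H : Fam R h) {g : E' → E}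
    (hg : ContDiff ℝ ∞ g) : Fam R (fun p => h (g p)) :=
  ⟨H.pos, H.smooth.comp ((hg.comp contDiff_fst).prodMk contDiff_snd), fun _ x hx => H.supp _ x hx⟩

lemma Fam.integrable_mul (H : Fam R h) (p : E) {w : ℝ → ℂ} (hw : LocallyIntegrable w) :
    Integrable (fun x => w x * h p x) := by
  have := hw.integrable_smul_left_of_hasCompactSupport (H.contDiff_slice p).continuous
    (H.hasCompactSupport p)
  simpa [mul_comm] using this

/-- The integral is the value at 0 of the convolution of w with x ↦ h p (-x), so smoothness in p
comes from the parametric convolution theorem, which asks only local integrability of w. -/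
lemma contDiff_integral_mul (H : Fam R h) {w : ℝ → ℂ} (hw : LocallyIntegrable w) :
    ContDiff ℝ ∞ (fun p => ∫ x, w x * h p x) := by
  have key := contDiffOn_convolution_right_with_param (𝕜 := ℝ) (n := ⊤) (f := w)
    (μ := (volume : Measure ℝ))
    (ContinuousLinearMap.mul ℝ ℂ) (g := fun p x => h p (-x)) (s := univ) (k := Icc (-R) R)
    isOpen_univ isCompact_Icc (fun _ _ _ hx => H.supp _ _ (by
      by_contra! hlt
      rw [abs_neg] at hlt
      exact hx (abs_le.1 hlt))) hw
    (H.smooth.comp (contDiff_fst.prodMk contDiff_snd.neg)).contDiffOn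
  rw [univ_prod_univ, contDiffOn_univ] at key
  have := key.comp (contDiff_prodMk_left (0 : ℝ))
  simpa [Function.comp_def, MeasureTheory.convolution] using this

/-- A bump equal to 1 on the interval makes the integrand a compactly supported family, and the
indicator of the interval serves as the locally integrable weight. -/
lemma contDiff_intervalIntegral {g : E → ℝ → ℂ}
    (hg : ContDiff ℝ ∞ (fun q : E × ℝ => g q.1 q.2)) (a b : ℝ) (hab : a ≤ b) :
    ContDiff ℝ ∞ (fun p => ∫ x in a..b, g p x) := by
  let χ : ContDiffBump (0 : ℝ) := ⟨|a| + |b| + 1, |a| + |b| + 2, by positivity, by linarith⟩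
  have hF : Fam (|a| + |b| + 2) (fun p x => (χ x : ℂ) * g p x) := by
    refine ⟨by positivity, ?_, fun p x hx => ?_⟩
    · exact (Complex.ofRealCLM.contDiff.comp (χ.contDiff.comp contDiff_snd)).mul hg
    · have : χ x = 0 := χ.zero_of_le_dist (by simpa [χ] using hx.le)
      simp [this]
  have hw : LocallyIntegrable ((Ioc a b).indicator fun _ => (1 : ℂ)) :=
    ((integrable_indicator_iff measurableSet_Ioc).2
      (integrableOn_const (by simp) (by simp))).locallyIntegrable
  convert contDiff_integral_mul hF hw using 2 with p
  rw [intervalIntegral.integral_of_le hab, ← integral_indicator measurableSet_Ioc]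
  congr 1
  ext x
  by_cases hx : x ∈ Ioc a b
  · have : χ x = 1 := χ.one_of_mem_closedBall (by
      have h1 : |x| ≤ |a| + |b| + 1 := by
        rw [abs_le]
        constructor <;> linarith [hx.1, hx.2, neg_abs_le a, le_abs_self b, abs_nonneg a,
          abs_nonneg b]
      simpa [χ] using h1)
    simp [hx, this]
  · simp [hx]

/-- The smooth even function `(g x - g (-x)) / (2 x)`. -/
def oddQuot (g : ℝ → ℂ) (x : ℝ) : ℂ := 2⁻¹ * ∫ t in (-1 : ℝ)..1, deriv g (t * x)

lemma mul_oddQuot {g : ℝ → ℂ} (hg : ContDiff ℝ 1 g) (x : ℝ) :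
    (x : ℂ) * oddQuot g x = (g x - g (-x)) / 2 := by
  have h1 : ∀ t ∈ uIcc (-1 : ℝ) 1, HasDerivAt (fun t : ℝ => g (t * x))
      ((x : ℂ) * deriv g (t * x)) t := by
    intro t _
    have := (hg.differentiable (by norm_num)).differentiableAt.hasDerivAt (x := t * x)
    simpa [Function.comp_def] using HasDerivAt.scomp t this (hasDerivAt_mul_const x)
  have h2 := intervalIntegral.integral_eq_sub_of_hasDerivAt h1 (by
    have := hg.continuous_deriv (by norm_num)
    apply Continuous.intervalIntegrable
    fun_prop)
  rw [intervalIntegral.integral_const_mul] at h2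
  rw [oddQuot, mul_left_comm, h2]
  simp
  ring

lemma Fam.deriv (H : Fam R h) : Fam R (fun p => _root_.deriv (h p)) := by
  have hd : ∀ p x, _root_.deriv (h p) x =
      fderiv ℝ (fun q : E × ℝ => h q.1 q.2) (p, x) (0, 1) := by
    intro p x
    have h1 := (H.smooth.differentiable (by simp) (p, x)).hasFDerivAt
    have h2 : HasDerivAt (fun y : ℝ => ((p, y) : E × ℝ)) (0, 1) x :=
      (hasDerivAt_const x p).prodMk (hasDerivAt_id x)
    exact (h1.comp_hasDerivAt x h2).deriv
  refine ⟨H.pos, ?_, fun p x hx => ?_⟩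
  · simp only [hd]
    exact (H.smooth.fderiv_right (m := ∞) (by simp)).clm_apply contDiff_const
  · have : h p =ᶠ[nhds x] fun _ => 0 := by
      filter_upwards [(isOpen_lt continuous_const continuous_abs).mem_nhds hx] with y hy
      exact H.supp p y hy
    rw [this.deriv_eq]
    simp

lemma Fam.oddQuot (H : Fam R h) : Fam R (fun p => oddQuot (h p)) := by
  refine ⟨H.pos, ?_, fun p x hx => ?_⟩
  · unfold SLTwo.oddQuot
    refine contDiff_const.mul (contDiff_intervalIntegral (E := E × ℝ)
      (g := fun q t => _root_.deriv (h q.1) (t * q.2)) ?_ _ _ (by norm_num))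
    exact H.deriv.smooth.comp ((contDiff_fst.comp contDiff_fst).prodMk
      (contDiff_snd.mul (contDiff_snd.comp contDiff_fst)))
  · have h1 := mul_oddQuot ((H.contDiff_slice p).of_le (by simp)) x
    rw [H.supp p x hx, H.supp p (-x) (by simpa using hx)] at h1
    have hx0 : (x : ℂ) ≠ 0 := by
      have := H.pos
      rintro h0
      rw [Complex.ofReal_eq_zero] at h0
      rw [h0, abs_zero] at hx
      linarith
    simpa [hx0] using h1

end Family

lemma continuous_mul_apow {s : ℂ} (h : -1 < s.re) : Continuous fun x : ℝ => (x : ℂ) * apow s x := by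
  rw [continuous_iff_continuousAt]
  intro x
  rcases eq_or_ne x 0 with rfl | hx
  · have h1 : Filter.Tendsto (fun x : ℝ => |x| ^ (s.re + 1)) (nhds 0) (nhds 0) := by
      have : Continuous fun x : ℝ => |x| ^ (s.re + 1) :=
        continuous_abs.rpow_const fun _ => Or.inr (by linarith)
      simpa [Real.zero_rpow (by linarith : s.re + 1 ≠ 0)] using this.tendsto 0
    rw [ContinuousAt, Complex.ofReal_zero, zero_mul]
    refine squeeze_zero_norm (fun y => ?_) h1
    rcases eq_or_ne y 0 with rfl | hy
    · simpa using Real.rpow_nonneg le_rfl _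
    · rw [norm_mul, norm_apow s hy, Real.rpow_add (abs_pos.2 hy), Real.rpow_one, mul_comm]
      simp
  · refine (Complex.continuous_ofReal.continuousAt).mul ?_
    have : ContinuousAt (fun y : ℝ => Complex.exp (s * (Real.log y : ℂ))) x := by
      have := Real.continuousAt_log hx
      fun_prop
    refine this.congr ?_
    filter_upwards [isOpen_ne.mem_nhds hx] with y hy
    rw [apow_eq_exp s hy]

lemma hasDerivAt_mul_apow (s : ℂ) {x : ℝ} (hx : x ≠ 0) :
    HasDerivAt (fun x : ℝ => (x : ℂ) * apow s x) ((s + 1) * apow s x) x := by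
  have h1 : HasDerivAt (fun y : ℝ => (y : ℂ) * Complex.exp (s * (Real.log y : ℂ)))
      (1 * Complex.exp (s * (Real.log x : ℂ)) +
        x * (Complex.exp (s * (Real.log x : ℂ)) * (s * ((x⁻¹ : ℝ) : ℂ)))) x := by
    refine (HasDerivAt.ofReal_comp (hasDerivAt_id x)).mul ?_
    exact ((Real.hasDerivAt_log hx).ofReal_comp.const_mul s).cexp
  have h2 : (fun x : ℝ => (x : ℂ) * apow s x) =ᶠ[nhds x]
      fun y : ℝ => (y : ℂ) * Complex.exp (s * (Real.log y : ℂ)) := by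
    filter_upwards [isOpen_ne.mem_nhds hx] with y hy
    rw [apow_eq_exp s hy]
  refine (h1.congr_of_eventuallyEq h2).congr_deriv ?_
  rw [apow_eq_exp s hx]
  have : (x : ℂ) ≠ 0 := by exact_mod_cast hx
  push_cast
  field_simp
  ring

lemma locallyIntegrable_mul_apow {s : ℂ} (h : -2 < s.re) :
    LocallyIntegrable fun x : ℝ => apow s x * (x : ℂ) := by
  refine (locallyIntegrable_abs_rpow (r := s.re + 1) (by linarith)).mono
    ((measurable_apow s).mul Complex.measurable_ofReal).aestronglyMeasurable ?_
  filter_upwards [compl_mem_ae_iff.2 (measure_singleton (μ := volume) (0 : ℝ))] with x hx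
  rw [norm_mul, norm_apow s hx, Real.norm_of_nonneg (by positivity),
    Real.rpow_add (abs_pos.2 hx), Real.rpow_one]
  simp

lemma LocallyIntegrable.integrable_mul_of_supp {R : ℝ} {w g : ℝ → ℂ} (hw : LocallyIntegrable w)
    (hg : Continuous g) (hs : ∀ x, R < |x| → g x = 0) : Integrable fun x => w x * g x := by
  have := hw.integrable_smul_left_of_hasCompactSupport hg
    (HasCompactSupport.intro (isCompact_Icc (a := -R) (b := R)) fun x hx => hs x (by
      by_contra! hlt
      exact hx (abs_le.1 hlt)))
  simpa [mul_comm] using this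

/-- Integration by parts against `|x|^s`. -/
lemma integral_apow_mul {R : ℝ} {g : ℝ → ℂ} (hR : 0 < R) (hg : ContDiff ℝ 1 g)
    (hs : ∀ x, R < |x| → g x = 0) {s : ℂ} (h : -1 < s.re) :
    (s + 1) * ∫ x, apow s x * g x = - ∫ x, apow s x * (x * deriv g x) := by
  have hs' : ∀ x, R < |x| → deriv g x = 0 := by
    intro x hx
    have : g =ᶠ[nhds x] fun _ => 0 := by
      filter_upwards [(isOpen_lt continuous_const continuous_abs).mem_nhds hx] with y hy
      exact hs y hy
    rw [this.deriv_eq]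
    simp
  have hdc : Continuous (deriv g) := hg.continuous_deriv (by simp)
  have i1 : Integrable fun x => apow s x * g x :=
    LocallyIntegrable.integrable_mul_of_supp (locallyIntegrable_apow h) hg.continuous hs
  have i2 : Integrable fun x => apow s x * (x * deriv g x) := by
    refine LocallyIntegrable.integrable_mul_of_supp (R := R) (locallyIntegrable_apow h)
      (by fun_prop) fun x hx => ?_
    rw [hs' x hx, mul_zero]
  have i3 : Integrable fun x => (s + 1) * (apow s x * g x) + apow s x * (x * deriv g x) :=
    (i1.const_mul _).add i2
  -- The primitive x|x|^s g is continuous but possibly not differentiable at 0, hence the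
  -- exceptional set {0}. The endpoints ±(R+1) lie strictly outside the support, so there are no
  -- boundary terms.
  have key := integral_eq_of_hasDerivAt_off_countable (a := -(R + 1)) (b := R + 1)
    (fun x : ℝ => (x : ℂ) * apow s x * g x)
    (fun x => (s + 1) * (apow s x * g x) + apow s x * (x * deriv g x)) (s := {0})
    (countable_singleton 0)
    ((continuous_mul_apow h).mul hg.continuous).continuousOn
    (fun x hx => by
      have := (hasDerivAt_mul_apow s hx.2).mul
        ((hg.differentiable (by norm_num)).differentiableAt.hasDerivAt (x := x))
      refine this.congr_deriv ?_
      ring) i3.intervalIntegrable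
  rw [hs (R + 1) (by rw [abs_of_pos] <;> linarith), hs (-(R + 1)) (by
    rw [abs_neg, abs_of_pos] <;> linarith), intervalIntegral.integral_of_le (by linarith),
    setIntegral_eq_integral_of_forall_compl_eq_zero, integral_add (i1.const_mul _) i2,
    integral_const_mul] at key
  · rw [eq_neg_iff_add_eq_zero, key]
    simp
  · intro x hx
    have : R < |x| := by
      by_contra! hlt
      have := abs_le.1 hlt
      exact hx ⟨by linarith, by linarith⟩
    rw [hs x this, hs' x this]
    simp

/-- Only the even part of x g(x) pairs with the even power, and that part is x² · `oddQuot g`. The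
factor x² raises the exponent by 2. Convergence for Re s > -2 is due to the factor x. -/
lemma integral_apow_mul_odd {R : ℝ} {g : ℝ → ℂ} (hg : ContDiff ℝ 1 g)
    (hs : ∀ x, R < |x| → g x = 0) {s : ℂ} (h : -2 < s.re) :
    ∫ x, apow s x * (x * g x) = ∫ x, apow (s + 2) x * oddQuot g x := by
  have i1 : Integrable fun x => apow s x * (x * g x) := by
    simpa [mul_assoc] using LocallyIntegrable.integrable_mul_of_supp
      (locallyIntegrable_mul_apow h) hg.continuous hs
  have e1 := integral_neg_eq_self (fun x => apow s x * (x * g x)) volume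
  have e2 : ∫ x, (apow s x * (x * g x) + apow s (-x) * ((-x : ℝ) * g (-x))) =
      2 * ∫ x, apow s x * (x * g x) := by
    rw [integral_add i1 i1.comp_neg, e1, two_mul]
  have e3 : (fun x : ℝ => apow s x * (x * g x) + apow s (-x) * ((-x : ℝ) * g (-x))) =ᵐ[volume]
      fun x => 2 * (apow (s + 2) x * oddQuot g x) := by
    filter_upwards [compl_mem_ae_iff.2 (measure_singleton (μ := volume) (0 : ℝ))] with x hx
    have := mul_oddQuot hg x
    rw [apow_neg, apow_add_two hx]
    push_cast
    linear_combination (-2 * apow s x * x) * this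
  rw [integral_congr_ae e3, integral_const_mul] at e2
  exact (mul_left_cancel₀ two_ne_zero e2).symm

/-! ### Holomorphic dependence of integrals on a parameter -/

lemma norm_deriv_le_of_ball {F : ℂ → ℂ} {s : ℂ} {r C : ℝ} (hr : 0 < r)
    (hF : DifferentiableOn ℂ F (Metric.ball s (2 * r)))
    (hC : ∀ z ∈ Metric.ball s (2 * r), ‖F z‖ ≤ C) {z : ℂ} (hz : z ∈ Metric.ball s r) :
    ‖deriv F z‖ ≤ C / (r / 2) := by
  have hsub : Metric.closedBall z (r / 2) ⊆ Metric.ball s (2 * r) := by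
    refine Metric.closedBall_subset_ball' ?_
    have := Metric.mem_ball.1 hz
    linarith
  refine Complex.norm_deriv_le_of_forall_mem_sphere_norm_le (by positivity) ?_ fun w hw =>
    hC w (hsub (Metric.sphere_subset_closedBall hw))
  exact (hF.mono hsub).diffContOnCl_ball le_rfl

/-- Integrals of holomorphic functions of a parameter under a locally uniform integrable bound. -/
lemma differentiableAt_integral_of_bound {X : Type*} [MeasurableSpace X] {m : Measure X}
    {F : ℂ → X → ℂ} {s : ℂ} {V : Set ℂ} (hV : V ∈ nhds s)
    (hm : ∀ z ∈ V, AEStronglyMeasurable (F z) m) {b : X → ℝ} (hb : Integrable b m)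
    (hF : ∀ᵐ x ∂m, ∀ z ∈ V, ‖F z x‖ ≤ b x)
    (hd : ∀ᵐ x ∂m, DifferentiableOn ℂ (fun z => F z x) V) :
    DifferentiableAt ℂ (fun z => ∫ x, F z x ∂m) s := by
  obtain ⟨r', hr', hrV⟩ := Metric.mem_nhds_iff.1 hV
  obtain ⟨r, hr, rfl⟩ : ∃ r : ℝ, 0 < r ∧ r' = 2 * r := ⟨r' / 2, by positivity, by ring⟩
  have hball : Metric.ball s r ⊆ Metric.ball s (2 * r) := Metric.ball_subset_ball (by linarith)
  have hsV : s ∈ V := mem_of_mem_nhds hV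
  have hdiff : ∀ᵐ x ∂m, ∀ z ∈ Metric.ball s r, HasDerivAt (fun z => F z x)
      (deriv (fun z => F z x) z) z := by
    filter_upwards [hd] with x hx z hz
    exact ((hx.mono hrV).differentiableAt (Metric.isOpen_ball.mem_nhds (hball hz))).hasDerivAt
  refine (hasDerivAt_integral_of_dominated_loc_of_deriv_le (Metric.ball_mem_nhds s hr)
    (F' := fun z x => deriv (fun z => F z x) z) (bound := fun x => b x / (r / 2))
    ?_ ?_ ?_ ?_ ?_ hdiff).2.differentiableAt
  · filter_upwards [hV] with z hz using hm z hz
  · exact hb.mono' (hm s hsV) (hF.mono fun x hx => hx s hsV)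
  -- The derivative at s is measurable in x as a pointwise limit of difference quotients along the
  -- points s + r/(2(n+1)), which stay in the ball.
  · have hu : Filter.Tendsto (fun n : ℕ => ((r / 2 / (n + 1) : ℝ) : ℂ)) Filter.atTop (nhds 0) := by
      have : Filter.Tendsto (fun n : ℕ => (r / 2 : ℝ) * (1 / ((n : ℝ) + 1))) Filter.atTop
          (nhds ((r / 2) * 0)) :=
        tendsto_one_div_add_atTop_nhds_zero_nat.const_mul _
      have h2 := (Complex.continuous_ofReal.tendsto _).comp this
      simpa [Function.comp_def, div_eq_mul_inv] using h2
    have hu0 : ∀ n : ℕ, ((r / 2 / (n + 1) : ℝ) : ℂ) ≠ 0 := fun n => by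
      have : (r / 2 / (n + 1) : ℝ) ≠ 0 := by positivity
      exact_mod_cast this
    refine aestronglyMeasurable_of_tendsto_ae Filter.atTop
      (f := fun (n : ℕ) x => ((r / 2 / (n + 1) : ℝ) : ℂ)⁻¹ •
        (F (s + ((r / 2 / (n + 1) : ℝ) : ℂ)) x - F s x)) (fun n => ?_) ?_
    · refine AEStronglyMeasurable.const_smul (((hm _ (hrV ?_)).sub (hm s hsV)))
        (((r / 2 / (n + 1) : ℝ) : ℂ)⁻¹)
      rw [Metric.mem_ball, dist_eq_norm, add_sub_cancel_left, Complex.norm_real,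
        Real.norm_of_nonneg (by positivity)]
      have : r / 2 / ((n : ℝ) + 1) ≤ r / 2 :=
        div_le_self (by positivity) (by linarith [(Nat.cast_nonneg n : (0 : ℝ) ≤ n)])
      linarith
    · filter_upwards [hdiff] with x hx
      have := (hx s (Metric.mem_ball_self hr)).tendsto_slope_zero
      exact this.comp (tendsto_nhdsWithin_iff.2 ⟨hu, Filter.Eventually.of_forall fun n => hu0 n⟩)
  · filter_upwards [hF, hd] with x hx hdx z hz
    exact norm_deriv_le_of_ball hr (hdx.mono hrV) (fun w hw => hx w (hrV hw)) hz
  · exact hb.div_const _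

lemma rpow_le_add {t a b r : ℝ} (ht : 0 < t) (ha : a ≤ r) (hb : r ≤ b) :
    t ^ r ≤ t ^ a + t ^ b := by
  rcases le_total t 1 with h | h
  · have := Real.rpow_le_rpow_of_exponent_ge ht h ha
    linarith [Real.rpow_nonneg ht.le b]
  · have := Real.rpow_le_rpow_of_exponent_le h hb
    linarith [Real.rpow_nonneg ht.le a]

lemma differentiable_apow {x : ℝ} (hx : x ≠ 0) : Differentiable ℂ fun s => apow s x := by
  simp_rw [fun s => apow_eq_exp s hx]
  fun_prop

lemma ae_ne_zero : ∀ᵐ x : ℝ, x ≠ 0 :=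
  compl_mem_ae_iff.2 (measure_singleton (μ := volume) (0 : ℝ))

/-- The vertical strip around `s`, in which the powers `|x|^z` have a common integrable bound. -/
def nearStrip (s : ℂ) : Set ℂ := {z | (s.re - 1) / 2 < z.re ∧ z.re < s.re + 1}

lemma nearStrip_mem_nhds {s : ℂ} (hs : -1 < s.re) : nearStrip s ∈ nhds s := by
  refine IsOpen.mem_nhds ?_ ⟨by linarith, by linarith⟩
  exact (isOpen_lt continuous_const Complex.continuous_re).inter
    (isOpen_lt Complex.continuous_re continuous_const)

/-- The common bound of the powers `|x|^z` on `nearStrip`. -/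
def stripBound (s : ℂ) (x : ℝ) : ℝ := |x| ^ ((s.re - 1) / 2) + |x| ^ (s.re + 1)

lemma norm_apow_le_stripBound {s z : ℂ} (hz : z ∈ nearStrip s) {x : ℝ} (hx : x ≠ 0) :
    ‖apow z x‖ ≤ stripBound s x := by
  rw [norm_apow z hx]
  exact rpow_le_add (abs_pos.2 hx) hz.1.le hz.2.le

lemma locallyIntegrable_stripBound {s : ℂ} (hs : -1 < s.re) :
    LocallyIntegrable (stripBound s) :=
  (locallyIntegrable_abs_rpow (by linarith)).add (locallyIntegrable_abs_rpow (by linarith))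

lemma stripBound_nonneg (s : ℂ) (x : ℝ) : 0 ≤ stripBound s x := by
  unfold stripBound
  positivity

lemma integrable_indicator_stripBound {s : ℂ} (hs : -1 < s.re) (R B : ℝ) :
    Integrable ((Icc (-R) R).indicator fun x => stripBound s x * B) := by
  rw [integrable_indicator_iff measurableSet_Icc]
  exact ((locallyIntegrable_stripBound hs).integrableOn_isCompact isCompact_Icc).mul_const B

/-! ### Entire continuation of |x|^s_ε / Γ((s+1+ε)/2) -/

section Family

variable {E : Type*} [NormedAddCommGroup E] [NormedSpace ℝ E] {R : ℝ} {h : E → ℝ → ℂ}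

lemma Fam.exists_bound [ProperSpace E] (H : Fam R h) (p : E) :
    ∃ B : ℝ, 0 ≤ B ∧ ∀ q ∈ Metric.ball p 1, ∀ x, ‖h q x‖ ≤ B := by
  obtain ⟨B, hB⟩ := ((isCompact_closedBall p 1).prod (isCompact_Icc (a := -R) (b := R))
    ).exists_bound_of_continuousOn H.smooth.continuous.continuousOn
  refine ⟨max B 0, le_max_right _ _, fun q hq x => ?_⟩
  by_cases hx : R < |x|
  · rw [H.supp q x hx, norm_zero]
    exact le_max_right _ _
  · exact (hB (q, x) ⟨Metric.ball_subset_closedBall hq, abs_le.1 (not_lt.1 hx)⟩).trans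
      (le_max_left _ _)

lemma Fam.norm_apow_mul_le (H : Fam R h) {s z : ℂ} (hz : z ∈ nearStrip s) {q : E} {B : ℝ}
    (hB : ∀ x, ‖h q x‖ ≤ B) {x : ℝ} (hx : x ≠ 0) :
    ‖apow z x * h q x‖ ≤ (Icc (-R) R).indicator (fun x => stripBound s x * B) x := by
  by_cases hxR : x ∈ Icc (-R) R
  · rw [indicator_of_mem hxR, norm_mul]
    exact mul_le_mul (norm_apow_le_stripBound hz hx) (hB x) (norm_nonneg _) (stripBound_nonneg s x)
  · rw [indicator_of_notMem hxR, H.supp q x (by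
      by_contra! hlt
      exact hxR (abs_le.1 hlt))]
    simp

lemma Fam.aestronglyMeasurable (H : Fam R h) (s : ℂ) (q : E) :
    AEStronglyMeasurable (fun x => apow s x * h q x) :=
  ((measurable_apow s).mul (H.contDiff_slice q).continuous.measurable).aestronglyMeasurable

lemma Fam.continuousAt_integral [ProperSpace E] (H : Fam R h) {s : ℂ} (hs : -1 < s.re) (p : E) :
    ContinuousAt (fun q : ℂ × E => ∫ x, apow q.1 x * h q.2 x) (s, p) := by
  obtain ⟨B, -, hB⟩ := H.exists_bound p
  refine continuousAt_of_dominated (Filter.Eventually.of_forall fun q =>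
    H.aestronglyMeasurable q.1 q.2) ?_ (integrable_indicator_stripBound hs R B) ?_
  · filter_upwards [prod_mem_nhds (nearStrip_mem_nhds hs) (Metric.ball_mem_nhds p one_pos)]
      with q hq
    filter_upwards [ae_ne_zero] with x hx
    exact H.norm_apow_mul_le hq.1 (hB q.2 hq.2) hx
  · filter_upwards [ae_ne_zero] with x hx
    refine ContinuousAt.mul ?_ ?_
    · exact ((differentiable_apow hx).continuous.comp continuous_fst).continuousAt
    · exact (H.smooth.continuous.comp (continuous_snd.prodMk continuous_const)).continuousAt

lemma Fam.differentiableAt_integral (H : Fam R h) {s : ℂ} (hs : -1 < s.re) (p : E) :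
    DifferentiableAt ℂ (fun z => ∫ x, apow z x * h p x) s := by
  have H' : Fam R (fun _ : ℝ => h p) := H.comp (g := fun _ => p) contDiff_const
  obtain ⟨B, -, hB⟩ := H'.exists_bound 0
  refine differentiableAt_integral_of_bound (nearStrip_mem_nhds hs)
    (fun z _ => H.aestronglyMeasurable z p) (integrable_indicator_stripBound hs R B) ?_ ?_
  · filter_upwards [ae_ne_zero] with x hx z hz
    exact H.norm_apow_mul_le hz (hB 0 (Metric.mem_ball_self one_pos)) hx
  · filter_upwards [ae_ne_zero] with x hx
    exact ((differentiable_apow hx).mul_const _).differentiableOn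

/-- One step of the continuation of the even powers. -/
def rieszStep (g : ℝ → ℂ) : ℝ → ℂ := oddQuot (deriv g)

/-- The normalized distribution `|x|^s / Γ((s+1)/2)`, in the half-plane `Re s > -1 - 2N`. -/
def rieszEven (N : ℕ) (s : ℂ) (g : ℝ → ℂ) : ℂ :=
  (-1 / 2) ^ N * (Complex.Gamma ((s + 1 + 2 * N) / 2))⁻¹ *
    ∫ x, apow (s + 2 * N) x * (rieszStep^[N] g) x

/-- The entire continuation of the distribution `|x|^s_ε / Γ((s+1+ε)/2)`. -/
def riesz (ε : ZMod 2) (s : ℂ) (g : ℝ → ℂ) : ℂ :=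
  rieszEven ⌈-s.re⌉₊ (s + ε.val) (oddQuot^[ε.val] g)

lemma Fam.rieszStep (H : Fam R h) (N : ℕ) : Fam R (fun p => rieszStep^[N] (h p)) := by
  induction N with
  | zero => exact H
  | succ N ih =>
    simp_rw [Function.iterate_succ_apply']
    exact ih.deriv.oddQuot

lemma Fam.oddQuot_iterate (H : Fam R h) (n : ℕ) : Fam R (fun p => SLTwo.oddQuot^[n] (h p)) := by
  induction n with
  | zero => exact H
  | succ n ih =>
    simp_rw [Function.iterate_succ_apply']
    exact ih.oddQuot

/-- With t = s + 2N, integration by parts and `integral_apow_mul_odd` replace the pairing of |x|^t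
with g by -1/(t+1) times that of |x|^{t+2} with `rieszStep g`. The factor is -1/2 divided by
(t+1)/2, and the latter is absorbed by Γ(z+1) = zΓ(z). -/
lemma Fam.rieszEven_succ (H : Fam R h) (p : E) {N : ℕ} {s : ℂ} (hs : -1 < s.re + 2 * N) :
    rieszEven (N + 1) s (h p) = rieszEven N s (h p) := by
  set t : ℂ := s + 2 * N with ht
  have htre : -1 < t.re := by simpa [ht] using hs
  have HN := H.rieszStep N
  have h1 := integral_apow_mul H.pos ((HN.contDiff_slice p).of_le (by simp)) (HN.supp p) htre
  have h2 := integral_apow_mul_odd ((HN.deriv.contDiff_slice p).of_le (by simp)) (HN.deriv.supp p)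
    (s := t) (by linarith)
  have ht1 : t + 1 ≠ 0 := by
    intro h0
    have := congrArg Complex.re h0
    simp at this
    linarith
  have hG := Complex.Gamma_add_one ((t + 1) / 2) (by simpa using ht1)
  rw [rieszEven, rieszEven, Function.iterate_succ_apply', SLTwo.rieszStep]
  have e1 : (s + 1 + 2 * ((N + 1 : ℕ) : ℂ)) / 2 = (t + 1) / 2 + 1 := by
    rw [ht]; push_cast; ring
  have e2 : s + 2 * ((N + 1 : ℕ) : ℂ) = t + 2 := by rw [ht]; push_cast; ring
  have e3 : (s + 1 + 2 * (N : ℂ)) / 2 = (t + 1) / 2 := by rw [ht]; ring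
  rw [e1, e2, e3, hG, ← h2, ← ht, eq_neg_iff_add_eq_zero.1 h1 |> eq_neg_of_add_eq_zero_right]
  rw [mul_inv, pow_succ]
  field_simp

lemma Fam.rieszEven_eq (H : Fam R h) (p : E) {N K : ℕ} {s : ℂ} (hN : -1 < s.re + 2 * N)
    (hK : -1 < s.re + 2 * K) : rieszEven N s (h p) = rieszEven K s (h p) := by
  have key : ∀ n : ℕ, ∀ M : ℕ, -1 < s.re + 2 * M →
      rieszEven (M + n) s (h p) = rieszEven M s (h p) := by
    intro n
    induction n with
    | zero => intro M _; rfl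
    | succ n ih =>
      intro M hM
      rw [← add_assoc, H.rieszEven_succ p, ih M hM]
      push_cast
      linarith [(Nat.cast_nonneg n : (0 : ℝ) ≤ n)]
  rcases le_total N K with hle | hle
  · obtain ⟨n, rfl⟩ := Nat.exists_eq_add_of_le hle
    exact (key n N hN).symm
  · obtain ⟨n, rfl⟩ := Nat.exists_eq_add_of_le hle
    exact key n K hK

lemma ceil_spec (s : ℂ) : -1 < s.re + 2 * ⌈-s.re⌉₊ := by
  have h1 := Nat.le_ceil (-s.re)
  have h2 : (0 : ℝ) ≤ ⌈-s.re⌉₊ := Nat.cast_nonneg _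
  rcases le_total 0 s.re with h | h <;> linarith

/-- The ceiling in the definition of `riesz` jumps with s. Any N large enough gives the same value,
so N can be frozen near a given s, and all regularity in s is obtained from that formula. -/
lemma Fam.riesz_eq (H : Fam R h) (p : E) (ε : ZMod 2) {s : ℂ} (N : ℕ) (hN : -1 < s.re + 2 * N) :
    riesz ε s (h p) = rieszEven N (s + ε.val) (SLTwo.oddQuot^[ε.val] (h p)) := by
  have h0 : (0 : ℝ) ≤ ε.val := Nat.cast_nonneg _
  refine (H.oddQuot_iterate ε.val).rieszEven_eq p ?_ ?_
  · have := ceil_spec s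
    simp [-ZMod.natCast_val]
    linarith
  · simp [-ZMod.natCast_val]
    linarith

/-- The family by which the continued distribution is an absolutely convergent integral. -/
def rieszFam (ε : ZMod 2) (N : ℕ) (g : ℝ → ℂ) : ℝ → ℂ := SLTwo.rieszStep^[N] (oddQuot^[ε.val] g)

lemma Fam.rieszFam (H : Fam R h) (ε : ZMod 2) (N : ℕ) : Fam R (fun p => rieszFam ε N (h p)) :=
  (H.oddQuot_iterate ε.val).rieszStep N

/-- The factor in the representation by an absolutely convergent integral. -/
def rieszConst (ε : ZMod 2) (N : ℕ) (s : ℂ) : ℂ :=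
  (-1 / 2) ^ N * (Complex.Gamma ((s + ε.val + 1 + 2 * N) / 2))⁻¹

lemma differentiable_rieszConst (ε : ZMod 2) (N : ℕ) : Differentiable ℂ (rieszConst ε N) := by
  have := Complex.differentiable_one_div_Gamma.comp
    (g := fun z => (Complex.Gamma z)⁻¹) (f := fun s : ℂ => (s + ε.val + 1 + 2 * N) / 2)
    (by fun_prop)
  exact this.const_mul _

lemma Fam.riesz_eq_integral (H : Fam R h) (p : E) (ε : ZMod 2) {s : ℂ} (N : ℕ)
    (hN : -1 < s.re + 2 * N) :
    riesz ε s (h p) = rieszConst ε N s *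
      ∫ x, apow (s + ε.val + 2 * N) x * SLTwo.rieszFam ε N (h p) x := by
  rw [H.riesz_eq p ε N hN]
  rfl

lemma exists_nat_re (s : ℂ) : ∃ N : ℕ, -1 < s.re + 2 * N := ⟨_, ceil_spec s⟩

lemma re_shift_mem {ε : ZMod 2} {s : ℂ} {N : ℕ} (hN : -1 < s.re + 2 * N) :
    -1 < (s + ε.val + 2 * N).re := by
  have h0 : (0 : ℝ) ≤ ε.val := Nat.cast_nonneg _
  simp [-ZMod.natCast_val]
  linarith

lemma eventually_re_shift {s : ℂ} {N : ℕ} (hN : -1 < s.re + 2 * N) :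
    ∀ᶠ z : ℂ in nhds s, -1 < z.re + 2 * N :=
  (isOpen_lt continuous_const (Complex.continuous_re.add continuous_const)).mem_nhds hN

lemma Fam.differentiable_riesz (H : Fam R h) (p : E) (ε : ZMod 2) :
    Differentiable ℂ fun s => riesz ε s (h p) := by
  intro s
  obtain ⟨N, hN⟩ := exists_nat_re s
  have h1 : DifferentiableAt ℂ (fun s => rieszConst ε N s *
      ∫ x, apow (s + ε.val + 2 * N) x * SLTwo.rieszFam ε N (h p) x) s := by
    refine (differentiable_rieszConst ε N s).mul ?_
    exact DifferentiableAt.comp s (g := fun s => ∫ x, apow s x * SLTwo.rieszFam ε N (h p) x)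
      (f := fun s : ℂ => s + ε.val + 2 * N)
      ((H.rieszFam ε N).differentiableAt_integral (re_shift_mem hN) p) (by fun_prop)
  refine h1.congr_of_eventuallyEq ?_
  filter_upwards [eventually_re_shift hN] with z hz
  exact H.riesz_eq_integral p ε N hz

lemma Fam.continuous_riesz [ProperSpace E] (H : Fam R h) (ε : ZMod 2) :
    Continuous fun q : ℂ × E => riesz ε q.1 (h q.2) := by
  rw [continuous_iff_continuousAt]
  rintro ⟨s, p⟩
  obtain ⟨N, hN⟩ := exists_nat_re s
  have h1 : ContinuousAt (fun q : ℂ × E => rieszConst ε N q.1 *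
      ∫ x, apow (q.1 + ε.val + 2 * N) x * SLTwo.rieszFam ε N (h q.2) x) (s, p) := by
    refine ((differentiable_rieszConst ε N).continuous.comp continuous_fst).continuousAt.mul ?_
    exact ContinuousAt.comp (g := fun q : ℂ × E => ∫ x, apow q.1 x * SLTwo.rieszFam ε N (h q.2) x)
      (f := fun q : ℂ × E => (q.1 + ε.val + 2 * N, q.2)) (x := (s, p))
      ((H.rieszFam ε N).continuousAt_integral (re_shift_mem hN) p) (by fun_prop)
  refine h1.congr ?_
  filter_upwards [continuousAt_fst.eventually (eventually_re_shift (s := s) hN)] with z hz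
  exact (H.riesz_eq_integral z.2 ε N hz).symm

lemma Fam.contDiff_riesz (H : Fam R h) (ε : ZMod 2) (s : ℂ) :
    ContDiff ℝ ∞ fun p => riesz ε s (h p) := by
  obtain ⟨N, hN⟩ := exists_nat_re s
  simp_rw [fun p => H.riesz_eq_integral p ε N hN]
  exact contDiff_const.mul
    (contDiff_integral_mul (H.rieszFam ε N) (locallyIntegrable_apow (re_shift_mem hN)))

lemma zmod_two_cases (ε : ZMod 2) : ε = 0 ∨ ε = 1 := by
  revert ε
  decide

lemma spow_zero_left (s : ℂ) (x : ℝ) : spow 0 s x = apow s x := by simp [spow, apow]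

lemma spow_one_left (s : ℂ) (x : ℝ) : spow 1 s x = (Real.sign x : ℂ) * apow s x := by
  simp [spow, apow, ZMod.val_one]

lemma norm_spow (ε : ZMod 2) (s : ℂ) {x : ℝ} (hx : x ≠ 0) : ‖spow ε s x‖ = |x| ^ s.re := by
  have h1 : ‖(Real.sign x : ℂ)‖ = 1 := by
    rcases Real.sign_apply_eq_of_ne_zero x hx with h | h <;> simp [h]
  rw [spow, norm_mul, norm_pow, h1, one_pow, one_mul, ← norm_apow s hx, apow]

lemma measurable_spow (ε : ZMod 2) (s : ℂ) : Measurable (spow ε s) := by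
  have : Measurable Real.sign := by
    unfold Real.sign
    exact Measurable.ite measurableSet_Iio measurable_const
      (Measurable.ite measurableSet_Ioi measurable_const measurable_const)
  unfold spow
  fun_prop

lemma locallyIntegrable_spow (ε : ZMod 2) {s : ℂ} (hs : -1 < s.re) :
    LocallyIntegrable (spow ε s) := by
  refine (locallyIntegrable_abs_rpow hs).mono (measurable_spow ε s).aestronglyMeasurable ?_
  filter_upwards [ae_ne_zero] with x hx
  rw [norm_spow ε s hx, Real.norm_of_nonneg (by positivity)]

lemma spow_one_eq {x : ℝ} (hx : x ≠ 0) (s : ℂ) : spow 1 s x = apow (s - 1) x * x := by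
  have h1 : apow s x = apow (s - 1) x * (|x| : ℝ) := by
    conv_lhs => rw [show s = (s - 1) + 1 by ring, apow_add hx]
    congr 1
    simp [apow]
  rw [spow_one_left, h1, mul_left_comm]
  congr 1
  rw [← Complex.ofReal_mul]
  congr 1
  rcases lt_or_gt_of_ne hx with h | h
  · rw [Real.sign_of_neg h, abs_of_neg h]; ring
  · rw [Real.sign_of_pos h, abs_of_pos h]; ring

/-- In the half-plane of convergence the distribution is given by its integral. -/
lemma Fam.riesz_eq_integral_spow (H : Fam R h) (p : E) (ε : ZMod 2) {s : ℂ} (hs : -1 < s.re) :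
    riesz ε s (h p) = (Complex.Gamma ((s + 1 + ε.val) / 2))⁻¹ * ∫ x, spow ε s x * h p x := by
  rw [H.riesz_eq p ε 0 (by simpa using hs), rieszEven]
  rcases zmod_two_cases ε with rfl | rfl
  · simp [spow_zero_left]
  -- Since sgn(x)|x|^s = |x|^{s-1} x, the odd power of exponent s acts as the even power of exponent
  -- s+1 on `oddQuot` of the function. This explains the shift by ε in `riesz`.
  · have h1 := integral_apow_mul_odd ((H.contDiff_slice p).of_le (by simp)) (H.supp p)
      (s := s - 1) (by simp; linarith)
    have h2 : ∫ x, spow 1 s x * h p x = ∫ x, apow (s - 1) x * (x * h p x) := by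
      refine integral_congr_ae ?_
      filter_upwards [ae_ne_zero] with x hx
      rw [spow_one_eq hx, mul_assoc]
    rw [h2, h1]
    have e1 : s - 1 + 2 = s + 1 := by ring
    simp [ZMod.val_one, e1]

end Family

/-! ### Convolution with |sin τ|^{ν-1} on the circle -/

/-- A smooth cutoff, equal to `1` near `0` and supported in `[-1/2, 1/2]`. -/
def cutoff : ContDiffBump (0 : ℝ) := ⟨1 / 4, 1 / 2, by norm_num, by norm_num⟩

lemma cutoff_eq_one {y : ℝ} (hy : |y| ≤ 1 / 4) : cutoff y = 1 :=
  cutoff.one_of_mem_closedBall (by simpa [cutoff] using hy)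

lemma cutoff_eq_zero {y : ℝ} (hy : 1 / 2 ≤ |y|) : cutoff y = 0 :=
  cutoff.zero_of_le_dist (by simpa [cutoff] using hy)

/-- The part near `τ = 0` of a function of the angle, in the coordinate `y = sin τ`. -/
def nearPart (Φ : ℝ → ℂ) (y : ℝ) : ℂ :=
  (cutoff y : ℂ) * (((√(1 - y ^ 2))⁻¹ : ℝ) : ℂ) * Φ (Real.arcsin y)

/-- The square root and the arcsine are smooth for |y| < 1, and the cutoff is already zero for |y| ≥
1/2, so their singularities at ±1 do no harm. -/
lemma fam_nearPart {E : Type*} [NormedAddCommGroup E] [NormedSpace ℝ E] {Φ : E → ℝ → ℂ}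
    (hΦ : ContDiff ℝ ∞ fun q : E × ℝ => Φ q.1 q.2) : Fam (1 / 2) fun p => nearPart (Φ p) := by
  refine ⟨by norm_num, ?_, fun p x hx => ?_⟩
  · rw [contDiff_iff_contDiffAt]
    rintro ⟨p, y⟩
    by_cases hy : |y| < 1
    · have hy' := abs_lt.1 hy
      have h1 : ContDiffAt ℝ ∞ (fun q : E × ℝ => ((cutoff q.2 : ℝ) : ℂ)) (p, y) :=
        (Complex.ofRealCLM.contDiff.comp (cutoff.contDiff.comp contDiff_snd)).contDiffAt
      have h2 : ContDiffAt ℝ ∞ (fun q : E × ℝ => (√(1 - q.2 ^ 2))⁻¹) (p, y) := by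
        have h0 : (1 - y ^ 2 : ℝ) ≠ 0 := by nlinarith
        have h00 : √(1 - y ^ 2) ≠ 0 := by
          rw [Real.sqrt_ne_zero']
          nlinarith
        have : ContDiffAt ℝ ∞ (fun q : E × ℝ => 1 - q.2 ^ 2) (p, y) := by fun_prop
        exact (this.sqrt h0).inv h00
      have h3 : ContDiffAt ℝ ∞ (fun q : E × ℝ => Φ q.1 (Real.arcsin q.2)) (p, y) := by
        have ha : ContDiffAt ℝ ∞ (fun q : E × ℝ => Real.arcsin q.2) (p, y) :=
          (Real.contDiffAt_arcsin (by linarith) (by linarith)).comp (p, y)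
            contDiff_snd.contDiffAt
        exact hΦ.contDiffAt.comp (p, y) (contDiff_fst.contDiffAt.prodMk ha)
      exact (h1.mul (Complex.ofRealCLM.contDiff.contDiffAt.comp (p, y) h2)).mul h3
    · have : (fun q : E × ℝ => nearPart (Φ q.1) q.2) =ᶠ[nhds (p, y)] fun _ => 0 := by
        have ho : IsOpen {q : E × ℝ | 1 / 2 < |q.2|} :=
          isOpen_lt continuous_const (continuous_abs.comp continuous_snd)
        filter_upwards [ho.mem_nhds (show 1 / 2 < |y| by linarith)] with q hq
        rw [nearPart, cutoff_eq_zero (le_of_lt hq)]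
        simp
      exact contDiffAt_const.congr_of_eventuallyEq this
  · rw [nearPart, cutoff_eq_zero hx.le]
    simp

/-- The weight of the part away from `τ = 0`. -/
def farWeight (ε : ZMod 2) (ν : ℂ) (τ : ℝ) : ℂ :=
  spow ε (ν - 1) (Real.sin τ) * (1 - (cutoff (Real.sin τ) : ℂ))

lemma spow_eq_of_ne_zero (ε : ZMod 2) (s : ℂ) {x : ℝ} (hx : x ≠ 0) :
    spow ε s x = (((x / |x|) ^ ε.val : ℝ) : ℂ) * Complex.exp (s * (Real.log x : ℂ)) := by
  have h1 : Real.sign x = x / |x| := by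
    rcases lt_or_gt_of_ne hx with h | h
    · rw [Real.sign_of_neg h, abs_of_neg h]; field_simp
    · rw [Real.sign_of_pos h, abs_of_pos h]; field_simp
  rw [spow, h1, ← apow_eq_exp s hx, apow]
  push_cast
  rfl

/-- The power is singular only where sin τ = 0, and the factor 1 - cutoff vanishes identically for
|sin τ| ≤ 1/4. -/
lemma continuous_farWeight (ε : ZMod 2) : Continuous fun q : ℂ × ℝ => farWeight ε q.1 q.2 := by
  rw [continuous_iff_continuousAt]
  rintro ⟨ν, τ⟩
  by_cases h : Real.sin τ = 0
  · have : (fun q : ℂ × ℝ => farWeight ε q.1 q.2) =ᶠ[nhds (ν, τ)] fun _ => 0 := by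
      have ho : IsOpen {q : ℂ × ℝ | |Real.sin q.2| < 1 / 4} :=
        isOpen_lt (by fun_prop) continuous_const
      filter_upwards [ho.mem_nhds (show |Real.sin τ| < 1 / 4 by rw [h]; norm_num)] with q hq
      rw [farWeight, cutoff_eq_one (le_of_lt hq)]
      simp
    exact continuousAt_const.congr this.symm
  · have h2 : ContinuousAt (fun q : ℂ × ℝ => (((Real.sin q.2 / |Real.sin q.2|) ^ ε.val : ℝ) : ℂ) *
        Complex.exp ((q.1 - 1) * (Real.log (Real.sin q.2) : ℂ)) *
          (1 - (cutoff (Real.sin q.2) : ℂ))) (ν, τ) := by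
      have hc : Continuous fun y : ℝ => cutoff y := cutoff.continuous
      have h3 : ContinuousAt (fun q : ℂ × ℝ => Real.log (Real.sin q.2)) (ν, τ) :=
        ContinuousAt.comp (g := Real.log) (Real.continuousAt_log h) (by fun_prop)
      have h4 : ContinuousAt (fun q : ℂ × ℝ => Real.sin q.2 / |Real.sin q.2|) (ν, τ) :=
        ContinuousAt.div (by fun_prop) (by fun_prop) (by simpa using h)
      fun_prop
    refine h2.congr ?_
    have ho : IsOpen {q : ℂ × ℝ | Real.sin q.2 ≠ 0} :=
      isOpen_ne_fun (by fun_prop) continuous_const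
    filter_upwards [ho.mem_nhds h] with q hq
    rw [farWeight, spow_eq_of_ne_zero ε _ hq]

lemma differentiable_farWeight (ε : ZMod 2) (τ : ℝ) : Differentiable ℂ fun ν => farWeight ε ν τ := by
  by_cases h : Real.sin τ = 0
  · have : (fun ν => farWeight ε ν τ) = fun _ => 0 := by
      ext ν
      rw [farWeight, cutoff_eq_one (by rw [h]; norm_num)]
      simp
    rw [this]
    fun_prop
  · simp_rw [farWeight, fun s => spow_eq_of_ne_zero ε s h]
    fun_prop

/-- The normalized convolution with `|sin τ|_ε^{ν-1}` on the circle, for all `ν`. -/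
def circT (ε : ZMod 2) (ν : ℂ) (Φ : ℝ → ℂ) : ℂ :=
  riesz ε (ν - 1) (nearPart Φ) + (Complex.Gamma ((ν + ε.val) / 2))⁻¹ *
    ∫ τ in (-(Real.pi / 2))..(Real.pi / 2), farWeight ε ν τ * Φ τ

/-- `Complex.Gamma` is 0 at its poles and 0⁻¹ = 0, so the literal inverse is the entire function
1/Γ. The same convention gives the intended value to divisions by Γ at poles. -/
lemma differentiable_inv_Gamma_comp {g : ℂ → ℂ} (hg : Differentiable ℂ g) :
    Differentiable ℂ fun ν => (Complex.Gamma (g ν))⁻¹ :=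
  Complex.differentiable_one_div_Gamma.comp (g := fun z => (Complex.Gamma z)⁻¹) hg

section Family

variable {E : Type*} [NormedAddCommGroup E] [NormedSpace ℝ E] {Φ : E → ℝ → ℂ}

lemma continuous_circT [ProperSpace E] (hΦ : ContDiff ℝ ∞ fun q : E × ℝ => Φ q.1 q.2)
    (ε : ZMod 2) : Continuous fun q : ℂ × E => circT ε q.1 (Φ q.2) := by
  unfold circT
  refine Continuous.add ?_ (Continuous.mul ?_ ?_)
  · exact Continuous.comp (g := fun q : ℂ × E => riesz ε q.1 (nearPart (Φ q.2)))
      (f := fun q : ℂ × E => (q.1 - 1, q.2)) ((fam_nearPart hΦ).continuous_riesz ε)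
      ((continuous_fst.sub continuous_const).prodMk continuous_snd)
  · have hc : Continuous fun ν : ℂ => (Complex.Gamma ((ν + ε.val) / 2))⁻¹ :=
      (differentiable_inv_Gamma_comp (by fun_prop)).continuous
    exact hc.comp continuous_fst
  · have h1 : Continuous fun r : (ℂ × E) × ℝ => farWeight ε r.1.1 r.2 :=
      Continuous.comp (g := fun q : ℂ × ℝ => farWeight ε q.1 q.2)
        (f := fun r : (ℂ × E) × ℝ => (r.1.1, r.2)) (continuous_farWeight ε)
        ((continuous_fst.comp continuous_fst).prodMk continuous_snd)
    have h2 : Continuous fun r : (ℂ × E) × ℝ => Φ r.1.2 r.2 :=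
      Continuous.comp (g := fun r : E × ℝ => Φ r.1 r.2) (f := fun r : (ℂ × E) × ℝ => (r.1.2, r.2))
        hΦ.continuous ((continuous_snd.comp continuous_fst).prodMk continuous_snd)
    exact intervalIntegral.continuous_parametric_intervalIntegral_of_continuous'
      (f := fun (q : ℂ × E) τ => farWeight ε q.1 τ * Φ q.2 τ) (h1.mul h2) _ _

lemma differentiable_intervalIntegral {F : ℂ → ℝ → ℂ}
    (hF : Continuous fun q : ℂ × ℝ => F q.1 q.2) (hd : ∀ x, Differentiable ℂ fun s => F s x)
    (a b : ℝ) (hab : a ≤ b) : Differentiable ℂ fun s => ∫ x in a..b, F s x := by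
  intro s
  simp_rw [intervalIntegral.integral_of_le hab, ← integral_Icc_eq_integral_Ioc]
  obtain ⟨B, hB⟩ := ((isCompact_closedBall s 1).prod (isCompact_Icc (a := a) (b := b))
    ).exists_bound_of_continuousOn hF.continuousOn
  refine differentiableAt_integral_of_bound (Metric.closedBall_mem_nhds s one_pos)
    (b := fun _ => B) (fun z _ => ?_) (integrable_const B) ?_ ?_
  · exact (hF.comp (continuous_const.prodMk continuous_id)).aestronglyMeasurable
  · filter_upwards [ae_restrict_mem measurableSet_Icc] with x hx z hz
    exact hB (z, x) ⟨hz, hx⟩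
  · exact Filter.Eventually.of_forall fun x => (hd x).differentiableOn

lemma differentiable_circT {Φ : ℝ → ℂ} (hΦ : ContDiff ℝ ∞ Φ) (ε : ZMod 2) :
    Differentiable ℂ fun ν => circT ε ν Φ := by
  have hF := fam_nearPart (E := ℝ) (Φ := fun _ => Φ) (hΦ.comp contDiff_snd)
  unfold circT
  refine Differentiable.add ?_ (Differentiable.mul ?_ ?_)
  · exact (hF.differentiable_riesz 0 ε).comp (differentiable_id.sub_const 1)
  · exact differentiable_inv_Gamma_comp (by fun_prop)
  · refine differentiable_intervalIntegral ((continuous_farWeight ε).mul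
      (hΦ.continuous.comp continuous_snd)) (fun x => ?_) _ _ (by linarith [Real.pi_pos])
    exact (differentiable_farWeight ε x).mul_const _

end Family

lemma sin_image_Ioo : Real.sin '' Ioo (-(Real.pi / 2)) (Real.pi / 2) = Ioo (-1) 1 :=
  Real.sinPartialHomeomorph.toPartialEquiv.image_source_eq_target

lemma injOn_sin_Ioo : InjOn Real.sin (Ioo (-(Real.pi / 2)) (Real.pi / 2)) :=
  Real.injOn_sin.mono Ioo_subset_Icc_self

lemma abs_cos_smul_nearPart (ε : ZMod 2) (s : ℂ) (Φ : ℝ → ℂ) {τ : ℝ}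
    (hτ : τ ∈ Ioo (-(Real.pi / 2)) (Real.pi / 2)) :
    |Real.cos τ| • (spow ε s (Real.sin τ) * nearPart Φ (Real.sin τ)) =
      spow ε s (Real.sin τ) * (cutoff (Real.sin τ) : ℂ) * Φ τ := by
  have hc := Real.cos_pos_of_mem_Ioo hτ
  have h1 : √(1 - Real.sin τ ^ 2) = Real.cos τ := by
    rw [← Real.cos_sq', Real.sqrt_sq hc.le]
  rw [nearPart, h1, Real.arcsin_sin hτ.1.le hτ.2.le, abs_of_pos hc, Complex.real_smul]
  have : ((Real.cos τ : ℝ) : ℂ) ≠ 0 := by exact_mod_cast hc.ne'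
  rw [Complex.ofReal_inv]
  field_simp

lemma nearPart_eq_zero (Φ : ℝ → ℂ) {y : ℝ} (hy : y ∉ Ioo (-1 : ℝ) 1) : nearPart Φ y = 0 := by
  rw [nearPart, cutoff_eq_zero]
  · simp
  · by_contra! hlt
    have := abs_lt.1 hlt
    exact hy ⟨by linarith, by linarith⟩

/-- Convergence and value in the half-plane `Re ν > 0`. -/
lemma circT_eq {Φ : ℝ → ℂ} (hΦ : ContDiff ℝ ∞ Φ) (ε : ZMod 2) {ν : ℂ} (hν : 0 < ν.re) :
    IntegrableOn (fun τ => spow ε (ν - 1) (Real.sin τ) * Φ τ)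
        (Ioo (-(Real.pi / 2)) (Real.pi / 2)) ∧
      circT ε ν Φ = (Complex.Gamma ((ν + ε.val) / 2))⁻¹ *
        ∫ τ in Ioo (-(Real.pi / 2)) (Real.pi / 2), spow ε (ν - 1) (Real.sin τ) * Φ τ := by
  have hF := fam_nearPart (E := ℝ) (Φ := fun _ => Φ) (hΦ.comp contDiff_snd)
  have hν' : -1 < (ν - 1).re := by simpa using hν
  have hderiv : ∀ x ∈ Ioo (-(Real.pi / 2)) (Real.pi / 2),
      HasDerivWithinAt Real.sin (Real.cos x) (Ioo (-(Real.pi / 2)) (Real.pi / 2)) x :=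
    fun x _ => (Real.hasDerivAt_sin x).hasDerivWithinAt
  have i0 : Integrable fun y => spow ε (ν - 1) y * nearPart Φ y :=
    hF.integrable_mul 0 (locallyIntegrable_spow ε hν')
  -- Substitution y = sin τ: the Jacobian cos τ cancels the factor 1/√(1-y²) built into `nearPart`.
  have i1 : IntegrableOn (fun τ => spow ε (ν - 1) (Real.sin τ) * (cutoff (Real.sin τ) : ℂ) * Φ τ)
      (Ioo (-(Real.pi / 2)) (Real.pi / 2)) := by
    have := (integrableOn_image_iff_integrableOn_abs_deriv_smul measurableSet_Ioo hderiv
      injOn_sin_Ioo (fun y => spow ε (ν - 1) y * nearPart Φ y)).1 i0.integrableOn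
    exact this.congr_fun (fun τ hτ => abs_cos_smul_nearPart ε _ Φ hτ) measurableSet_Ioo
  have e1 : ∫ y, spow ε (ν - 1) y * nearPart Φ y =
      ∫ τ in Ioo (-(Real.pi / 2)) (Real.pi / 2),
        spow ε (ν - 1) (Real.sin τ) * (cutoff (Real.sin τ) : ℂ) * Φ τ := by
    rw [← setIntegral_congr_fun measurableSet_Ioo
      (fun τ hτ => abs_cos_smul_nearPart ε (ν - 1) Φ hτ),
      ← integral_image_eq_integral_abs_deriv_smul measurableSet_Ioo hderiv injOn_sin_Ioo
        (fun y => spow ε (ν - 1) y * nearPart Φ y), sin_image_Ioo,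
      setIntegral_eq_integral_of_forall_compl_eq_zero]
    intro y hy
    rw [nearPart_eq_zero Φ hy, mul_zero]
  have hfar : Continuous fun τ => farWeight ε ν τ * Φ τ :=
    ((continuous_farWeight ε).comp (continuous_const.prodMk continuous_id)).mul hΦ.continuous
  have i2 : IntegrableOn (fun τ => farWeight ε ν τ * Φ τ)
      (Ioo (-(Real.pi / 2)) (Real.pi / 2)) :=
    (hfar.continuousOn.integrableOn_Icc (a := -(Real.pi / 2)) (b := Real.pi / 2)).mono_set
      Ioo_subset_Icc_self
  have e2 : ∀ τ, spow ε (ν - 1) (Real.sin τ) * Φ τ =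
      spow ε (ν - 1) (Real.sin τ) * (cutoff (Real.sin τ) : ℂ) * Φ τ +
        farWeight ε ν τ * Φ τ := by
    intro τ
    rw [farWeight]
    ring
  simp_rw [e2]
  refine ⟨i1.add i2, ?_⟩
  have e3 := hF.riesz_eq_integral_spow 0 ε hν'
  rw [integral_add i1 i2, mul_add, circT, intervalIntegral.integral_of_le (by
    linarith [Real.pi_pos]), integral_Ioc_eq_integral_Ioo, ← e1, e3, sub_add_cancel]

/-! ### Matrix entries and polar coordinates of the first column -/

lemma G.mul_apply (g h : G) (i j : Fin 2) : (g * h) i j = g i 0 * h 0 j + g i 1 * h 1 j := by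
  rw [Matrix.SpecialLinearGroup.coe_mul, Matrix.mul_apply, Fin.sum_univ_two]

lemma G.det_eq (g : G) : g 0 0 * g 1 1 - g 0 1 * g 1 0 = 1 := by
  have := g.det_coe
  rwa [Matrix.det_fin_two] at this

lemma G.ext_entries {g h : G} (h00 : g 0 0 = h 0 0) (h01 : g 0 1 = h 0 1) (h10 : g 1 0 = h 1 0)
    (h11 : g 1 1 = h 1 1) : g = h := by
  ext i j
  fin_cases i <;> fin_cases j <;> assumption

section Entries

variable (t : ℝˣ) (x : ℝ)

@[simp] lemma diagG_00 : diagG t 0 0 = t := rfl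
@[simp] lemma diagG_01 : diagG t 0 1 = 0 := rfl
@[simp] lemma diagG_10 : diagG t 1 0 = 0 := rfl
@[simp] lemma diagG_11 : diagG t 1 1 = (t : ℝ)⁻¹ := rfl
@[simp] lemma nG_00 : nG x 0 0 = 1 := rfl
@[simp] lemma nG_01 : nG x 0 1 = x := rfl
@[simp] lemma nG_10 : nG x 1 0 = 0 := rfl
@[simp] lemma nG_11 : nG x 1 1 = 1 := rfl
@[simp] lemma nbarG_00 : nbarG x 0 0 = 1 := rfl
@[simp] lemma nbarG_01 : nbarG x 0 1 = 0 := rfl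
@[simp] lemma nbarG_10 : nbarG x 1 0 = x := rfl
@[simp] lemma nbarG_11 : nbarG x 1 1 = 1 := rfl
@[simp] lemma kG_00 : kG x 0 0 = Real.cos x := rfl
@[simp] lemma kG_01 : kG x 0 1 = Real.sin x := rfl
@[simp] lemma kG_10 : kG x 1 0 = -Real.sin x := rfl
@[simp] lemma kG_11 : kG x 1 1 = Real.cos x := rfl
@[simp] lemma bG_00 : bG x 0 0 = Real.cosh x := rfl
@[simp] lemma bG_01 : bG x 0 1 = Real.sinh x := rfl
@[simp] lemma bG_10 : bG x 1 0 = Real.sinh x := rfl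
@[simp] lemma bG_11 : bG x 1 1 = Real.cosh x := rfl
@[simp] lemma w0_00 : w0 0 0 = 0 := rfl
@[simp] lemma w0_01 : w0 0 1 = 1 := rfl
@[simp] lemma w0_10 : w0 1 0 = -1 := rfl
@[simp] lemma w0_11 : w0 1 1 = 0 := rfl
@[simp] lemma G.inv_00 (g : G) : g⁻¹ 0 0 = g 1 1 := by
  simp [Matrix.SpecialLinearGroup.coe_inv, Matrix.adjugate_fin_two]
@[simp] lemma G.inv_01 (g : G) : g⁻¹ 0 1 = -g 0 1 := by
  simp [Matrix.SpecialLinearGroup.coe_inv, Matrix.adjugate_fin_two]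
@[simp] lemma G.inv_10 (g : G) : g⁻¹ 1 0 = -g 1 0 := by
  simp [Matrix.SpecialLinearGroup.coe_inv, Matrix.adjugate_fin_two]
@[simp] lemma G.inv_11 (g : G) : g⁻¹ 1 1 = g 0 0 := by
  simp [Matrix.SpecialLinearGroup.coe_inv, Matrix.adjugate_fin_two]

end Entries

/-- Elements of `G` with the same first column differ by an element of `N`. -/
lemma exists_nG_of_col {g h : G} (h0 : g 0 0 = h 0 0) (h1 : g 1 0 = h 1 0) :
    ∃ x : ℝ, h = g * nG x := by
  have dg := G.det_eq g
  have dh := G.det_eq h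
  rw [h0, h1] at dg
  refine ⟨h 0 1 * g 1 1 - g 0 1 * h 1 1, G.ext_entries ?_ ?_ ?_ ?_⟩ <;>
    simp only [G.mul_apply, nG_00, nG_01, nG_10, nG_11, h0, h1]
  · ring
  · linear_combination (- h 0 1) * dg + g 0 1 * dh
  · ring
  · linear_combination (- h 1 1) * dg + g 1 1 * dh

lemma spow_of_pos (ε : ZMod 2) (s : ℂ) {t : ℝ} (ht : 0 < t) : spow ε s t = (t : ℂ) ^ s := by
  rw [spow, Real.sign_of_pos ht, abs_of_pos ht]
  simp

/-- Values of an element of the principal series in terms of its restriction to `K`. -/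
lemma IndP.apply_eq {ε : ZMod 2} {μ : ℂ} {φ : G → ℂ} (hφ : φ ∈ IndP ε μ) {g : G} {θ ρ : ℝ}
    (hρ : 0 < ρ) (h0 : g 0 0 = ρ * Real.cos θ) (h1 : g 1 0 = -(ρ * Real.sin θ)) :
    φ g = (ρ : ℂ) ^ (-μ - 1) * φ (kG θ) := by
  have hc : ((Units.mk0 ρ hρ.ne' : ℝˣ) : ℝ) = ρ := rfl
  obtain ⟨x, hx⟩ := exists_nG_of_col (g := kG θ * diagG (Units.mk0 ρ hρ.ne')) (h := g)
    (by simp [G.mul_apply, h0, mul_comm])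
    (by simp [G.mul_apply, h1, mul_comm])
  rw [hx, mul_assoc, hφ.2, hc, spow_of_pos _ _ hρ]

lemma exists_polar (g : G) : ∃ θ ρ : ℝ, 0 < ρ ∧ g 0 0 = ρ * Real.cos θ ∧
    g 1 0 = -(ρ * Real.sin θ) := by
  set z : ℂ := ⟨g 0 0, -g 1 0⟩ with hz
  have hz0 : z ≠ 0 := by
    intro h
    have h0 : g 0 0 = 0 := by simpa [hz] using congrArg Complex.re h
    have h1 : g 1 0 = 0 := by simpa [hz] using congrArg Complex.im h
    have := G.det_eq g
    rw [h0, h1] at this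
    simp at this
  refine ⟨z.arg, ‖z‖, norm_pos_iff.2 hz0, ?_, ?_⟩
  · rw [Complex.norm_mul_cos_arg]
  · rw [Complex.norm_mul_sin_arg]
    simp [hz]

lemma SmoothG.contDiff_comp {E : Type*} [NormedAddCommGroup E] [NormedSpace ℝ E] {f : G → ℂ}
    (hf : SmoothG f) {γ : E → G} (hγ : ∀ i j, ContDiff ℝ ∞ fun p => γ p i j) :
    ContDiff ℝ ∞ fun p => f (γ p) := by
  obtain ⟨U, F, hU, hF, h⟩ := hf
  have h1 : ContDiff ℝ ∞ fun p => (fun i j => γ p i j : Fin 2 → Fin 2 → ℝ) :=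
    contDiff_pi.2 fun i => contDiff_pi.2 fun j => hγ i j
  have h2 := hF.comp_contDiff h1 fun p => (h (γ p)).1
  convert h2 using 2 with p
  exact ((h (γ p)).2).symm

/-! ### The Knapp–Stein operator as a convolution on the circle -/

lemma IndP.contDiff_circle {ε : ZMod 2} {μ : ℂ} {φ : G → ℂ} (hφ : φ ∈ IndP ε μ) (θ : ℝ) :
    ContDiff ℝ ∞ fun τ => φ (kG (θ + τ)) := by
  refine hφ.1.contDiff_comp fun i j => ?_
  fin_cases i <;> fin_cases j <;> simp <;> fun_prop

lemma cpow_eq_exp_log {t : ℝ} (ht : 0 < t) (s : ℂ) :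
    (t : ℂ) ^ s = Complex.exp (s * (Real.log t : ℂ)) := by
  rw [← apow_eq_exp s ht.ne', apow, abs_of_pos ht]

lemma IndP.flatSection_eq {ε : ZMod 2} {μ : ℂ} {φ : G → ℂ} (hφ : φ ∈ IndP ε μ) (ν : ℂ) {g : G}
    {θ ρ : ℝ} (hρ : 0 < ρ) (h0 : g 0 0 = ρ * Real.cos θ) (h1 : g 1 0 = -(ρ * Real.sin θ)) :
    flatSection μ ν φ g = (ρ : ℂ) ^ (-ν - 1) * φ (kG θ) := by
  have h2 : g 0 0 ^ 2 + g 1 0 ^ 2 = ρ ^ 2 := by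
    rw [h0, h1]
    linear_combination ρ ^ 2 * Real.cos_sq_add_sin_sq θ
  rw [flatSection, IndP.apply_eq hφ hρ h0 h1, h2, ← mul_assoc, cpow_eq_exp_log (by positivity),
    cpow_eq_exp_log hρ, cpow_eq_exp_log hρ, ← Complex.exp_add, Real.log_pow]
  congr 2
  push_cast
  ring

lemma spow_neg (ε : ZMod 2) (s : ℂ) (x : ℝ) : spow ε s (-x) = (-1) ^ ε.val * spow ε s x := by
  rw [spow, spow, Real.sign_neg, abs_neg, ← mul_assoc, ← mul_pow]
  simp

lemma kG_add_pi (θ : ℝ) : kG (θ + Real.pi) = kG θ * diagG (-1) := by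
  apply G.ext_entries <;> simp [G.mul_apply]

lemma neg_one_pow_mul_self (n : ℕ) : ((-1 : ℂ) ^ n) * (-1) ^ n = 1 := by
  rw [← mul_pow]
  simp

lemma IndP.add_pi {ε : ZMod 2} {μ : ℂ} {φ : G → ℂ} (hφ : φ ∈ IndP ε μ) (θ : ℝ) :
    φ (kG (θ + Real.pi)) = (-1) ^ ε.val * φ (kG θ) := by
  have h1 := hφ.2 (kG θ) (-1) 0
  have h2 : diagG (-1) * nG 0 = diagG (-1) := by
    apply G.ext_entries <;> simp [G.mul_apply]
  rw [h2, ← kG_add_pi] at h1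
  rw [h1]
  congr 1
  have := spow_neg ε (-μ - 1) 1
  simpa [spow_of_pos] using this

lemma cos_arctan_sq (X : ℝ) : Real.cos (Real.arctan X) ^ 2 = (1 + X ^ 2)⁻¹ := by
  rw [Real.cos_sq_arctan, one_div]

/-- The integrand of the Knapp–Stein operator, in the coordinate `σ` with `X = tan σ`. -/
lemma IndP.flatSection_w0_nbar {ε : ZMod 2} {μ : ℂ} {φ : G → ℂ} (hφ : φ ∈ IndP ε μ) (ν : ℂ)
    {g : G} {θ t : ℝ} (ht : 0 < t) (h0 : g 0 0 = t * Real.cos θ)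
    (h1 : g 1 0 = -(t * Real.sin θ)) :
    ∃ y : ℝ, ∀ x : ℝ, flatSection μ ν φ (g * w0 * nbarG x) =
      (t : ℂ) ^ (ν + 1) * (fun X : ℝ => |1 / (1 + X ^ 2)| •
        (fun σ : ℝ => spow ε (ν - 1) (Real.sin (Real.pi / 2 - σ)) *
          φ (kG (θ + (Real.pi / 2 - σ)))) (Real.arctan X)) (t ^ 2 * (x - y)) := by
  have hc : ((Units.mk0 t ht.ne' : ℝˣ) : ℝ) = t := rfl
  obtain ⟨y, hy⟩ := exists_nG_of_col (g := kG θ * diagG (Units.mk0 t ht.ne')) (h := g)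
    (by simp [G.mul_apply, h0, mul_comm])
    (by simp [G.mul_apply, h1, mul_comm])
  -- The shift y is the N-coordinate in g = k_θ diag(t, t⁻¹) n_y. Moving n_y past w₀ translates x.
  refine ⟨y, fun x => ?_⟩
  set X := t ^ 2 * (x - y) with hX
  set σ := Real.arctan X with hσ
  have hcos : 0 < Real.cos σ := Real.cos_arctan_pos X
  have htan : Real.sin σ = X * Real.cos σ := by
    rw [← Real.tan_mul_cos hcos.ne', hσ, Real.tan_arctan]
  have hX' : t⁻¹ * X = t * (x - y) := by
    rw [hX]
    field_simp
  have hρ : 0 < t⁻¹ / Real.cos σ := by positivity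
  -- With tan σ = X = t²(x - y), the first column of g w₀ n̄_x has radius 1/(t cos σ) and angle θ +
  -- π/2 - σ. Two of the powers of cos σ are the Jacobian 1/(1+X²).
  rw [IndP.flatSection_eq hφ ν hρ (θ := θ + (Real.pi / 2 - σ))]
  · have e1 : |1 / (1 + X ^ 2)| = Real.cos σ ^ 2 := by
      rw [cos_arctan_sq, one_div, abs_of_pos (by positivity)]
    simp only []
    rw [e1, Real.sin_pi_div_two_sub, spow_of_pos _ _ hcos, Complex.real_smul,
      cpow_eq_exp_log hρ, cpow_eq_exp_log ht, cpow_eq_exp_log hcos, ← mul_assoc, ← mul_assoc]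
    congr 1
    have e2 : ((Real.cos σ ^ 2 : ℝ) : ℂ) = Complex.exp (2 * (Real.log (Real.cos σ) : ℂ)) := by
      rw [← cpow_eq_exp_log hcos]
      push_cast
      norm_cast
    rw [e2, ← Complex.exp_add, ← Complex.exp_add, Real.log_div (by positivity) hcos.ne',
      Real.log_inv]
    congr 1
    push_cast
    ring
  · rw [Real.cos_add, Real.cos_pi_div_two_sub, Real.sin_pi_div_two_sub, hy, htan]
    simp only [G.mul_apply, kG_00, kG_01, diagG_00, diagG_01, diagG_10, diagG_11,
      nG_00, nG_01, nG_10, nG_11, w0_00, w0_01, w0_10, w0_11, nbarG_00, nbarG_10, hc]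
    have : t⁻¹ / Real.cos σ * (Real.cos θ * (X * Real.cos σ) - Real.sin θ * Real.cos σ) =
        t⁻¹ * X * Real.cos θ - t⁻¹ * Real.sin θ := by
      field_simp
    rw [this, hX']
    ring
  · rw [Real.sin_add, Real.cos_pi_div_two_sub, Real.sin_pi_div_two_sub, hy, htan]
    simp only [G.mul_apply, kG_10, kG_11, diagG_00, diagG_01, diagG_10, diagG_11,
      nG_00, nG_01, nG_10, nG_11, w0_00, w0_01, w0_10, w0_11, nbarG_00, nbarG_10, hc]
    have : t⁻¹ / Real.cos σ * (Real.sin θ * (X * Real.cos σ) + Real.cos θ * Real.cos σ) =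
        t⁻¹ * X * Real.sin θ + t⁻¹ * Real.cos θ := by
      field_simp
    rw [this, hX']
    ring

lemma arctan_image_univ : Real.arctan '' univ = Ioo (-(Real.pi / 2)) (Real.pi / 2) := by
  rw [image_univ, Real.range_arctan]

lemma hasDerivWithinAt_arctan (x : ℝ) (s : Set ℝ) :
    HasDerivWithinAt Real.arctan (1 / (1 + x ^ 2)) s x :=
  (Real.hasDerivAt_arctan x).hasDerivWithinAt

/-- The map σ ↦ π/2 - σ carries (-π/2, π/2) onto (0, π), another full period. -/
lemma pi_periodic_reflect {P : ℝ → ℂ} (hP : Function.Periodic P Real.pi)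
    (hi : IntegrableOn P (Ioo (-(Real.pi / 2)) (Real.pi / 2))) :
    IntegrableOn (fun σ => P (Real.pi / 2 - σ)) (Ioo (-(Real.pi / 2)) (Real.pi / 2)) ∧
      ∫ σ in Ioo (-(Real.pi / 2)) (Real.pi / 2), P (Real.pi / 2 - σ) =
        ∫ σ in Ioo (-(Real.pi / 2)) (Real.pi / 2), P σ := by
  have hle : -(Real.pi / 2) ≤ Real.pi / 2 := by linarith [Real.pi_pos]
  have hpi : -(Real.pi / 2) + Real.pi = Real.pi / 2 := by ring
  have h1 : IntervalIntegrable P volume (-(Real.pi / 2)) (-(Real.pi / 2) + Real.pi) := by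
    rwa [hpi, intervalIntegrable_iff_integrableOn_Ioo_of_le hle]
  have h2 := hP.intervalIntegrable Real.pi_ne_zero h1 0 Real.pi
  constructor
  · rw [← intervalIntegrable_iff_integrableOn_Ioo_of_le hle]
    have := (h2.comp_sub_left (Real.pi / 2)).symm
    rwa [sub_zero, show Real.pi / 2 - Real.pi = -(Real.pi / 2) by ring] at this
  · rw [← integral_Ioc_eq_integral_Ioo, ← integral_Ioc_eq_integral_Ioo,
      ← intervalIntegral.integral_of_le hle, ← intervalIntegral.integral_of_le hle,
      intervalIntegral.integral_comp_sub_left (fun x => P x)]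
    have := hP.intervalIntegral_add_eq 0 (-(Real.pi / 2))
    rw [hpi, zero_add] at this
    rw [← this]
    congr 1 <;> ring

/-- The Knapp–Stein integral on a flat section is, up to an exponential factor, a convolution
on the circle. -/
lemma IndP.knappSteinIntegral_eq {ε : ZMod 2} {μ : ℂ} {φ : G → ℂ} (hφ : φ ∈ IndP ε μ)
    {g : G} {θ t : ℝ} (ht : 0 < t) (h0 : g 0 0 = t * Real.cos θ)
    (h1 : g 1 0 = -(t * Real.sin θ)) {ν : ℂ} (hν : 0 < ν.re) :
    (Integrable fun x : ℝ => flatSection μ ν φ (g * w0 * nbarG x)) ∧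
      knappSteinIntegral ε μ φ g ν =
        (t : ℂ) ^ (ν - 1) * circT ε ν (fun τ => φ (kG (θ + τ))) := by
  obtain ⟨y, hy⟩ := IndP.flatSection_w0_nbar hφ ν ht h0 h1
  set P : ℝ → ℂ := fun τ => spow ε (ν - 1) (Real.sin τ) * φ (kG (θ + τ)) with hPdef
  -- Under τ ↦ τ + π the power of sin τ and the function on K each acquire the sign (-1)^ε, and the
  -- signs cancel.
  have hP : Function.Periodic P Real.pi := by
    intro τ
    simp only [hPdef]
    rw [Real.sin_add_pi, spow_neg, ← add_assoc, IndP.add_pi hφ]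
    linear_combination (spow ε (ν - 1) (Real.sin τ) * φ (kG (θ + τ))) *
      neg_one_pow_mul_self ε.val
  obtain ⟨c1, c2⟩ := circT_eq (IndP.contDiff_circle hφ θ) ε hν
  obtain ⟨r1, r2⟩ := pi_periodic_reflect hP c1
  have hinj : InjOn Real.arctan univ := Real.arctan_injective.injOn
  set F : ℝ → ℂ := fun X => |1 / (1 + X ^ 2)| •
    (fun σ => P (Real.pi / 2 - σ)) (Real.arctan X) with hF
  have i1 : Integrable F := by
    rw [← integrableOn_univ, hF]
    refine (integrableOn_image_iff_integrableOn_abs_deriv_smul MeasurableSet.univ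
      (fun x _ => hasDerivWithinAt_arctan x univ) hinj (fun σ => P (Real.pi / 2 - σ))).1 ?_
    rw [arctan_image_univ]
    exact r1
  have e1 : ∫ X : ℝ, F X = ∫ σ in Ioo (-(Real.pi / 2)) (Real.pi / 2), P σ := by
    have := integral_image_eq_integral_abs_deriv_smul MeasurableSet.univ
      (fun x _ => hasDerivWithinAt_arctan x univ) hinj (fun σ => P (Real.pi / 2 - σ))
    rw [arctan_image_univ, setIntegral_univ, r2] at this
    exact this.symm
  simp_rw [knappSteinIntegral, hy]
  constructor
  · exact ((i1.comp_mul_left' (by positivity : t ^ 2 ≠ 0)).comp_sub_right y).const_mul _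
  · rw [integral_const_mul, integral_sub_right_eq_self (fun x => F (t ^ 2 * x)) y,
      Measure.integral_comp_mul_left F, e1, c2, abs_of_pos (by positivity), Complex.real_smul]
    -- The factor t⁻² is the Jacobian of X = t²(x - y).
    have e2 : (((t ^ 2)⁻¹ : ℝ) : ℂ) * (t : ℂ) ^ (ν + 1) = (t : ℂ) ^ (ν - 1) := by
      have e3 : (((t ^ 2)⁻¹ : ℝ) : ℂ) = Complex.exp (-2 * (Real.log t : ℂ)) := by
        rw [← cpow_eq_exp_log ht, Complex.cpow_neg]
        push_cast
        norm_cast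
      rw [e3, cpow_eq_exp_log ht, cpow_eq_exp_log ht, ← Complex.exp_add]
      congr 1
      ring
    rw [← e2]
    ring

/-- Uniqueness of continuation makes the chosen extension equal to any explicit one. Every value of
`knappStein` and `normOpA` is computed through it. -/
lemma entireExt_eq {U : Set ℂ} {F E : ℂ → ℂ} (hU : IsOpen U) (hne : U.Nonempty)
    (h : IsEntireExt U F E) : entireExt U F = E := by
  have hex : ∃ E, IsEntireExt U F E := ⟨E, h⟩
  rw [entireExt, dif_pos hex]
  exact hex.choose_spec.unique hU hne h

lemma isOpen_re_pos : IsOpen {ν : ℂ | 0 < ν.re} := isOpen_lt continuous_const Complex.continuous_re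

lemma differentiable_cpow_pos {t : ℝ} (ht : 0 < t) {g : ℂ → ℂ} (hg : Differentiable ℂ g) :
    Differentiable ℂ fun ν => (t : ℂ) ^ g ν := by
  simp_rw [fun s => cpow_eq_exp_log ht s]
  fun_prop

lemma IndP.isEntireExt {ε : ZMod 2} {μ : ℂ} {φ : G → ℂ} (hφ : φ ∈ IndP ε μ)
    {g : G} {θ t : ℝ} (ht : 0 < t) (h0 : g 0 0 = t * Real.cos θ)
    (h1 : g 1 0 = -(t * Real.sin θ)) :
    IsEntireExt {ν | 0 < ν.re} (knappSteinIntegral ε μ φ g)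
      fun ν => (t : ℂ) ^ (ν - 1) * circT ε ν (fun τ => φ (kG (θ + τ))) :=
  ⟨(differentiable_cpow_pos ht (by fun_prop)).mul (differentiable_circT (IndP.contDiff_circle hφ θ) ε),
    fun _ hν => (IndP.knappSteinIntegral_eq hφ ht h0 h1 hν).2.symm⟩

lemma IndP.knappSteinDefined {ε : ZMod 2} {μ : ℂ} {φ : G → ℂ} (hφ : φ ∈ IndP ε μ) :
    KnappSteinDefined ε μ φ := by
  intro g
  obtain ⟨θ, t, ht, h0, h1⟩ := exists_polar g
  exact ⟨fun ν hν => (IndP.knappSteinIntegral_eq hφ ht h0 h1 hν).1, _, IndP.isEntireExt hφ ht h0 h1⟩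

lemma IndP.knappStein_eq {ε : ZMod 2} {μ : ℂ} {φ : G → ℂ} (hφ : φ ∈ IndP ε μ)
    {g : G} {θ t : ℝ} (ht : 0 < t) (h0 : g 0 0 = t * Real.cos θ)
    (h1 : g 1 0 = -(t * Real.sin θ)) :
    knappStein ε μ φ g = (t : ℂ) ^ (μ - 1) * circT ε μ (fun τ => φ (kG (θ + τ))) := by
  rw [knappStein, entireExt_eq isOpen_re_pos ⟨1, by simp⟩ (IndP.isEntireExt hφ ht h0 h1)]

lemma IndP.knappStein_smul {ε : ZMod 2} {μ : ℂ} {φ : G → ℂ} (hφ : φ ∈ IndP ε μ) (c : ℂ) :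
    knappStein ε μ (fun g => c * φ g) = c • knappStein ε μ φ := by
  ext g
  obtain ⟨θ, t, ht, h0, h1⟩ := exists_polar g
  have h := IndP.isEntireExt hφ ht h0 h1
  have hc : IsEntireExt {ν | 0 < ν.re} (knappSteinIntegral ε μ (fun g => c * φ g) g)
      fun ν => c * ((t : ℂ) ^ (ν - 1) * circT ε ν (fun τ => φ (kG (θ + τ)))) := by
    refine ⟨h.1.const_mul c, fun ν hν => ?_⟩
    simp only []
    rw [← (IndP.knappSteinIntegral_eq hφ ht h0 h1 hν).2, knappSteinIntegral, knappSteinIntegral,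
      mul_left_comm, ← integral_const_mul]
    congr 2
    ext x
    rw [flatSection, flatSection]
    ring
  rw [Pi.smul_apply, smul_eq_mul, IndP.knappStein_eq hφ ht h0 h1, knappStein,
    entireExt_eq isOpen_re_pos ⟨1, by simp⟩ hc]

/-! ### Charts of G/H and the invariant measure -/

lemma kG_add (a b : ℝ) : kG (a + b) = kG a * kG b := by
  apply G.ext_entries <;> simp [G.mul_apply, Real.cos_add, Real.sin_add] <;> ring

/-- Right `H`-invariance. -/
def HInv (F : G → ℂ) : Prop := ∀ (g : G) (t : ℝˣ), F (g * diagG t) = F g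

lemma HInv.periodic {F : G → ℂ} (hF : HInv F) (u : ℝ) :
    Function.Periodic (fun θ => F (kG θ * bG u)) Real.pi := by
  intro θ
  have : kG (θ + Real.pi) * bG u = kG θ * bG u * diagG (-1) := by
    rw [kG_add_pi]
    apply G.ext_entries <;> simp [G.mul_apply] <;> ring
  simp only []
  rw [this, hF]

/-- The hyperbolic coordinate of `n_b n̄_c H`. -/
def uCoord (q : ℝ × ℝ) : ℝ := Real.arsinh (q.1 + q.2 * (1 + q.1 ^ 2)) / 2

/-- The angle `φ` with `tan φ = tanh u`. -/
def phiAng (u : ℝ) : ℝ := Real.arctan (Real.tanh u)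

/-- The angular coordinate, not reduced modulo `π`, of `k_θ n_b n̄_c H`. -/
def thetaCoord (θ : ℝ) (q : ℝ × ℝ) : ℝ := θ + Real.arctan q.1 - phiAng (uCoord q)

/-- The coordinates in `coordDomain` of `k_θ n_b n̄_c H`. -/
def coordMap (θ : ℝ) (q : ℝ × ℝ) : ℝ × ℝ :=
  (toIcoMod Real.pi_pos 0 (thetaCoord θ q), uCoord q)

lemma phiAng_spec (u : ℝ) : ∃ ρ : ℝ, 0 < ρ ∧ Real.cosh u = ρ * Real.cos (phiAng u) ∧
    Real.sinh u = ρ * Real.sin (phiAng u) := by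
  have hc := Real.cosh_pos u
  have hcos : 0 < Real.cos (phiAng u) := Real.cos_arctan_pos _
  refine ⟨Real.cosh u / Real.cos (phiAng u), by positivity, by field_simp, ?_⟩
  have h1 : Real.sin (phiAng u) = Real.tanh u * Real.cos (phiAng u) := by
    rw [← Real.tan_mul_cos hcos.ne', phiAng, Real.tan_arctan]
  rw [h1, Real.tanh_eq_sinh_div_cosh]
  field_simp

/-- Modulo H a matrix is determined by the direction of its second column and the inner product of
its two columns. Here the direction is (b, 1), that is (sin ψ, cos ψ) with ψ = arctan b, and the
inner product is b + c(1+b²). For k b_u the inner product is sinh 2u, which fixes u. The second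
column of b_u has angle φ, so the rotation is by ψ - φ. -/
lemma nG_mul_nbarG_eq (b c : ℝ) : ∃ t : ℝˣ, kG (Real.arctan b - phiAng (uCoord (b, c))) *
    bG (uCoord (b, c)) = nG b * nbarG c * diagG t := by
  set u := uCoord (b, c) with hu
  obtain ⟨ρ, hρ, hch, hsh⟩ := phiAng_spec u
  set φ := phiAng u
  set ψ := Real.arctan b with hψ
  have hcos : 0 < Real.cos ψ := Real.cos_arctan_pos b
  have hsin : Real.sin ψ = b * Real.cos ψ := by
    rw [← Real.tan_mul_cos hcos.ne', hψ, Real.tan_arctan]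
  have h2 : 2 * Real.sinh u * Real.cosh u = b + c * (1 + b ^ 2) := by
    rw [← Real.sinh_two_mul, hu, uCoord]
    rw [show 2 * (Real.arsinh (b + c * (1 + b ^ 2)) / 2) = Real.arsinh (b + c * (1 + b ^ 2)) by
      ring, Real.sinh_arsinh]
  have h3 : Real.cosh u ^ 2 - Real.sinh u ^ 2 = 1 := Real.cosh_sq_sub_sinh_sq u
  have hq : Real.cos ψ ^ 2 * (1 + b ^ 2) = 1 := by
    have := Real.cos_sq_add_sin_sq ψ
    rw [hsin] at this
    linear_combination this
  have hφ1 := Real.cos_sq_add_sin_sq φ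
  have e01 : (kG (ψ - φ) * bG u) 0 1 = ρ * Real.cos ψ * b := by
    simp only [G.mul_apply, kG_00, kG_01, bG_01, bG_11, Real.cos_sub, Real.sin_sub]
    rw [hch, hsh, hsin]
    linear_combination (ρ * b * Real.cos ψ) * hφ1
  have e11 : (kG (ψ - φ) * bG u) 1 1 = ρ * Real.cos ψ := by
    simp only [G.mul_apply, kG_10, kG_11, bG_01, bG_11, Real.cos_sub, Real.sin_sub]
    rw [hch, hsh, hsin]
    linear_combination (ρ * Real.cos ψ) * hφ1
  have e10 : ρ * Real.cos ψ * (kG (ψ - φ) * bG u) 1 0 = c := by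
    simp only [G.mul_apply, kG_10, kG_11, bG_00, bG_10, Real.cos_sub, Real.sin_sub]
    have a1 : ρ * Real.cos φ = Real.cosh u := hch.symm
    have a2 : ρ * Real.sin φ = Real.sinh u := hsh.symm
    rw [hsin]
    have : ρ * Real.cos ψ * (-(b * Real.cos ψ * Real.cos φ - Real.cos ψ * Real.sin φ) *
        Real.cosh u + (Real.cos ψ * Real.cos φ + b * Real.cos ψ * Real.sin φ) * Real.sinh u) =
        Real.cos ψ ^ 2 * (-(b * (ρ * Real.cos φ) - ρ * Real.sin φ) * Real.cosh u +
          (ρ * Real.cos φ + b * (ρ * Real.sin φ)) * Real.sinh u) := by ring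
    rw [this, a1, a2]
    linear_combination (Real.cos ψ ^ 2) * h2 - b * Real.cos ψ ^ 2 * h3 + c * hq
  have hd : ρ * Real.cos ψ ≠ 0 := by positivity
  -- Right multiplication by diag(t, t⁻¹) divides the second column by t, and the second columns
  -- differ by the factor ρ cos ψ.
  refine ⟨(Units.mk0 (ρ * Real.cos ψ) hd)⁻¹, ?_⟩
  have hdet := G.det_eq (kG (ψ - φ) * bG u)
  rw [e01, e11] at hdet
  apply G.ext_entries
  · apply mul_right_cancel₀ hd
    have : (nG b * nbarG c * diagG (Units.mk0 (ρ * Real.cos ψ) hd)⁻¹) 0 0 * (ρ * Real.cos ψ) =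
        1 + b * c := by
      simp [G.mul_apply]
      field_simp
    rw [this]
    linear_combination hdet + b * e10
  · rw [e01]
    simp [G.mul_apply, mul_comm]
  · apply mul_left_cancel₀ hd
    rw [e10]
    simp [G.mul_apply]
    field_simp
  · rw [e11]
    simp [G.mul_apply]

/-- Reducing the angle modulo π changes nothing, because k_π = -1 is a central element of H. -/
lemma HInv.apply_coordMap {F : G → ℂ} (hF : HInv F) (θ : ℝ) (q : ℝ × ℝ) :
    F (kG (coordMap θ q).1 * bG (coordMap θ q).2) = F (kG θ * (nG q.1 * nbarG q.2)) := by
  obtain ⟨t, ht⟩ := nG_mul_nbarG_eq q.1 q.2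
  have h1 := (hF.periodic (uCoord q)).sub_zsmul_eq (toIcoDiv Real.pi_pos 0 (thetaCoord θ q))
    (x := thetaCoord θ q)
  simp only [coordMap, toIcoMod]
  rw [h1, thetaCoord, add_sub_assoc, kG_add, mul_assoc, ht, ← mul_assoc, hF]

lemma continuous_tanh : Continuous Real.tanh := by
  have : Real.tanh = fun x => Real.sinh x / Real.cosh x := by
    ext x
    exact Real.tanh_eq_sinh_div_cosh x
  rw [this]
  exact Real.continuous_sinh.div Real.continuous_cosh fun x => (Real.cosh_pos x).ne'

lemma continuous_phiAng : Continuous phiAng :=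
  Real.continuous_arctan.comp continuous_tanh

lemma continuous_uCoord : Continuous uCoord := by
  unfold uCoord
  exact (Real.continuous_arsinh.comp (by fun_prop)).div_const 2

lemma measurable_toIcoMod_pi : Measurable (toIcoMod Real.pi_pos 0) := by
  have : toIcoMod Real.pi_pos 0 = fun x : ℝ => Int.fract (x / Real.pi) * Real.pi := by
    ext x
    rw [toIcoMod_eq_fract_mul]
  rw [this]
  exact (measurable_fract.comp (measurable_id.div_const _)).mul_const _

lemma measurable_coordMap (θ : ℝ) : Measurable (coordMap θ) := by
  have h1 : Continuous (thetaCoord θ) := by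
    unfold thetaCoord
    exact (continuous_const.add (Real.continuous_arctan.comp continuous_fst)).sub
      (continuous_phiAng.comp continuous_uCoord)
  exact (measurable_toIcoMod_pi.comp h1.measurable).prodMk continuous_uCoord.measurable

open scoped ENNReal

/-- All half-open intervals of length π are fundamental domains for the same translations, so
neither the base point nor the shift matters. -/
lemma lintegral_Ioc_pi_periodic {K : ℝ → ℝ≥0∞} (hK : Function.Periodic K Real.pi)
    (a δ : ℝ) : ∫⁻ ψ in Ioc a (a + Real.pi), K (ψ + δ) = ∫⁻ θ in Ico 0 Real.pi, K θ := by
  have hfd : ∀ s : ℝ, IsAddFundamentalDomain (AddSubgroup.zmultiples Real.pi)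
      (Ioc s (s + Real.pi)) := fun s => isAddFundamentalDomain_Ioc Real.pi_pos s
  have h1 : ∫⁻ ψ in Ioc a (a + Real.pi), K (ψ + δ) =
      ∫⁻ ψ in Ioc 0 (0 + Real.pi), K (ψ + δ) := by
    refine (hfd a).setLIntegral_eq (hfd 0) _ ?_
    rintro ⟨_, n, rfl⟩ x
    have := hK.zsmul n (x + δ)
    simp only [AddSubgroup.vadd_def, vadd_eq_add]
    rw [← this]
    congr 1
    ring
  have h2 : ∫⁻ ψ in Ioc 0 (0 + Real.pi), K (ψ + δ) = ∫⁻ ψ in Ioc δ (δ + Real.pi), K ψ := by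
    have := (measurePreserving_add_right (volume : Measure ℝ) δ).setLIntegral_comp_preimage_emb
      (measurableEmbedding_addRight δ) K (Ioc δ (δ + Real.pi))
    rw [← this]
    congr 2
    ext x
    simp only [mem_Ioc, mem_preimage]
    constructor <;> intro h <;> constructor <;> linarith [h.1, h.2]
  have h3 : ∫⁻ ψ in Ioc δ (δ + Real.pi), K ψ = ∫⁻ ψ in Ioc 0 (0 + Real.pi), K ψ := by
    refine (hfd δ).setLIntegral_eq (hfd 0) _ ?_
    rintro ⟨_, n, rfl⟩ x
    have := hK.zsmul n x
    simp only [AddSubgroup.vadd_def, vadd_eq_add]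
    rw [← this, add_comm]
  rw [h1, h2, h3, zero_add]
  exact setLIntegral_congr Ico_ae_eq_Ioc.symm

/-- The invariant measure of `G/H` in the coordinates `(θ, u)`. -/
def coordMeasure : Measure (ℝ × ℝ) :=
  (volume.restrict coordDomain).withDensity fun p => (Real.toNNReal (Real.cosh (2 * p.2)) : ℝ≥0∞)

lemma measurable_density :
    Measurable fun p : ℝ × ℝ => Real.toNNReal (Real.cosh (2 * p.2)) := by
  have : Continuous fun p : ℝ × ℝ => Real.cosh (2 * p.2) :=
    Real.continuous_cosh.comp (by fun_prop)
  exact this.measurable.real_toNNReal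

lemma lintegral_uCoord (b : ℝ) (g : ℝ → ℝ≥0∞) :
    ∫⁻ c, g (uCoord (b, c)) =
      ∫⁻ u, ENNReal.ofReal (2 * Real.cosh (2 * u) / (1 + b ^ 2)) * g u := by
  have hb : (0 : ℝ) < 1 + b ^ 2 := by positivity
  set f : ℝ → ℝ := fun u => (Real.sinh (2 * u) - b) / (1 + b ^ 2) with hf
  have hinv : ∀ u, uCoord (b, f u) = u := by
    intro u
    have : b + f u * (1 + b ^ 2) = Real.sinh (2 * u) := by
      rw [hf]
      field_simp
      ring
    rw [uCoord]
    simp only [this, Real.arsinh_sinh]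
    ring
  have hinj : InjOn f univ := fun x _ y _ hxy => by
    rw [← hinv x, ← hinv y, hxy]
  have himg : f '' univ = univ := by
    rw [image_univ, range_eq_univ]
    intro c
    refine ⟨uCoord (b, c), ?_⟩
    simp only [hf, uCoord]
    rw [show 2 * (Real.arsinh (b + c * (1 + b ^ 2)) / 2) = Real.arsinh (b + c * (1 + b ^ 2)) by
      ring, Real.sinh_arsinh]
    field_simp
    ring
  have hder : ∀ x ∈ univ, HasDerivWithinAt f (2 * Real.cosh (2 * x) / (1 + b ^ 2)) univ x := by
    intro x _
    have h1 : HasDerivAt (fun x : ℝ => 2 * x) 2 x := by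
      simpa using (hasDerivAt_id x).const_mul 2
    have h2 := ((h1.sinh.sub_const b).div_const (1 + b ^ 2)).hasDerivWithinAt (s := univ)
    refine h2.congr_deriv ?_
    ring
  have key := lintegral_image_eq_lintegral_abs_deriv_mul MeasurableSet.univ hder hinj
    (fun c => g (uCoord (b, c)))
  rw [himg, setLIntegral_univ, setLIntegral_univ] at key
  rw [key]
  refine lintegral_congr fun u => ?_
  rw [hinv, abs_of_pos]
  have := Real.cosh_pos (2 * u)
  positivity

lemma lintegral_arctan (k : ℝ → ℝ≥0∞) :
    ∫⁻ b, ENNReal.ofReal (1 / (1 + b ^ 2)) * k (Real.arctan b) =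
      ∫⁻ ψ in Ioo (-(Real.pi / 2)) (Real.pi / 2), k ψ := by
  rw [← arctan_image_univ, lintegral_image_eq_lintegral_abs_deriv_mul MeasurableSet.univ
    (fun x _ => hasDerivWithinAt_arctan x univ) Real.arctan_injective.injOn, setLIntegral_univ]
  refine lintegral_congr fun b => ?_
  rw [abs_of_pos (by positivity)]

/-- For fixed b the substitution c ↦ u has dc = 2cosh(2u)/(1+b²) du. Then db/(1+b²) = dψ with ψ =
arctan b, and the u-dependent rotation disappears by periodicity. What remains is twice the
invariant density. The image of the chart need not be all of G/H, since it misses only a null set.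
-/
lemma lintegral_coordMap (θ : ℝ) {g : ℝ × ℝ → ℝ≥0∞} (hg : Measurable g) :
    ∫⁻ q, g (coordMap θ q) = 2 * ∫⁻ p, g p ∂coordMeasure := by
  have hgm := hg.comp (measurable_coordMap θ)
  have hm1 : Measurable fun p : ℝ × ℝ =>
      g (toIcoMod Real.pi_pos 0 (θ + Real.arctan p.1 - phiAng p.2), p.2) := by
    refine hg.comp (Measurable.prodMk (measurable_toIcoMod_pi.comp ?_) measurable_snd)
    exact ((continuous_const.add (Real.continuous_arctan.comp continuous_fst)).sub
      (continuous_phiAng.comp continuous_snd)).measurable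
  have hcosh : Continuous fun u : ℝ => Real.cosh (2 * u) := Real.continuous_cosh.comp (by fun_prop)
  calc ∫⁻ q, g (coordMap θ q)
      = ∫⁻ b, ∫⁻ c, g (coordMap θ (b, c)) := by
        rw [Measure.volume_eq_prod]
        exact lintegral_prod (fun q => g (coordMap θ q)) hgm.aemeasurable
    _ = ∫⁻ b, ∫⁻ u, ENNReal.ofReal (2 * Real.cosh (2 * u) / (1 + b ^ 2)) *
          g (toIcoMod Real.pi_pos 0 (θ + Real.arctan b - phiAng u), u) := by
        refine lintegral_congr fun b => ?_
        rw [← lintegral_uCoord b (fun u =>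
          g (toIcoMod Real.pi_pos 0 (θ + Real.arctan b - phiAng u), u))]
        rfl
    _ = ∫⁻ u, ∫⁻ b, ENNReal.ofReal (2 * Real.cosh (2 * u) / (1 + b ^ 2)) *
          g (toIcoMod Real.pi_pos 0 (θ + Real.arctan b - phiAng u), u) := by
        refine lintegral_lintegral_swap ?_
        refine (Measurable.mul (Measurable.ennreal_ofReal ?_) hm1).aemeasurable
        have : Measurable fun p : ℝ × ℝ => Real.cosh (2 * p.2) :=
          (hcosh.comp continuous_snd).measurable
        exact (this.const_mul 2).div (by fun_prop)
    _ = ∫⁻ u, ENNReal.ofReal (2 * Real.cosh (2 * u)) * ∫⁻ θ in Ico 0 Real.pi, g (θ, u) := by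
        refine lintegral_congr fun u => ?_
        have h1 : ∀ b : ℝ, ENNReal.ofReal (2 * Real.cosh (2 * u) / (1 + b ^ 2)) *
            g (toIcoMod Real.pi_pos 0 (θ + Real.arctan b - phiAng u), u) =
            ENNReal.ofReal (2 * Real.cosh (2 * u)) * (ENNReal.ofReal (1 / (1 + b ^ 2)) *
              (fun ψ => g (toIcoMod Real.pi_pos 0 (ψ + (θ - phiAng u)), u)) (Real.arctan b)) := by
          intro b
          have hc := Real.cosh_pos (2 * u)
          rw [← mul_assoc, ← ENNReal.ofReal_mul (by positivity), mul_one_div]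
          simp only []
          congr 4
          ring
        simp_rw [h1]
        have h2 : Measurable fun ψ : ℝ => g (toIcoMod Real.pi_pos 0 (ψ + (θ - phiAng u)), u) := by
          refine hg.comp (Measurable.prodMk (measurable_toIcoMod_pi.comp ?_) measurable_const)
          fun_prop
        rw [lintegral_const_mul _ (by
          refine Measurable.mul (by fun_prop) ?_
          exact h2.comp Real.measurable_arctan),
          lintegral_arctan fun ψ => g (toIcoMod Real.pi_pos 0 (ψ + (θ - phiAng u)), u)]
        congr 1
        rw [setLIntegral_congr Ioo_ae_eq_Ioc]
        have h3 := lintegral_Ioc_pi_periodic (K := fun ψ => g (toIcoMod Real.pi_pos 0 ψ, u))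
          (fun ψ => by simp only [toIcoMod_add_right]) (-(Real.pi / 2)) (θ - phiAng u)
        rw [show -(Real.pi / 2) + Real.pi = Real.pi / 2 by ring] at h3
        rw [h3]
        refine setLIntegral_congr_fun measurableSet_Ico fun ψ hψ => ?_
        rw [(toIcoMod_eq_self Real.pi_pos).2 (by simpa using hψ)]
    _ = 2 * ∫⁻ p, g p ∂coordMeasure := by
        rw [coordMeasure, lintegral_withDensity_eq_lintegral_mul _ measurable_density.coe_nnreal_ennreal hg,
          coordDomain, Measure.volume_eq_prod, ← Measure.prod_restrict, Measure.restrict_univ,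
          lintegral_prod_symm _ (measurable_density.coe_nnreal_ennreal.mul hg).aemeasurable,
          ← lintegral_const_mul _ (Measurable.lintegral_prod_left'
            (measurable_density.coe_nnreal_ennreal.mul hg))]
        refine lintegral_congr fun u => ?_
        have h4 : Measurable fun θ : ℝ => g (θ, u) := hg.comp (by fun_prop)
        simp only [Pi.mul_apply]
        rw [lintegral_const_mul _ h4, ← mul_assoc, ENNReal.ofReal_mul (by norm_num)]
        congr 2
        simp

lemma map_coordMap (θ : ℝ) : Measure.map (coordMap θ) volume = (2 : ℝ≥0∞) • coordMeasure := by
  refine Measure.ext_of_lintegral _ fun g hg => ?_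
  rw [lintegral_map hg (measurable_coordMap θ), lintegral_coordMap θ hg, lintegral_smul_measure,
    smul_eq_mul]

lemma density_smul (F : G → ℂ) (p : ℝ × ℝ) :
    Real.toNNReal (Real.cosh (2 * p.2)) • F (kG p.1 * bG p.2) = coordDensity F p := by
  rw [NNReal.smul_def, Real.coe_toNNReal _ (Real.cosh_pos _).le, Complex.real_smul, mul_comm,
    coordDensity]

/-- The function of the coordinates `(θ, u)` defined by a function on `G`. -/
def onCoord (F : G → ℂ) (p : ℝ × ℝ) : ℂ := F (kG p.1 * bG p.2)

/-- Integration over `G/H` in the chart `(b, c) ↦ k_θ n_b n̄_c H`. -/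
lemma HInv.integrableGH_iff {F : G → ℂ} (hF : HInv F) (hm : Measurable (onCoord F)) (θ : ℝ) :
    IntegrableGH F ↔ Integrable fun q : ℝ × ℝ => F (kG θ * (nG q.1 * nbarG q.2)) := by
  have h1 : (fun q : ℝ × ℝ => F (kG θ * (nG q.1 * nbarG q.2))) = onCoord F ∘ coordMap θ := by
    ext q
    exact (hF.apply_coordMap θ q).symm
  rw [h1, ← integrable_map_measure hm.aestronglyMeasurable (measurable_coordMap θ).aemeasurable,
    map_coordMap, integrable_smul_measure (by simp) (by simp), coordMeasure,
    integrable_withDensity_iff_integrable_smul measurable_density]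
  simp_rw [onCoord, density_smul]
  rfl

lemma HInv.integralGH_eq {F : G → ℂ} (hF : HInv F) (hm : Measurable (onCoord F)) (θ : ℝ) :
    integralGH F = 2⁻¹ * ∫ q : ℝ × ℝ, F (kG θ * (nG q.1 * nbarG q.2)) := by
  have h1 : (fun q : ℝ × ℝ => F (kG θ * (nG q.1 * nbarG q.2))) =
      fun q => onCoord F (coordMap θ q) := by
    ext q
    exact (hF.apply_coordMap θ q).symm
  rw [h1, ← integral_map (measurable_coordMap θ).aemeasurable hm.aestronglyMeasurable,
    map_coordMap, integral_smul_measure, coordMeasure,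
    integral_withDensity_eq_integral_smul measurable_density]
  simp_rw [onCoord, density_smul]
  rw [integralGH]
  simp

lemma measurePreserving_reflect : MeasurePreserving (Prod.map id (fun u : ℝ => -u))
    ((volume : Measure (ℝ × ℝ)).restrict coordDomain)
    ((volume : Measure (ℝ × ℝ)).restrict coordDomain) := by
  rw [coordDomain, Measure.volume_eq_prod, ← Measure.prod_restrict, Measure.restrict_univ]
  exact (MeasurePreserving.id _).prod (Measure.measurePreserving_neg volume)

lemma measurableEmbedding_reflect :
    MeasurableEmbedding (Prod.map (id : ℝ → ℝ) (fun u : ℝ => -u)) :=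
  MeasurableEmbedding.id.prodMap (MeasurableEquiv.neg ℝ).measurableEmbedding

/-- Right translation by `w₀`, combined with a rotation. -/
def flipG (F : G → ℂ) (g : G) : ℂ := F (kG (-(Real.pi / 2)) * g * w0)

/-- Since k_{π/2} = w₀ commutes with rotations and w₀⁻¹ b_u w₀ = b_{-u}, the flip is u ↦ -u. It
preserves the measure and yields the second chart from the first. -/
lemma coordDensity_flipG (F : G → ℂ) (p : ℝ × ℝ) :
    coordDensity (flipG F) p = coordDensity F (Prod.map id (fun u : ℝ => -u) p) := by
  have : kG (-(Real.pi / 2)) * (kG p.1 * bG p.2) * w0 = kG p.1 * bG (-p.2) := by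
    rw [← mul_assoc, ← kG_add]
    apply G.ext_entries <;> simp [G.mul_apply, Real.cos_add, Real.sin_add]
    all_goals ring
  simp [coordDensity, flipG, this]

lemma reflect_reflect (p : ℝ × ℝ) :
    Prod.map id (fun u : ℝ => -u) (Prod.map id (fun u : ℝ => -u) p) = p := by
  ext
  · rfl
  · exact neg_neg p.2

lemma integrableGH_flipG {F : G → ℂ} : IntegrableGH (flipG F) ↔ IntegrableGH F := by
  rw [IntegrableGH, IntegrableGH, IntegrableOn, IntegrableOn,
    ← measurePreserving_reflect.integrable_comp_emb measurableEmbedding_reflect]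
  refine integrable_congr (Filter.Eventually.of_forall fun p => ?_)
  simp only [Function.comp_apply, coordDensity_flipG, reflect_reflect]

lemma integralGH_flipG {F : G → ℂ} : integralGH (flipG F) = integralGH F := by
  rw [integralGH, integralGH,
    ← measurePreserving_reflect.integral_comp measurableEmbedding_reflect]
  simp_rw [coordDensity_flipG, reflect_reflect]

lemma HInv.flipG {F : G → ℂ} (hF : HInv F) : HInv (flipG F) := by
  intro g t
  have : kG (-(Real.pi / 2)) * (g * diagG t) * w0 =
      kG (-(Real.pi / 2)) * g * w0 * diagG t⁻¹ := by
    apply G.ext_entries <;> simp [G.mul_apply]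
  rw [SLTwo.flipG, this, hF, SLTwo.flipG]

lemma kG_shift_w0 (θ : ℝ) (g : G) :
    kG (-(Real.pi / 2)) * (kG (θ + Real.pi / 2) * g) * w0 = kG θ * (g * w0) := by
  rw [← mul_assoc, ← kG_add, mul_assoc]
  congr 2
  ring

lemma measurable_onCoord_flipG {F : G → ℂ} (hm : Measurable (onCoord F)) :
    Measurable (onCoord (flipG F)) := by
  have : onCoord (flipG F) = onCoord F ∘ Prod.map id (fun u : ℝ => -u) := by
    ext p
    have := coordDensity_flipG F p
    simp only [coordDensity, Prod.map_snd, mul_neg, Real.cosh_neg] at this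
    exact mul_right_cancel₀ (by exact_mod_cast (Real.cosh_pos _).ne') this
  rw [this]
  exact hm.comp measurableEmbedding_reflect.measurable

/-- Integration over `G/H` in the chart `(b, c) ↦ k_θ n_b n̄_c w₀ H`. -/
lemma HInv.integrableGH_iff_w0 {F : G → ℂ} (hF : HInv F) (hm : Measurable (onCoord F)) (θ : ℝ) :
    IntegrableGH F ↔ Integrable fun q : ℝ × ℝ => F (kG θ * (nG q.1 * nbarG q.2 * w0)) := by
  rw [← integrableGH_flipG, hF.flipG.integrableGH_iff (measurable_onCoord_flipG hm)
    (θ + Real.pi / 2)]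
  simp_rw [SLTwo.flipG, kG_shift_w0]

lemma HInv.integralGH_eq_w0 {F : G → ℂ} (hF : HInv F) (hm : Measurable (onCoord F)) (θ : ℝ) :
    integralGH F = 2⁻¹ * ∫ q : ℝ × ℝ, F (kG θ * (nG q.1 * nbarG q.2 * w0)) := by
  rw [← integralGH_flipG, hF.flipG.integralGH_eq (measurable_onCoord_flipG hm)
    (θ + Real.pi / 2)]
  simp_rw [SLTwo.flipG, kG_shift_w0]

/-! ### Partition of unity on G/H and fibre integrals -/

/-- A smooth step with `part (1 - t) = 1 - part t`, vanishing for `t ≤ 1/4`. -/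
def part (t : ℝ) : ℝ := Real.smoothTransition (2 * t - 1 / 2)

lemma contDiff_part : ContDiff ℝ ∞ part := by
  unfold part
  exact Real.smoothTransition.contDiff.comp (by fun_prop)

/-- For t = g₀₀g₁₁, which is invariant under right H, the determinant gives 1 - t = -g₀₁g₁₀. Thus
`part t` and `part (1 - t)` form a partition of unity subordinate to {g₁₁ ≠ 0} and {g₁₀ ≠ 0}, the
two charts. -/
lemma part_one_sub (t : ℝ) : part (1 - t) = 1 - part t := by
  have h1 : 2 * (1 - t) - 1 / 2 = 1 - (2 * t - 1 / 2) := by ring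
  rw [part, part, h1, Real.smoothTransition, Real.smoothTransition, sub_sub_cancel]
  have := Real.smoothTransition.pos_denom (2 * t - 1 / 2)
  rw [add_comm (expNegInvGlue (1 - (2 * t - 1 / 2))), eq_sub_iff_add_eq, ← add_div, add_comm,
    div_self this.ne']

lemma lt_of_part_ne_zero {t : ℝ} (h : part t ≠ 0) : 1 / 4 < t := by
  by_contra! hle
  exact h (Real.smoothTransition.zero_of_nonpos (by linarith))

/-- Compact support modulo `H`. -/
def CompactModH (f : G → ℂ) : Prop :=
  ∃ C : Set G, IsCompact C ∧ ∀ g : G, f g ≠ 0 → ∃ c ∈ C, ∃ t : ℝˣ, g = c * diagG t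

/-- The part of `f` near `{c = 0}`, in the chart `k_θ n_b n̄_c H`. -/
def chartFun (f : G → ℂ) (p : ℝ × ℝ) (b : ℝ) : ℂ :=
  (part (1 + b * p.2) : ℂ) * f (kG p.1 * (nG b * nbarG p.2))

lemma continuous_entry (i j : Fin 2) : Continuous fun g : G => g i j := by
  have h1 : Continuous fun g : G => (g : Matrix (Fin 2) (Fin 2) ℝ) := continuous_subtype_val
  exact h1.matrix_elem i j

lemma exists_entry_bound {C : Set G} (hC : IsCompact C) :
    ∃ M : ℝ, 1 ≤ M ∧ ∀ g ∈ C, ∀ i j, |g i j| ≤ M := by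
  have h : ∀ i j, ∃ M : ℝ, ∀ g ∈ C, |g i j| ≤ M := fun i j => by
    obtain ⟨M, hM⟩ := hC.exists_bound_of_continuousOn (continuous_entry i j).continuousOn
    exact ⟨M, hM⟩
  choose M hM using h
  refine ⟨1 + ∑ i, ∑ j, |M i j|, ?_, fun g hg i j => ?_⟩
  · have : 0 ≤ ∑ i, ∑ j, |M i j| := by positivity
    linarith
  · have h1 : |M i j| ≤ ∑ j, |M i j| :=
      Finset.single_le_sum (f := fun j => |M i j|) (fun _ _ => abs_nonneg _) (Finset.mem_univ j)
    have h2 : ∑ j, |M i j| ≤ ∑ i, ∑ j, |M i j| :=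
      Finset.single_le_sum (f := fun i => ∑ j, |M i j|) (fun _ _ => by positivity)
        (Finset.mem_univ i)
    linarith [hM i j g hg, le_abs_self (M i j)]

lemma kG_neg_mul (θ : ℝ) (g : G) : kG (-θ) * (kG θ * g) = g := by
  rw [← mul_assoc, ← kG_add, neg_add_cancel]
  have : kG 0 = 1 := by
    apply G.ext_entries <;> simp
  rw [this, one_mul]

/-- The chart point equals y diag(t, t⁻¹) with all |y_ij| ≤ 2M. Then t = y₁₁, c = y₁₀t, bt = y₀₁ and
1 + bc = y₀₀t. The cutoff forces y₀₀t > 1/4, so |t| > 1/(8M) and |b| < 16M², while |c| ≤ 4M².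
Without the cutoff b would be unbounded. -/
lemma chartFun_supp {f : G → ℂ} (hf : CompactModH f) :
    ∃ R : ℝ, 0 < R ∧ ∀ p b, chartFun f p b ≠ 0 → |b| ≤ R ∧ |p.2| ≤ R := by
  obtain ⟨C, hC, hfC⟩ := hf
  obtain ⟨M, hM1, hM⟩ := exists_entry_bound hC
  refine ⟨16 * M ^ 2, by positivity, fun p b hne => ?_⟩
  have hpart : part (1 + b * p.2) ≠ 0 := fun h => hne (by simp [chartFun, h])
  have hf0 : f (kG p.1 * (nG b * nbarG p.2)) ≠ 0 := fun h => hne (by simp [chartFun, h])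
  obtain ⟨x, hx, t, hxt⟩ := hfC _ hf0
  have hy : nG b * nbarG p.2 = kG (-p.1) * x * diagG t := by
    rw [mul_assoc, ← hxt, kG_neg_mul]
  set y := kG (-p.1) * x with hydef
  have hyM : ∀ i j, |y i j| ≤ 2 * M := by
    intro i j
    have hk : ∀ i j, |kG (-p.1) i j| ≤ 1 := by
      intro i j
      fin_cases i <;> fin_cases j <;> simp [Real.abs_cos_le_one, Real.abs_sin_le_one]
    rw [hydef, G.mul_apply]
    refine (abs_add_le _ _).trans ?_
    rw [abs_mul, abs_mul]
    nlinarith [hk i 0, hk i 1, hM x hx 0 j, hM x hx 1 j, abs_nonneg (kG (-p.1) i 0),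
      abs_nonneg (kG (-p.1) i 1), abs_nonneg (x 0 j), abs_nonneg (x 1 j)]
  have ht0 : (t : ℝ) ≠ 0 := t.ne_zero
  have e11 : y 1 1 = t := by
    have := congrArg (fun g : G => g 1 1) hy
    simp [G.mul_apply] at this
    field_simp at this
    exact this.symm
  have e01 : b * t = y 0 1 := by
    have := congrArg (fun g : G => g 0 1) hy
    simp [G.mul_apply] at this
    rw [this]
    field_simp
  have e10 : p.2 = y 1 0 * t := by
    have := congrArg (fun g : G => g 1 0) hy
    simpa [G.mul_apply] using this
  have e00 : 1 + b * p.2 = y 0 0 * t := by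
    have := congrArg (fun g : G => g 0 0) hy
    simpa [G.mul_apply] using this
  have h4 := lt_of_part_ne_zero hpart
  have ht : |(t : ℝ)| ≤ 2 * M := e11 ▸ hyM 1 1
  have ht' : 1 / 4 < 2 * M * |(t : ℝ)| := by
    rw [e00] at h4
    have := le_abs_self (y 0 0 * t)
    rw [abs_mul] at this
    nlinarith [hyM 0 0, abs_nonneg (t : ℝ)]
  constructor
  · have h5 : |b| * |(t : ℝ)| ≤ 2 * M := by
      rw [← abs_mul, e01]
      exact hyM 0 1
    by_contra! hb
    nlinarith [abs_nonneg (t : ℝ), abs_nonneg b]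
  · rw [e10, abs_mul]
    nlinarith [hyM 1 0, abs_nonneg (y 1 0), abs_nonneg (t : ℝ)]

lemma contDiff_chartFun {f : G → ℂ} (hf : SmoothG f) :
    ContDiff ℝ ∞ fun q : (ℝ × ℝ) × ℝ => chartFun f q.1 q.2 := by
  refine ContDiff.mul ?_ ?_
  · exact Complex.ofRealCLM.contDiff.comp (contDiff_part.comp (by fun_prop))
  · refine hf.contDiff_comp fun i j => ?_
    fin_cases i <;> fin_cases j <;> simp [G.mul_apply] <;> fun_prop

/-- Integral over the fibres `b` of the chart. -/
def fibreInt (f : G → ℂ) (θ c : ℝ) : ℂ := ∫ b, chartFun f (θ, c) b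

lemma exists_fam_fibreInt {f : G → ℂ} (hs : SmoothG f) (hf : CompactModH f) :
    ∃ R, Fam R (chartFun f) ∧ Fam R (fibreInt f) := by
  obtain ⟨R, hR, hsupp⟩ := chartFun_supp hf
  have h1 : Fam R (chartFun f) := ⟨hR, contDiff_chartFun hs, fun p b hb => by
    by_contra hne
    linarith [(hsupp p b hne).1]⟩
  refine ⟨R, h1, hR, ?_, fun θ c hc => ?_⟩
  · have := contDiff_integral_mul h1 (w := fun _ => 1) (locallyIntegrable_const 1)
    simpa [fibreInt] using this
  · have : ∀ b, chartFun f (θ, c) b = 0 := fun b => by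
      by_contra hne
      have := (hsupp (θ, c) b hne).2
      simp only at this
      linarith
    simp [fibreInt, this]

lemma integrable_chart {f : G → ℂ} (hs : SmoothG f) (hf : CompactModH f) (θ : ℝ) {w : ℝ → ℂ}
    (hw : LocallyIntegrable w) :
    Integrable (fun q : ℝ × ℝ => w q.2 * chartFun f (θ, q.2) q.1) ∧
      ∫ q : ℝ × ℝ, w q.2 * chartFun f (θ, q.2) q.1 = ∫ c, w c * fibreInt f θ c := by
  obtain ⟨R, hR, hsupp⟩ := chartFun_supp hf
  have hcont : Continuous fun q : ℝ × ℝ => chartFun f (θ, q.2) q.1 :=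
    Continuous.comp (g := fun q : (ℝ × ℝ) × ℝ => chartFun f q.1 q.2)
      (f := fun q : ℝ × ℝ => ((θ, q.2), q.1)) (contDiff_chartFun hs).continuous (by fun_prop)
  have hcs : HasCompactSupport fun q : ℝ × ℝ => chartFun f (θ, q.2) q.1 := by
    refine HasCompactSupport.intro ((isCompact_Icc (a := -R) (b := R)).prod
      (isCompact_Icc (a := -R) (b := R))) fun q hq => ?_
    by_contra hne
    have := hsupp (θ, q.2) q.1 hne
    exact hq ⟨abs_le.1 this.1, abs_le.1 this.2⟩
  obtain ⟨B, hB⟩ := hcs.exists_bound_of_continuous hcont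
  have i1 : Integrable ((Icc (-R) R).indicator fun _ : ℝ => (1 : ℂ)) :=
    (integrable_indicator_iff measurableSet_Icc).2 (integrableOn_const (by simp) (by simp))
  have i2 : Integrable ((Icc (-R) R).indicator w) :=
    (integrable_indicator_iff measurableSet_Icc).2 (hw.integrableOn_isCompact isCompact_Icc)
  -- The integrand is a product of an integrable function of b, an integrable function of c and a
  -- bounded continuous function.
  have i3 := (i1.mul_prod i2).mul_bdd (c := B) hcont.aestronglyMeasurable
    (Filter.Eventually.of_forall hB)
  have e : (fun q : ℝ × ℝ => w q.2 * chartFun f (θ, q.2) q.1) = fun q : ℝ × ℝ =>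
      (Icc (-R) R).indicator (fun _ : ℝ => (1 : ℂ)) q.1 * (Icc (-R) R).indicator w q.2 *
        chartFun f (θ, q.2) q.1 := by
    ext q
    by_cases hne : chartFun f (θ, q.2) q.1 = 0
    · simp [hne]
    · have := hsupp (θ, q.2) q.1 hne
      rw [indicator_of_mem (show q.1 ∈ Icc (-R) R from abs_le.1 this.1),
        indicator_of_mem (show q.2 ∈ Icc (-R) R from abs_le.1 this.2), one_mul]
  have i4 : Integrable (fun q : ℝ × ℝ => w q.2 * chartFun f (θ, q.2) q.1)
      ((volume : Measure ℝ).prod volume) := by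
    rw [e]
    exact i3
  refine ⟨i4, ?_⟩
  rw [Measure.volume_eq_prod, integral_prod_symm _ i4]
  refine integral_congr_ae (Filter.Eventually.of_forall fun c => ?_)
  simp only []
  rw [integral_const_mul, fibreInt]

/-! ### Equivariance of the kernel and of the integrand -/

lemma spow_mul (ε : ZMod 2) (s : ℂ) (x y : ℝ) : spow ε s (x * y) = spow ε s x * spow ε s y := by
  have h1 : Real.sign (x * y) = Real.sign x * Real.sign y := by
    rcases lt_trichotomy x 0 with hx | rfl | hx <;> rcases lt_trichotomy y 0 with hy | rfl | hy <;>
      simp [Real.sign_of_pos, Real.sign_of_neg, mul_pos_of_neg_of_neg, mul_neg_of_neg_of_pos,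
        mul_neg_of_pos_of_neg, *]
  rw [spow, spow, spow, h1, abs_mul]
  push_cast
  rw [Complex.mul_cpow_ofReal_nonneg (abs_nonneg x) (abs_nonneg y), mul_pow]
  ring

lemma spow_one_right (ε : ZMod 2) (s : ℂ) : spow ε s 1 = 1 := by
  rw [spow_of_pos _ _ one_pos]
  simp

lemma spow_add_mul (ε ξ : ZMod 2) (s s' : ℂ) {x : ℝ} (hx : x ≠ 0) :
    spow ε s x * spow ξ s' x = spow (ε + ξ) (s + s') x := by
  have h1 : ((Real.sign x : ℝ) : ℂ) ^ ε.val * ((Real.sign x : ℝ) : ℂ) ^ ξ.val =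
      ((Real.sign x : ℝ) : ℂ) ^ (ε + ξ).val := by
    have h2 : ((Real.sign x : ℝ) : ℂ) * ((Real.sign x : ℝ) : ℂ) = 1 := by
      rcases Real.sign_apply_eq_of_ne_zero x hx with h | h <;> simp [h]
    rcases zmod_two_cases ε with rfl | rfl <;> rcases zmod_two_cases ξ with rfl | rfl
    · simp
    · simp [ZMod.val_one]
    · simp [ZMod.val_one]
    · have : (1 + 1 : ZMod 2) = 0 := by decide
      rw [this]
      simpa [ZMod.val_one] using h2
  have h3 : ((|x| : ℝ) : ℂ) ≠ 0 := by simpa using hx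
  rw [spow, spow, spow, ← h1, Complex.cpow_add _ _ h3]
  ring

lemma spow_inv (ε : ZMod 2) (s : ℂ) {x : ℝ} (hx : x ≠ 0) : spow ε s x⁻¹ = (spow ε s x)⁻¹ := by
  have := spow_mul ε s x⁻¹ x
  rw [inv_mul_cancel₀ hx, spow_one_right] at this
  exact eq_inv_of_mul_eq_one_left this.symm

lemma spow_ne_zero (ε : ZMod 2) (s : ℂ) {x : ℝ} (hx : x ≠ 0) : spow ε s x ≠ 0 := by
  have h := spow_mul ε s x⁻¹ x
  rw [inv_mul_cancel₀ hx, spow_one_right] at h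
  intro h0
  rw [h0, mul_zero] at h
  exact one_ne_zero h

/-- Left multiplication scales the two entries by t and t⁻¹, so the difference of the exponents,
which is l, and of the parities, which is ε, comes out. In `kernelK_mul_diag_n` both entries scale
by t and the sum μ - 1 of the exponents appears. -/
lemma kernelK_diag_mul (ε ξ : ZMod 2) (l μ : ℂ) (t : ℝˣ) (g : G) :
    kernelK ε ξ l μ (diagG t * g) = spow ε l t * kernelK ε ξ l μ g := by
  have ht : (t : ℝ) ≠ 0 := t.ne_zero
  have h1 := spow_add_mul ε ξ l ((μ - l - 1) / 2) ht
  have h2 : (l + μ - 1) / 2 = l + (μ - l - 1) / 2 := by ring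
  rw [kernelK, kernelK]
  simp only [G.mul_apply, diagG_00, diagG_01, diagG_10, diagG_11, zero_mul, add_zero, zero_add]
  rw [spow_mul, spow_mul, h2, add_comm ξ ε, ← h1, spow_inv _ _ ht]
  field_simp [spow_ne_zero ξ ((μ - l - 1) / 2) ht]

lemma kernelK_mul_diag_n (ε ξ : ZMod 2) (l μ : ℂ) (t : ℝˣ) (x : ℝ) (g : G) :
    kernelK ε ξ l μ (g * (diagG t * nG x)) = spow ε (μ - 1) t * kernelK ε ξ l μ g := by
  have ht : (t : ℝ) ≠ 0 := t.ne_zero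
  have h1 := spow_add_mul (ξ + ε) ξ ((l + μ - 1) / 2) ((μ - l - 1) / 2) ht
  have h2 : (l + μ - 1) / 2 + (μ - l - 1) / 2 = μ - 1 := by ring
  have h3 : ξ + ε + ξ = ε := by
    rw [add_right_comm, CharTwo.add_self_eq_zero, zero_add]
  rw [h2, h3] at h1
  rw [kernelK, kernelK, ← h1]
  simp only [G.mul_apply, diagG_00, diagG_01, diagG_10, diagG_11, nG_00, nG_10]
  simp only [mul_one, mul_zero, add_zero]
  rw [spow_mul, spow_mul]
  ring

lemma hInv_integrandA {ε : ZMod 2} {l : ℂ} {f : G → ℂ} (hf : f ∈ IndHc ε l) (ξ : ZMod 2) (ν : ℂ)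
    (g : G) : HInv (integrandA ε ξ l ν f g) := by
  intro x t
  have ht : (t : ℝ) ≠ 0 := t.ne_zero
  have h1 : (diagG t)⁻¹ = diagG t⁻¹ := by
    apply G.ext_entries <;> simp
  have h2 : spow ε (-l) (t⁻¹ : ℝˣ) = spow ε l t := by
    have := spow_add_mul ε ε l (-l) ht
    rw [CharTwo.add_self_eq_zero, add_neg_cancel] at this
    have h0 : spow 0 0 (t : ℝ) = 1 := by simp [spow]
    rw [Units.val_inv_eq_inv_val, spow_inv _ _ ht]
    rw [h0] at this
    exact (eq_inv_of_mul_eq_one_left this).symm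
  rw [integrandA, integrandA, mul_inv_rev, h1, mul_assoc, kernelK_diag_mul, hf.2.1, h2]
  field_simp [spow_ne_zero ε l ht]

lemma integrandA_mul_diag_n (ε ξ : ZMod 2) (l ν : ℂ) (f : G → ℂ) (g : G) (t : ℝˣ) (x : ℝ) (y : G) :
    integrandA ε ξ l ν f (g * (diagG t * nG x)) y =
      spow ε (-ν - 1) t * integrandA ε ξ l ν f g y := by
  rw [integrandA, integrandA, ← mul_assoc, kernelK_mul_diag_n, mul_assoc]

/-- Right translate by `w₀`. -/
def w0Translate (f : G → ℂ) (g : G) : ℂ := f (g * w0)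

lemma CompactModH.w0Translate {f : G → ℂ} (hf : CompactModH f) : CompactModH (w0Translate f) := by
  obtain ⟨C, hC, hfC⟩ := hf
  refine ⟨(fun c => c * w0⁻¹) '' C, hC.image (continuous_mul_const _), fun g hg => ?_⟩
  obtain ⟨c, hc, t, ht⟩ := hfC _ hg
  refine ⟨_, ⟨c, hc, rfl⟩, t⁻¹, ?_⟩
  have h1 : diagG t * w0⁻¹ = w0⁻¹ * diagG t⁻¹ := by
    apply G.ext_entries <;> simp [G.mul_apply]
  rw [eq_mul_inv_of_mul_eq ht, mul_assoc, h1, mul_assoc]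

lemma SmoothG.w0Translate {f : G → ℂ} (hf : SmoothG f) : SmoothG (w0Translate f) := by
  obtain ⟨U, F, hU, hF, h⟩ := hf
  let L : (Fin 2 → Fin 2 → ℝ) → (Fin 2 → Fin 2 → ℝ) :=
    fun M => ![![-M 0 1, M 0 0], ![-M 1 1, M 1 0]]
  have hL : ContDiff ℝ ∞ L := by
    refine contDiff_pi.2 fun i => contDiff_pi.2 fun j => ?_
    fin_cases i <;> fin_cases j <;> simp [L] <;> fun_prop
  have hLg : ∀ g : G, L (fun i j => g i j) = fun i j => (g * w0) i j := by
    intro g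
    ext i j
    fin_cases i <;> fin_cases j <;> simp [L, -Matrix.SpecialLinearGroup.coe_mul, G.mul_apply]
  refine ⟨L ⁻¹' U, F ∘ L, hU.preimage hL.continuous, hF.comp hL.contDiffOn (fun _ hx => hx),
    fun g => ?_⟩
  have := h (g * w0)
  rw [mem_preimage, Function.comp_apply, hLg]
  exact this

lemma SmoothG.continuous_onCoord {f : G → ℂ} (hf : SmoothG f) : Continuous (onCoord f) := by
  refine (hf.contDiff_comp (γ := fun p : ℝ × ℝ => kG p.1 * bG p.2) fun i j => ?_).continuous
  fin_cases i <;> fin_cases j <;> simp [-Matrix.SpecialLinearGroup.coe_mul, G.mul_apply] <;>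
    fun_prop

lemma measurable_onCoord_integrandA {f : G → ℂ} (hf : SmoothG f) (ε ξ : ZMod 2) (l ν : ℂ) (g : G) :
    Measurable (onCoord (integrandA ε ξ l ν f g)) := by
  have h1 := hf.continuous_onCoord.measurable
  unfold onCoord integrandA kernelK
  refine Measurable.mul (Measurable.mul ?_ ?_) h1
  · refine (measurable_spow _ _).comp (Continuous.measurable ?_)
    simp only [G.mul_apply, G.inv_00, G.inv_01, kG_00, kG_01, kG_10, kG_11, bG_01, bG_11]
    fun_prop
  · refine (measurable_spow _ _).comp (Continuous.measurable ?_)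
    simp only [G.mul_apply, G.inv_10, G.inv_11, kG_00, kG_01, kG_10, kG_11, bG_00, bG_10]
    fun_prop

/-- The cutoff to the chart `k_θ n_b n̄_c H`, as a function on `G/H`. -/
def chartCut (θ : ℝ) (g : G) : ℝ := part ((kG (-θ) * g) 0 0 * (kG (-θ) * g) 1 1)

lemma hInv_chartCut (θ : ℝ) (g : G) (t : ℝˣ) : chartCut θ (g * diagG t) = chartCut θ g := by
  rw [chartCut, chartCut, ← mul_assoc]
  congr 1
  have ht : (t : ℝ) ≠ 0 := t.ne_zero
  rw [G.mul_apply _ (diagG t), G.mul_apply _ (diagG t)]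
  simp
  field_simp

lemma measurable_onCoord_chartCut (θ : ℝ) :
    Measurable fun p : ℝ × ℝ => chartCut θ (kG p.1 * bG p.2) := by
  refine Continuous.measurable (contDiff_part.continuous.comp ?_)
  simp only [G.mul_apply, kG_00, kG_01, kG_10, kG_11, bG_00, bG_01, bG_10, bG_11]
  fun_prop

/-! ### The operator A in the charts and its entire continuation -/

section Formula

variable {ε ξ : ZMod 2} {l ν : ℂ} {f : G → ℂ}

/-- The kernel at g⁻¹ involves only g₁₁ and -g₁₀. In this chart they are 1 and -c, so one factor is
trivial and the other is a power of c. In the w₀-chart they are c and 1, and the roles are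
exchanged. -/
lemma chartCut_mul_integrandA (θ : ℝ) (q : ℝ × ℝ) :
    (chartCut θ (kG θ * (nG q.1 * nbarG q.2)) : ℂ) *
        integrandA ε ξ l ν f (kG θ) (kG θ * (nG q.1 * nbarG q.2)) =
      (-1) ^ ξ.val * (spow ξ ((l - ν - 1) / 2) q.2 * chartFun f (θ, q.2) q.1) := by
  have h1 : (kG θ * (nG q.1 * nbarG q.2))⁻¹ * kG θ = (nG q.1 * nbarG q.2)⁻¹ := by
    rw [mul_inv_rev, inv_mul_cancel_right]
  rw [chartCut, kG_neg_mul, integrandA, h1, kernelK]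
  simp only [G.inv_00, G.inv_10, G.mul_apply, nG_00, nG_01, nG_10, nG_11, nbarG_00, nbarG_01,
    nbarG_10, nbarG_11]
  rw [show (0 : ℝ) * 0 + 1 * 1 = 1 by ring, show -((0 : ℝ) * 1 + 1 * q.2) = -q.2 by ring,
    spow_one_right, spow_neg, chartFun]
  simp only [mul_one, one_mul]
  rw [show (-ν - -l - 1) / 2 = (l - ν - 1) / 2 by ring]
  ring

lemma chartCut_mul_integrandA_w0 (θ : ℝ) (q : ℝ × ℝ) :
    ((1 - chartCut θ (kG θ * (nG q.1 * nbarG q.2 * w0)) : ℝ) : ℂ) *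
        integrandA ε ξ l ν f (kG θ) (kG θ * (nG q.1 * nbarG q.2 * w0)) =
      spow (ξ + ε) ((-l - ν - 1) / 2) q.2 * chartFun (w0Translate f) (θ, q.2) q.1 := by
  have h1 : (kG θ * (nG q.1 * nbarG q.2 * w0))⁻¹ * kG θ = (nG q.1 * nbarG q.2 * w0)⁻¹ := by
    rw [mul_inv_rev, inv_mul_cancel_right]
  rw [chartCut, kG_neg_mul, integrandA, h1, kernelK]
  simp only [G.inv_00, G.inv_10, G.mul_apply, nG_00, nG_01, nG_10, nG_11, nbarG_00, nbarG_01,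
    nbarG_10, nbarG_11, w0_00, w0_01, w0_10, w0_11]
  rw [← part_one_sub, chartFun, w0Translate, mul_assoc (kG θ)]
  have e1 : 1 - ((1 * 1 + q.1 * q.2) * 0 + (1 * 0 + q.1 * 1) * -1) *
      ((0 * 1 + 1 * q.2) * 1 + (0 * 0 + 1 * 1) * 0) = 1 + q.1 * q.2 := by ring
  have e2 : (0 * 1 + 1 * q.2) * 1 + (0 * 0 + 1 * 1) * 0 = q.2 := by ring
  have e3 : -((0 * 1 + 1 * q.2) * 0 + (0 * 0 + 1 * 1) * -1) = (1 : ℝ) := by ring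
  rw [e1, e2, e3, spow_one_right, show (-l + -ν - 1) / 2 = (-l - ν - 1) / 2 by ring]
  ring

/-- Each half of the partition of unity is integrated in its own chart. Because Re l = 0, both
exponents have real part -(1 + Re ν)/2, which exceeds -1 exactly when Re ν < 1. -/
lemma integrandA_kG (hl : l.re = 0) (hf : f ∈ IndHc ε l) (hν : ν.re < 1) (θ : ℝ) :
    IntegrableGH (integrandA ε ξ l ν f (kG θ)) ∧
      integralGH (integrandA ε ξ l ν f (kG θ)) =
        2⁻¹ * ((-1) ^ ξ.val * ∫ c, spow ξ ((l - ν - 1) / 2) c * fibreInt f θ c) +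
        2⁻¹ * ∫ c, spow (ξ + ε) ((-l - ν - 1) / 2) c * fibreInt (w0Translate f) θ c := by
  set F := integrandA ε ξ l ν f (kG θ) with hF
  have hinv : HInv F := hInv_integrandA hf ξ ν (kG θ)
  have hm : Measurable (onCoord F) := measurable_onCoord_integrandA hf.1 ε ξ l ν (kG θ)
  set F1 : G → ℂ := fun x => (chartCut θ x : ℂ) * F x with hF1
  set F2 : G → ℂ := fun x => ((1 - chartCut θ x : ℝ) : ℂ) * F x with hF2
  have inv1 : HInv F1 := fun g t => by simp only [hF1]; rw [hInv_chartCut, hinv]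
  have inv2 : HInv F2 := fun g t => by simp only [hF2]; rw [hInv_chartCut, hinv]
  have m1 : Measurable (onCoord F1) :=
    (Complex.measurable_ofReal.comp (measurable_onCoord_chartCut θ)).mul hm
  have m2 : Measurable (onCoord F2) :=
    (Complex.measurable_ofReal.comp ((measurable_onCoord_chartCut θ).const_sub 1)).mul hm
  have hβ : -1 < ((l - ν - 1) / 2).re := by
    simp [hl]
    linarith
  have hα : -1 < ((-l - ν - 1) / 2).re := by
    simp [hl]
    linarith
  obtain ⟨a1, b1⟩ := integrable_chart hf.1 hf.2.2 θ (locallyIntegrable_spow ξ hβ)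
  obtain ⟨a2, b2⟩ := integrable_chart hf.1.w0Translate
    (CompactModH.w0Translate hf.2.2) θ (locallyIntegrable_spow (ξ + ε) hα)
  have i1 : IntegrableGH F1 := by
    rw [inv1.integrableGH_iff m1 θ]
    simp_rw [hF1, hF, chartCut_mul_integrandA]
    exact a1.const_mul _
  have e1 : integralGH F1 = 2⁻¹ * ((-1) ^ ξ.val *
      ∫ c, spow ξ ((l - ν - 1) / 2) c * fibreInt f θ c) := by
    rw [inv1.integralGH_eq m1 θ]
    simp_rw [hF1, hF, chartCut_mul_integrandA]
    rw [integral_const_mul, b1]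
  have i2 : IntegrableGH F2 := by
    rw [inv2.integrableGH_iff_w0 m2 θ]
    simp_rw [hF2, hF, chartCut_mul_integrandA_w0]
    exact a2
  have e2 : integralGH F2 = 2⁻¹ *
      ∫ c, spow (ξ + ε) ((-l - ν - 1) / 2) c * fibreInt (w0Translate f) θ c := by
    rw [inv2.integralGH_eq_w0 m2 θ]
    simp_rw [hF2, hF, chartCut_mul_integrandA_w0]
    rw [b2]
  have hsum : coordDensity F = fun p => coordDensity F1 p + coordDensity F2 p := by
    ext p
    simp only [coordDensity, hF1, hF2]
    push_cast
    ring
  constructor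
  · rw [IntegrableGH, hsum]
    exact Integrable.add i1 i2
  · rw [← e1, ← e2, integralGH, hsum]
    exact integral_add i1 i2

/-- The normalized operator, restricted to `K`. -/
def normOpK (ε ξ : ZMod 2) (l : ℂ) (f : G → ℂ) (θ : ℝ) (ν : ℂ) : ℂ :=
  2⁻¹ * ((-1) ^ ξ.val * ((Complex.Gamma ((1 - l - ν + 2 * ((ξ + ε).val : ℂ)) / 4))⁻¹ *
      riesz ξ ((l - ν - 1) / 2) (fibreInt f θ))) +
    2⁻¹ * ((Complex.Gamma ((1 + l - ν + 2 * (ξ.val : ℂ)) / 4))⁻¹ *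
      riesz (ξ + ε) ((-l - ν - 1) / 2) (fibreInt (w0Translate f) θ))

lemma differentiable_normOpK (hf : f ∈ IndHc ε l) (θ : ℝ) :
    Differentiable ℂ (normOpK ε ξ l f θ) := by
  obtain ⟨R, -, h1⟩ := exists_fam_fibreInt hf.1 hf.2.2
  obtain ⟨R', -, h2⟩ := exists_fam_fibreInt hf.1.w0Translate (CompactModH.w0Translate hf.2.2)
  have g1 : Differentiable ℂ fun ν => riesz ξ ((l - ν - 1) / 2) (fibreInt f θ) :=
    (h1.differentiable_riesz θ ξ).comp (f := fun ν : ℂ => (l - ν - 1) / 2) (by fun_prop)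
  have g2 : Differentiable ℂ fun ν =>
      riesz (ξ + ε) ((-l - ν - 1) / 2) (fibreInt (w0Translate f) θ) :=
    (h2.differentiable_riesz θ (ξ + ε)).comp (f := fun ν : ℂ => (-l - ν - 1) / 2) (by fun_prop)
  have k1 : Differentiable ℂ fun ν : ℂ =>
      (Complex.Gamma ((1 - l - ν + 2 * ((ξ + ε).val : ℂ)) / 4))⁻¹ :=
    differentiable_inv_Gamma_comp (by fun_prop)
  have k2 : Differentiable ℂ fun ν : ℂ =>
      (Complex.Gamma ((1 + l - ν + 2 * (ξ.val : ℂ)) / 4))⁻¹ :=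
    differentiable_inv_Gamma_comp (by fun_prop)
  exact ((((k1.mul g1).const_mul _).const_mul _)).add ((k2.mul g2).const_mul _)

lemma contDiff_normOpK (hf : f ∈ IndHc ε l) (ν : ℂ) :
    ContDiff ℝ ∞ fun θ => normOpK ε ξ l f θ ν := by
  obtain ⟨R, -, h1⟩ := exists_fam_fibreInt hf.1 hf.2.2
  obtain ⟨R', -, h2⟩ := exists_fam_fibreInt hf.1.w0Translate (CompactModH.w0Translate hf.2.2)
  have g1 := h1.contDiff_riesz ξ ((l - ν - 1) / 2)
  have g2 := h2.contDiff_riesz (ξ + ε) ((-l - ν - 1) / 2)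
  exact (contDiff_const.mul (contDiff_const.mul (contDiff_const.mul g1))).add
    (contDiff_const.mul (contDiff_const.mul g2))

lemma Gamma_quarter_ne_zero {a : ℂ} {n : ℕ} (ha : 0 < a.re) :
    Complex.Gamma ((a + 2 * (n : ℂ)) / 4) ≠ 0 := by
  apply Complex.Gamma_ne_zero_of_re_pos
  have : (0 : ℝ) ≤ n := Nat.cast_nonneg n
  simp
  linarith

/-- In each summand `riesz` supplies one of the two Gamma factors of `gammaA`; the other is the
explicit inverse Gamma in `normOpK`. -/
lemma normOpK_eq (hl : l.re = 0) (hf : f ∈ IndHc ε l) (hν : ν.re < 1) (θ : ℝ) :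
    normOpK ε ξ l f θ ν = normIntegralA ε ξ l f (kG θ) ν := by
  have hβ : -1 < ((l - ν - 1) / 2).re := by
    simp [hl]
    linarith
  have hα : -1 < ((-l - ν - 1) / 2).re := by
    simp [hl]
    linarith
  obtain ⟨R, -, h1⟩ := exists_fam_fibreInt hf.1 hf.2.2
  obtain ⟨R', -, h2⟩ := exists_fam_fibreInt hf.1.w0Translate (CompactModH.w0Translate hf.2.2)
  rw [normOpK, normIntegralA, (integrandA_kG hl hf hν θ).2, h1.riesz_eq_integral_spow θ ξ hβ,
    h2.riesz_eq_integral_spow θ (ξ + ε) hα, gammaA, mul_inv]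
  have e1 : ((l - ν - 1) / 2 + 1 + (ξ.val : ℂ)) / 2 = (1 + l - ν + 2 * (ξ.val : ℂ)) / 4 := by ring
  have e2 : ((-l - ν - 1) / 2 + 1 + ((ξ + ε).val : ℂ)) / 2 =
      (1 - l - ν + 2 * ((ξ + ε).val : ℂ)) / 4 := by ring
  rw [e1, e2]
  ring

lemma kernelK_of_col {ε ξ : ZMod 2} {l μ : ℂ} {g h : G} {ρ : ℝ} (hρ : 0 < ρ)
    (h0 : g 0 0 = ρ * h 0 0) (h1 : g 1 0 = ρ * h 1 0) :
    kernelK ε ξ l μ g = (ρ : ℂ) ^ (μ - 1) * kernelK ε ξ l μ h := by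
  have e : kernelK ε ξ l μ (h * (diagG (Units.mk0 ρ hρ.ne') * nG 0)) = kernelK ε ξ l μ g := by
    rw [kernelK, kernelK]
    simp only [G.mul_apply, diagG_00, diagG_01, diagG_10, diagG_11, nG_00, nG_10, Units.val_mk0]
    rw [h0, h1]
    congr 2 <;> ring
  rw [← e, kernelK_mul_diag_n, Units.val_mk0, spow_of_pos _ _ hρ]

/-- The kernel is homogeneous in the first column, so every g reduces to the rotation k_θ of the
same direction. -/
lemma integrandA_polar {g : G} {θ ρ : ℝ} (hρ : 0 < ρ) (h0 : g 0 0 = ρ * Real.cos θ)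
    (h1 : g 1 0 = -(ρ * Real.sin θ)) (x : G) :
    integrandA ε ξ l ν f g x = (ρ : ℂ) ^ (-ν - 1) * integrandA ε ξ l ν f (kG θ) x := by
  rw [integrandA, integrandA, kernelK_of_col (h := x⁻¹ * kG θ) hρ, mul_assoc]
  · rw [G.mul_apply, G.mul_apply, h0, h1, kG_00, kG_10]
    ring
  · rw [G.mul_apply, G.mul_apply, h0, h1, kG_00, kG_10]
    ring

lemma coordDensity_const_mul (c : ℂ) (F : G → ℂ) :
    coordDensity (fun x => c * F x) = fun p => c * coordDensity F p := by
  ext p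
  simp only [coordDensity, mul_assoc]

lemma integralGH_const_mul (c : ℂ) (F : G → ℂ) :
    integralGH (fun x => c * F x) = c * integralGH F := by
  rw [integralGH, coordDensity_const_mul, integral_const_mul, integralGH]

lemma isOpen_re_lt : IsOpen {ν : ℂ | ν.re < 1} := isOpen_lt Complex.continuous_re continuous_const

lemma isEntireExt_normIntegralA (hl : l.re = 0) (hf : f ∈ IndHc ε l) {g : G} {θ ρ : ℝ}
    (hρ : 0 < ρ) (h0 : g 0 0 = ρ * Real.cos θ) (h1 : g 1 0 = -(ρ * Real.sin θ)) :
    IsEntireExt {ν | ν.re < 1} (normIntegralA ε ξ l f g)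
      fun ν => (ρ : ℂ) ^ (-ν - 1) * normOpK ε ξ l f θ ν := by
  refine ⟨(differentiable_cpow_pos hρ (by fun_prop)).mul (differentiable_normOpK hf θ),
    fun ν hν => ?_⟩
  simp only []
  rw [normOpK_eq hl hf hν, normIntegralA, normIntegralA,
    show integrandA ε ξ l ν f g = fun x => (ρ : ℂ) ^ (-ν - 1) * integrandA ε ξ l ν f (kG θ) x from
      funext fun x => integrandA_polar hρ h0 h1 x, integralGH_const_mul]
  ring

lemma opADefined (hl : l.re = 0) (hf : f ∈ IndHc ε l) : OpADefined ε ξ l f := by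
  intro g
  obtain ⟨θ, ρ, hρ, h0, h1⟩ := exists_polar g
  refine ⟨fun ν hν => ?_, _, isEntireExt_normIntegralA hl hf hρ h0 h1⟩
  rw [show integrandA ε ξ l ν f g = fun x => (ρ : ℂ) ^ (-ν - 1) * integrandA ε ξ l ν f (kG θ) x
    from funext fun x => integrandA_polar hρ h0 h1 x, IntegrableGH, coordDensity_const_mul]
  exact Integrable.const_mul (integrandA_kG hl hf hν θ).1 _

lemma normOpA_eq (hl : l.re = 0) (hf : f ∈ IndHc ε l) {g : G} {θ ρ : ℝ}
    (hρ : 0 < ρ) (h0 : g 0 0 = ρ * Real.cos θ) (h1 : g 1 0 = -(ρ * Real.sin θ)) :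
    normOpA ε ξ l ν f g = (ρ : ℂ) ^ (-ν - 1) * normOpK ε ξ l f θ ν := by
  rw [normOpA, entireExt_eq isOpen_re_lt ⟨0, by simp⟩
    (isEntireExt_normIntegralA hl hf hρ h0 h1)]

lemma normOpA_kG (hl : l.re = 0) (hf : f ∈ IndHc ε l) (θ : ℝ) :
    normOpA ε ξ l ν f (kG θ) = normOpK ε ξ l f θ ν := by
  rw [normOpA_eq hl hf one_pos (θ := θ) (by simp) (by simp)]
  simp

lemma differentiable_normOpA (hl : l.re = 0) (hf : f ∈ IndHc ε l) (g : G) :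
    Differentiable ℂ fun ν => normOpA ε ξ l ν f g := by
  obtain ⟨θ, ρ, hρ, h0, h1⟩ := exists_polar g
  simp_rw [normOpA_eq hl hf hρ h0 h1]
  exact (isEntireExt_normIntegralA hl hf hρ h0 h1).1

lemma normOpA_eq_integral (hl : l.re = 0) (hf : f ∈ IndHc ε l) (hν : ν.re < 1) (g : G) :
    normOpA ε ξ l ν f g = normIntegralA ε ξ l f g ν := by
  obtain ⟨θ, ρ, hρ, h0, h1⟩ := exists_polar g
  rw [normOpA_eq hl hf hρ h0 h1]
  exact (isEntireExt_normIntegralA hl hf hρ h0 h1).2 hν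

/-- For Re ν < 1 the law holds under the integral sign, and it persists because both sides are
entire in ν. -/
lemma normOpA_mul_diag_n (hl : l.re = 0) (hf : f ∈ IndHc ε l) (g : G) (t : ℝˣ) (x : ℝ) :
    normOpA ε ξ l ν f (g * (diagG t * nG x)) = spow ε (-ν - 1) t * normOpA ε ξ l ν f g := by
  have ht : (t : ℝ) ≠ 0 := t.ne_zero
  have hd : Differentiable ℂ fun ν => spow ε (-ν - 1) t * normOpA ε ξ l ν f g := by
    refine Differentiable.mul ?_ (differentiable_normOpA hl hf g)
    simp_rw [fun s => spow_eq_of_ne_zero ε s ht]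
    fun_prop
  have h : IsEntireExt {ν | ν.re < 1} (normIntegralA ε ξ l f (g * (diagG t * nG x)))
      fun ν => spow ε (-ν - 1) t * normOpA ε ξ l ν f g := by
    refine ⟨hd, fun ν hν => ?_⟩
    simp only []
    rw [normOpA_eq_integral hl hf hν, normIntegralA, normIntegralA,
      show integrandA ε ξ l ν f (g * (diagG t * nG x)) = fun y =>
        spow ε (-ν - 1) t * integrandA ε ξ l ν f g y from
        funext fun y => integrandA_mul_diag_n ε ξ l ν f g t x y, integralGH_const_mul]
    ring
  conv_lhs => rw [normOpA, entireExt_eq isOpen_re_lt ⟨0, by simp⟩ h]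

lemma normOpK_add_pi (hl : l.re = 0) (hf : f ∈ IndHc ε l) (θ : ℝ) :
    normOpK ε ξ l f (θ + Real.pi) ν = (-1) ^ ε.val * normOpK ε ξ l f θ ν := by
  have h1 := normOpA_mul_diag_n (ξ := ξ) (ν := ν) hl hf (kG θ) (-1) 0
  have h2 : diagG (-1) * nG 0 = diagG (-1) := by
    apply G.ext_entries <;> simp [G.mul_apply]
  rw [h2, ← kG_add_pi, normOpA_kG hl hf, normOpA_kG hl hf] at h1
  rw [h1]
  congr 1
  have := spow_neg ε (-ν - 1) 1
  simpa [spow_one_right] using this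

/-! ### Smoothness of Ãf on G -/

/-- The first column of a matrix as a complex number. -/
def colC (M : Fin 2 → Fin 2 → ℝ) : ℂ := (M 0 0 : ℂ) - (M 1 0 : ℂ) * Complex.I

lemma contDiff_colC : ContDiff ℝ ∞ colC := by
  unfold colC
  have h : ∀ i j, ContDiff ℝ ∞ fun M : Fin 2 → Fin 2 → ℝ => ((M i j : ℝ) : ℂ) := fun i j =>
    Complex.ofRealCLM.contDiff.comp (by fun_prop)
  exact (h 0 0).sub ((h 1 0).mul contDiff_const)

lemma colC_re (M : Fin 2 → Fin 2 → ℝ) : (colC M).re = M 0 0 := by simp [colC]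

lemma colC_im (M : Fin 2 → Fin 2 → ℝ) : (colC M).im = -M 1 0 := by simp [colC]

lemma contDiffAt_arg {z : ℂ} (hz : z ∈ Complex.slitPlane) : ContDiffAt ℝ ∞ Complex.arg z := by
  have h1 : ContDiffAt ℝ ∞ Complex.log z := (Complex.contDiffAt_log hz).restrict_scalars ℝ
  have h2 : ContDiffAt ℝ ∞ (fun w => (Complex.log w).im) z :=
    Complex.imCLM.contDiff.contDiffAt.comp z h1
  simpa [Complex.log_im] using h2

/-- A smooth `2π`-periodic function on `K` of the right parity extends to a smooth homogeneous
function. -/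
lemma contDiffAt_homogeneous {Ψ : ℝ → ℂ} (hΨ : ContDiff ℝ ∞ Ψ) {a c : ℂ}
    (hpar : ∀ z : ℂ, z ≠ 0 → Ψ z.arg = c * Ψ (-z).arg) {z : ℂ} (hz : z ≠ 0) :
    ContDiffAt ℝ ∞ (fun z : ℂ => ((‖z‖ : ℝ) : ℂ) ^ a * Ψ z.arg) z := by
  have key : ∀ w : ℂ, w ∈ Complex.slitPlane →
      ContDiffAt ℝ ∞ (fun z : ℂ => ((‖z‖ : ℝ) : ℂ) ^ a * Ψ z.arg) w := by
    intro w hw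
    have hw0 : w ≠ 0 := Complex.slitPlane_ne_zero hw
    have h1 : ContDiffAt ℝ ∞ (fun z : ℂ => Complex.exp (a * ((Real.log ‖z‖ : ℝ) : ℂ))) w := by
      have : ContDiffAt ℝ ∞ (fun z : ℂ => Real.log ‖z‖) w :=
        (contDiffAt_norm ℝ hw0).log (norm_ne_zero_iff.2 hw0)
      exact (contDiffAt_const.mul (Complex.ofRealCLM.contDiff.contDiffAt.comp w this)).cexp
    have h2 : (fun z : ℂ => ((‖z‖ : ℝ) : ℂ) ^ a) =ᶠ[nhds w]
        fun z : ℂ => Complex.exp (a * ((Real.log ‖z‖ : ℝ) : ℂ)) := by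
      filter_upwards [isOpen_ne.mem_nhds hw0] with v hv
      rw [cpow_eq_exp_log (norm_pos_iff.2 hv)]
    exact (h1.congr_of_eventuallyEq h2).mul (hΨ.contDiffAt.comp w (contDiffAt_arg hw))
  -- The argument jumps on the negative real axis. There -z lies in the slit plane, and the parity
  -- relation transports smoothness from -z to z.
  by_cases hs : z ∈ Complex.slitPlane
  · exact key z hs
  · have hs' : -z ∈ Complex.slitPlane := by
      rw [Complex.mem_slitPlane_iff] at hs ⊢
      push Not at hs
      left
      rcases hs.1.lt_or_eq with h | h
      · simpa using h
      · exact absurd (Complex.ext h hs.2) hz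
    have h3 : ContDiffAt ℝ ∞ (fun z : ℂ => c * (((‖-z‖ : ℝ) : ℂ) ^ a * Ψ (-z).arg)) z := by
      refine contDiffAt_const.mul ?_
      exact ContDiffAt.comp (g := fun z : ℂ => ((‖z‖ : ℝ) : ℂ) ^ a * Ψ z.arg) z (key (-z) hs')
        contDiff_neg.contDiffAt
    refine h3.congr_of_eventuallyEq ?_
    filter_upwards [isOpen_ne.mem_nhds hz] with v hv
    rw [norm_neg, hpar v hv]
    ring

lemma kG_arg_neg {z : ℂ} (hz : z ≠ 0) : kG (-z).arg = kG (z.arg + Real.pi) := by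
  have h1 : Real.cos (-z).arg = - Real.cos z.arg := by
    rw [Complex.cos_arg hz, Complex.cos_arg (neg_ne_zero.2 hz)]
    simp [neg_div]
  have h2 : Real.sin (-z).arg = - Real.sin z.arg := by
    rw [Complex.sin_arg, Complex.sin_arg]
    simp [neg_div]
  apply G.ext_entries <;> simp [h1, h2]

/-- The function depends only on z = g₀₀ - i g₁₀. It extends as |z|^{-μ-1} times a smooth function
of arg z to the open set of matrices with nonzero first column. -/
lemma normOpA_mem_IndP (hl : l.re = 0) (hf : f ∈ IndHc ε l) (μ : ℂ) :
    normOpA ε ξ l μ f ∈ IndP ε μ := by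
  refine ⟨?_, fun g t x => normOpA_mul_diag_n hl hf g t x⟩
  refine ⟨{M | colC M ≠ 0}, (fun z : ℂ => ((‖z‖ : ℝ) : ℂ) ^ (-μ - 1) *
    normOpK ε ξ l f z.arg μ) ∘ colC, isOpen_ne_fun contDiff_colC.continuous continuous_const,
    fun M hM => ?_, fun g => ?_⟩
  · refine ContDiffAt.contDiffWithinAt (ContDiffAt.comp M
      (contDiffAt_homogeneous (c := (-1) ^ ε.val) (contDiff_normOpK hf μ) ?_ hM)
      contDiff_colC.contDiffAt)
    intro z hz
    rw [← normOpA_kG hl hf (-z).arg, kG_arg_neg hz, normOpA_kG hl hf, normOpK_add_pi hl hf,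
      ← mul_assoc, neg_one_pow_mul_self, one_mul]
  · have hz : colC (fun i j => g i j) ≠ 0 := by
      intro h
      have h0 := congrArg Complex.re h
      have h1 := congrArg Complex.im h
      rw [colC_re] at h0
      rw [colC_im] at h1
      have := G.det_eq g
      simp at h0 h1
      rw [h0, h1] at this
      simp at this
    refine ⟨hz, ?_⟩
    rw [Function.comp_apply, normOpA_eq hl hf (norm_pos_iff.2 hz)]
    · rw [Complex.norm_mul_cos_arg, colC_re]
    · rw [Complex.norm_mul_sin_arg, colC_im, neg_neg]

end Formula

/-! ### The Beta integral over the line -/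

lemma integral_beta_Ioo {s t : ℂ} (hs : 0 < s.re) (ht : 0 < t.re) :
    IntegrableOn (fun y : ℝ => (y : ℂ) ^ (s - 1) * ((1 - y : ℝ) : ℂ) ^ (t - 1)) (Ioo 0 1) ∧
      ∫ y in Ioo (0 : ℝ) 1, (y : ℂ) ^ (s - 1) * ((1 - y : ℝ) : ℂ) ^ (t - 1) =
        Complex.betaIntegral s t := by
  have h := Complex.betaIntegral_convergent hs ht
  rw [intervalIntegrable_iff_integrableOn_Ioo_of_le zero_le_one] at h
  constructor
  · simpa using h
  · rw [Complex.betaIntegral, intervalIntegral.integral_of_le zero_le_one,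
      integral_Ioc_eq_integral_Ioo]
    simp

lemma inv_image_Ioo_zero_one : (fun t : ℝ => t⁻¹) '' Ioo 0 1 = Ioi 1 := by
  rw [image_inv_eq_inv, inv_Ioo_0_left one_pos, inv_one]

/-- The inversion y = 1/x carries this to the Beta integral over (0, 1). -/
lemma integral_beta_Ioi {s t : ℂ} (hs : 0 < s.re) (ht : 0 < t.re) :
    IntegrableOn (fun y : ℝ => (y : ℂ) ^ (-s - t) * ((y - 1 : ℝ) : ℂ) ^ (t - 1)) (Ioi 1) ∧
      ∫ y in Ioi (1 : ℝ), (y : ℂ) ^ (-s - t) * ((y - 1 : ℝ) : ℂ) ^ (t - 1) =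
        Complex.betaIntegral s t := by
  obtain ⟨h1, h2⟩ := integral_beta_Ioo hs ht
  have hd : ∀ x ∈ Ioo (0 : ℝ) 1, HasDerivWithinAt (fun t : ℝ => t⁻¹) (-(x ^ 2)⁻¹) (Ioo 0 1) x :=
    fun x hx => (hasDerivAt_inv hx.1.ne').hasDerivWithinAt
  have hinj : InjOn (fun t : ℝ => t⁻¹) (Ioo (0 : ℝ) 1) := inv_injective.injOn
  have key : ∀ x ∈ Ioo (0 : ℝ) 1,
      |(-(x ^ 2)⁻¹)| • ((fun y : ℝ => (y : ℂ) ^ (-s - t) * ((y - 1 : ℝ) : ℂ) ^ (t - 1)) x⁻¹) =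
        (x : ℂ) ^ (s - 1) * ((1 - x : ℝ) : ℂ) ^ (t - 1) := by
    intro x hx
    have hx0 := hx.1
    have hx1 : 0 < 1 - x := by linarith [hx.2]
    have e1 : x⁻¹ - 1 = x⁻¹ * (1 - x) := by field_simp
    have e2 : |(-(x ^ 2)⁻¹)| = Real.exp (-2 * Real.log x) := by
      rw [abs_neg, abs_of_pos (by positivity), neg_mul, Real.exp_neg, two_mul, Real.exp_add,
        Real.exp_log hx0, sq]
    simp only []
    rw [e2, e1, cpow_eq_exp_log (by positivity), cpow_eq_exp_log (by positivity),
      cpow_eq_exp_log hx0, cpow_eq_exp_log hx1, Real.log_mul (by positivity) (by positivity),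
      Real.log_inv, Complex.real_smul, Complex.ofReal_exp, ← Complex.exp_add, ← Complex.exp_add,
      ← Complex.exp_add]
    congr 1
    push_cast
    ring
  rw [← inv_image_Ioo_zero_one]
  constructor
  · rw [integrableOn_image_iff_integrableOn_abs_deriv_smul measurableSet_Ioo hd hinj]
    exact h1.congr_fun (fun x hx => (key x hx).symm) measurableSet_Ioo
  · rw [integral_image_eq_integral_abs_deriv_smul measurableSet_Ioo hd hinj,
      setIntegral_congr_fun measurableSet_Ioo key, h2]

lemma spow_of_neg (ε : ZMod 2) (s : ℂ) {x : ℝ} (hx : x < 0) :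
    spow ε s x = (-1) ^ ε.val * ((-x : ℝ) : ℂ) ^ s := by
  rw [← spow_of_pos ε s (neg_pos.2 hx), ← spow_neg, neg_neg]

/-- The Beta integral over the whole line. -/
lemma integral_spow_mul_spow (δ ξ : ZMod 2) {s₁ s₂ s₃ : ℂ} (h₁ : 0 < s₁.re) (h₂ : 0 < s₂.re)
    (h₃ : 0 < s₃.re) (hs : s₁ + s₂ + s₃ = 1) :
    Integrable (fun y : ℝ => spow δ (s₁ - 1) y * spow ξ (s₂ - 1) (y - 1)) ∧
      ∫ y : ℝ, spow δ (s₁ - 1) y * spow ξ (s₂ - 1) (y - 1) =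
        (-1) ^ ξ.val * Complex.betaIntegral s₁ s₂ + Complex.betaIntegral s₃ s₂ +
          (-1) ^ δ.val * (-1) ^ ξ.val * Complex.betaIntegral s₃ s₁ := by
  set k : ℝ → ℂ := fun y => spow δ (s₁ - 1) y * spow ξ (s₂ - 1) (y - 1) with hk
  obtain ⟨a1, b1⟩ := integral_beta_Ioo h₁ h₂
  obtain ⟨a2, b2⟩ := integral_beta_Ioi h₃ h₂
  obtain ⟨a3, b3⟩ := integral_beta_Ioi h₃ h₁
  have e1 : EqOn (fun y : ℝ => (-1) ^ ξ.val *
      ((y : ℂ) ^ (s₁ - 1) * ((1 - y : ℝ) : ℂ) ^ (s₂ - 1))) k (Ioo 0 1) := by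
    intro y hy
    simp only [hk]
    rw [spow_of_pos _ _ hy.1, spow_of_neg _ _ (by linarith [hy.2]), neg_sub]
    ring
  have e2 : EqOn (fun y : ℝ => (y : ℂ) ^ (-s₃ - s₂) * ((y - 1 : ℝ) : ℂ) ^ (s₂ - 1)) k (Ioi 1) := by
    intro y hy
    have hy' : (1 : ℝ) < y := hy
    simp only [hk]
    rw [spow_of_pos _ _ (by linarith), spow_of_pos _ _ (by linarith),
      show -s₃ - s₂ = s₁ - 1 by linear_combination -hs]
  -- The reflection y ↦ 1 - y maps (1, ∞) onto (-∞, 0) and exchanges the roles of s₁ and s₂.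
  have e3 : EqOn (fun y : ℝ => (-1) ^ δ.val * (-1) ^ ξ.val *
      ((y : ℂ) ^ (-s₃ - s₁) * ((y - 1 : ℝ) : ℂ) ^ (s₁ - 1))) (fun y => k (1 - y)) (Ioi 1) := by
    intro y hy
    have hy' : (1 : ℝ) < y := hy
    simp only [hk]
    rw [spow_of_neg _ _ (by linarith), spow_of_neg _ _ (by linarith),
      show -s₃ - s₁ = s₂ - 1 by linear_combination -hs, show -(1 - y) = y - 1 by ring,
      show -(1 - y - 1) = y by ring]
    ring
  have i1 : IntegrableOn k (Ioo 0 1) :=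
    IntegrableOn.congr_fun (Integrable.const_mul a1 _) e1 measurableSet_Ioo
  have i2 : IntegrableOn k (Ioi 1) := a2.congr_fun e2 measurableSet_Ioi
  have i3' : IntegrableOn (fun y => k (1 - y)) (Ioi 1) :=
    IntegrableOn.congr_fun (Integrable.const_mul a3 _) e3 measurableSet_Ioi
  have hmp : MeasurePreserving (fun y : ℝ => 1 - y) := Measure.measurePreserving_sub_left volume 1
  have hme : MeasurableEmbedding (fun y : ℝ => 1 - y) := (Homeomorph.subLeft (1 : ℝ)).measurableEmbedding
  have hpre : (fun y : ℝ => 1 - y) ⁻¹' Iio 0 = Ioi 1 := by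
    ext y
    simp
  have i3 : IntegrableOn k (Iio 0) := by
    rw [← hmp.integrableOn_comp_preimage hme, hpre]
    exact i3'
  have hU : (Iio (0 : ℝ) ∪ Ioo 0 1 ∪ Ioi 1 : Set ℝ) =ᵐ[volume] univ := by
    rw [Filter.eventuallyEq_set]
    filter_upwards [ae_ne_zero, (measure_eq_zero_iff_ae_notMem.1 (measure_singleton (1 : ℝ)))]
      with y h0 h1
    simp only [mem_union, mem_Iio, mem_Ioo, mem_Ioi, mem_univ, iff_true]
    have h1' : y ≠ 1 := h1
    grind
  have d1 : Disjoint (Iio (0 : ℝ)) (Ioo 0 1) := by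
    rw [Set.disjoint_left]
    intro y h h'
    exact absurd h (not_lt.2 h'.1.le)
  have d2 : Disjoint (Iio (0 : ℝ) ∪ Ioo 0 1) (Ioi 1) := by
    rw [Set.disjoint_left]
    rintro y (h | h) h'
    · have : y < 0 := h
      have : 1 < y := h'
      linarith
    · exact absurd h.2 (not_lt.2 (le_of_lt h'))
  constructor
  · rw [← integrableOn_univ]
    exact ((i3.union i1).union i2).congr_set_ae hU.symm
  · rw [← setIntegral_univ, ← setIntegral_congr_set hU,
      setIntegral_union d2 measurableSet_Ioi (i3.union i1) i2,
      setIntegral_union d1 measurableSet_Ioo i3 i1, ← setIntegral_congr_fun measurableSet_Ioo e1,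
      ← setIntegral_congr_fun measurableSet_Ioi e2, integral_const_mul, b1, b2,
      ← hmp.setIntegral_preimage_emb hme, hpre, ← setIntegral_congr_fun measurableSet_Ioi e3,
      integral_const_mul, b3]
    ring

/-- The local factor of the functional equation. -/
def gammaRatio (ε : ZMod 2) (s : ℂ) : ℂ :=
  Complex.Gamma ((s + ε.val) / 2) / Complex.Gamma ((1 - s + ε.val) / 2)

lemma sin_ne_zero_of_re {s : ℂ} (h0 : 0 < s.re) (h1 : s.re < 1) :
    Complex.sin (Real.pi * s) ≠ 0 := by
  intro h
  have h2 := Complex.Gamma_mul_Gamma_one_sub s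
  rw [h, div_zero] at h2
  refine (mul_ne_zero (Complex.Gamma_ne_zero_of_re_pos h0)
    (Complex.Gamma_ne_zero_of_re_pos ?_)) h2
  simpa using h1

lemma sqrt_pi_mul_self : ((√Real.pi : ℝ) : ℂ) * ((√Real.pi : ℝ) : ℂ) = Real.pi := by
  rw [← Complex.ofReal_mul, Real.mul_self_sqrt Real.pi_pos.le]

lemma ratio_of_reflection {X Y Z p r q : ℂ} (hY : Y ≠ 0) (hZ : Z ≠ 0) (hr : r * r = q)
    (h : X * Y = p * r) : X / Z * r = p * (q / (Y * Z)) := by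
  field_simp
  linear_combination r * h + p * hr

/-- Duplication expresses Γ(s/2)Γ((s+1)/2) through Γ(s), and reflection turns
1/(Γ((s+1)/2)Γ((1-s)/2)) into cos(πs/2)/π. In the odd case reflection at s/2 gives the sine instead.
-/
lemma gammaRatio_zero {s : ℂ} (h0 : 0 < s.re) (h1 : s.re < 1) :
    gammaRatio 0 s * (√Real.pi : ℝ) =
      Complex.Gamma s * 2 ^ (1 - s) * Complex.cos (Real.pi * s / 2) := by
  have hpi : (Real.pi : ℂ) ≠ 0 := by exact_mod_cast Real.pi_ne_zero
  have hd := Complex.Gamma_mul_Gamma_add_half (s / 2)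
  rw [mul_div_cancel₀ s two_ne_zero] at hd
  have hr := Complex.Gamma_mul_Gamma_one_sub (s / 2 + 1 / 2)
  have hsin := sin_ne_zero_of_re (s := s / 2 + 1 / 2) (by simp; linarith) (by simp; linarith)
  rw [show 1 - (s / 2 + 1 / 2) = (1 - s) / 2 by ring] at hr
  rw [show (Real.pi : ℂ) * (s / 2 + 1 / 2) = Real.pi * s / 2 + Real.pi / 2 by ring,
    Complex.sin_add_pi_div_two] at hr hsin
  have hG : Complex.Gamma ((1 - s) / 2) ≠ 0 :=
    Complex.Gamma_ne_zero_of_re_pos (by simp; linarith)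
  have hG' : Complex.Gamma (s / 2 + 1 / 2) ≠ 0 :=
    Complex.Gamma_ne_zero_of_re_pos (by simp; linarith)
  rw [gammaRatio, ZMod.val_zero, Nat.cast_zero, add_zero, add_zero]
  have hr' : Complex.cos (Real.pi * s / 2) =
      Real.pi / (Complex.Gamma (s / 2 + 1 / 2) * Complex.Gamma ((1 - s) / 2)) := by
    rw [hr]
    field_simp
  rw [hr']
  exact ratio_of_reflection hG' hG sqrt_pi_mul_self hd

lemma gammaRatio_one {s : ℂ} (h0 : 0 < s.re) (h1 : s.re < 1) :
    gammaRatio 1 s * (√Real.pi : ℝ) =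
      Complex.Gamma s * 2 ^ (1 - s) * Complex.sin (Real.pi * s / 2) := by
  have hpi : (Real.pi : ℂ) ≠ 0 := by exact_mod_cast Real.pi_ne_zero
  have hd := Complex.Gamma_mul_Gamma_add_half (s / 2)
  rw [mul_div_cancel₀ s two_ne_zero] at hd
  have hr := Complex.Gamma_mul_Gamma_one_sub (s / 2)
  have hsin := sin_ne_zero_of_re (s := s / 2) (by simp; linarith) (by simp; linarith)
  rw [show (Real.pi : ℂ) * (s / 2) = Real.pi * s / 2 by ring] at hr hsin
  have hG : Complex.Gamma (1 - s / 2) ≠ 0 :=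
    Complex.Gamma_ne_zero_of_re_pos (by simp; linarith)
  have hG' : Complex.Gamma (s / 2) ≠ 0 :=
    Complex.Gamma_ne_zero_of_re_pos (by simp; linarith)
  rw [gammaRatio, show (1 : ZMod 2).val = 1 from rfl, Nat.cast_one,
    show (s + 1) / 2 = s / 2 + 1 / 2 by ring, show (1 - s + 1) / 2 = 1 - s / 2 by ring]
  have hr' : Complex.sin (Real.pi * s / 2) =
      Real.pi / (Complex.Gamma (s / 2) * Complex.Gamma (1 - s / 2)) := by
    rw [hr]
    field_simp
  rw [hr']
  exact ratio_of_reflection hG' hG sqrt_pi_mul_self ((mul_comm _ _).trans hd)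

/-- The trigonometric function of the parity. -/
def trigP (ε : ZMod 2) (a : ℂ) : ℂ := if ε = 0 then Complex.cos a else Complex.sin a

lemma gammaRatio_eq (ε : ZMod 2) {s : ℂ} (h0 : 0 < s.re) (h1 : s.re < 1) :
    gammaRatio ε s * (√Real.pi : ℝ) =
      Complex.Gamma s * 2 ^ (1 - s) * trigP ε (Real.pi * s / 2) := by
  rcases zmod_two_cases ε with rfl | rfl
  · rw [gammaRatio_zero h0 h1, trigP, if_pos rfl]
  · rw [gammaRatio_one h0 h1, trigP, if_neg one_ne_zero]

/-- For ε = ξ = 0 this is sin 2a + sin 2b + sin 2c = 4 cos a cos b cos c; the other parities are its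
signed variants. The extra sign is -1 only for ε = ξ = 1. Eliminating c = π/2 - (a + b) leaves
polynomial identities modulo sin² + cos² = 1. -/
lemma trig_identity (ε ξ : ZMod 2) {a b c : ℂ} (h : a + b + c = Real.pi / 2) :
    (-1) ^ ξ.val * Complex.sin (2 * c) + Complex.sin (2 * a) +
        (-1) ^ (ξ + ε).val * (-1) ^ ξ.val * Complex.sin (2 * b) =
      (-1) ^ ((ε.val + ξ.val) / 2) * (4 * (trigP (ξ + ε) a * trigP ξ b * trigP ε c)) := by
  have hc : c = Real.pi / 2 - (a + b) := by linear_combination h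
  have c1 : Complex.cos c = Complex.sin (a + b) := by rw [hc, Complex.cos_pi_div_two_sub]
  have c2 : Complex.sin c = Complex.cos (a + b) := by rw [hc, Complex.sin_pi_div_two_sub]
  have sa := Complex.sin_sq_add_cos_sq a
  have sb := Complex.sin_sq_add_cos_sq b
  rw [Complex.sin_two_mul, Complex.sin_two_mul, Complex.sin_two_mul]
  have e1 : ((1 : ZMod 2) + 1) = 0 := rfl
  have e2 : (1 : ZMod 2).val = 1 := rfl
  rcases zmod_two_cases ε with rfl | rfl <;> rcases zmod_two_cases ξ with rfl | rfl
  · simp [trigP, c1, c2, Complex.sin_add, Complex.cos_add]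
    linear_combination -2 * Complex.sin a * Complex.cos a * sb -
      2 * Complex.sin b * Complex.cos b * sa
  · simp [trigP, c1, c2, Complex.sin_add, Complex.cos_add, e2]
    linear_combination -2 * Complex.sin a * Complex.cos a * sb -
      2 * Complex.sin b * Complex.cos b * sa
  · simp [trigP, c1, c2, Complex.sin_add, Complex.cos_add, e2]
    linear_combination -2 * Complex.sin a * Complex.cos a * sb +
      2 * Complex.sin b * Complex.cos b * sa
  · simp [trigP, c1, c2, Complex.sin_add, Complex.cos_add, e1, e2]
    linear_combination -2 * Complex.sin a * Complex.cos a * sb +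
      2 * Complex.sin b * Complex.cos b * sa

/-- Reflection replaces 1/Γ(s+t) = 1/Γ(1-u) by Γ(u) sin(πu)/π. The three Beta integrals then share
one symmetric product of Gamma values and differ only in a sine. -/
lemma betaIntegral_eq_sin {s t u : ℂ} (hs : 0 < s.re) (ht : 0 < t.re) (hu : 0 < u.re)
    (h : s + t + u = 1) :
    Complex.betaIntegral s t =
      Complex.Gamma s * Complex.Gamma t * Complex.Gamma u * Complex.sin (Real.pi * u) /
        Real.pi := by
  have h1 : u.re < 1 := by
    have := congrArg Complex.re h
    simp at this
    linarith
  have hsin := sin_ne_zero_of_re hu h1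
  have hpi : (Real.pi : ℂ) ≠ 0 := by exact_mod_cast Real.pi_ne_zero
  have hr := Complex.Gamma_mul_Gamma_one_sub u
  have hG : Complex.Gamma (1 - u) ≠ 0 := Complex.Gamma_ne_zero_of_re_pos (by simpa using h1)
  rw [Complex.betaIntegral_eq_Gamma_mul_div s t hs ht, show s + t = 1 - u by linear_combination h]
  rw [eq_div_iff hsin] at hr
  rw [div_eq_div_iff hG hpi]
  linear_combination -(Complex.Gamma s * Complex.Gamma t) * hr

/-- After the common Gamma product is factored out, `trig_identity` turns the signed sum of sines
into a product. The powers of 2 from duplication multiply to 2^{3-1} = 4, which matches the 4 in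
that identity. -/
lemma integral_spow_mul_spow_eq (ε ξ : ZMod 2) {s₁ s₂ s₃ : ℂ} (h₁ : 0 < s₁.re) (h₂ : 0 < s₂.re)
    (h₃ : 0 < s₃.re) (hs : s₁ + s₂ + s₃ = 1) :
    ∫ y : ℝ, spow (ξ + ε) (s₁ - 1) y * spow ξ (s₂ - 1) (y - 1) =
      (-1) ^ ((ε.val + ξ.val) / 2) * (√Real.pi : ℝ) *
        (gammaRatio (ξ + ε) s₁ * gammaRatio ξ s₂ * gammaRatio ε s₃) := by
  have hre := congrArg Complex.re hs
  simp only [Complex.add_re, Complex.one_re] at hre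
  have hpi : (Real.pi : ℂ) ≠ 0 := by exact_mod_cast Real.pi_ne_zero
  have g1 := gammaRatio_eq (ξ + ε) h₁ (by linarith)
  have g2 := gammaRatio_eq ξ h₂ (by linarith)
  have g3 := gammaRatio_eq ε h₃ (by linarith)
  have ht := trig_identity ε ξ (a := Real.pi * s₁ / 2) (b := Real.pi * s₂ / 2)
    (c := Real.pi * s₃ / 2) (by linear_combination (Real.pi / 2 : ℂ) * hs)
  simp only [mul_div_cancel₀ _ (two_ne_zero' ℂ)] at ht
  have hp : (2 : ℂ) ^ (1 - s₁) * 2 ^ (1 - s₂) * 2 ^ (1 - s₃) = 4 := by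
    rw [← Complex.cpow_add _ _ two_ne_zero, ← Complex.cpow_add _ _ two_ne_zero,
      show 1 - s₁ + (1 - s₂) + (1 - s₃) = 2 by linear_combination -hs]
    norm_num
  rw [(integral_spow_mul_spow (ξ + ε) ξ h₁ h₂ h₃ hs).2, betaIntegral_eq_sin h₁ h₂ h₃ hs,
    betaIntegral_eq_sin h₃ h₂ h₁ (by linear_combination hs),
    betaIntegral_eq_sin h₃ h₁ h₂ (by linear_combination hs)]
  set T := trigP (ξ + ε) (Real.pi * s₁ / 2) * trigP ξ (Real.pi * s₂ / 2) *
    trigP ε (Real.pi * s₃ / 2) with hT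
  set P := Complex.Gamma s₁ * Complex.Gamma s₂ * Complex.Gamma s₃ with hP
  have hg : gammaRatio (ξ + ε) s₁ * gammaRatio ξ s₂ * gammaRatio ε s₃ *
      (√Real.pi : ℝ) * Real.pi = P * 4 * T := by
    rw [← sqrt_pi_mul_self, ← hp]
    calc _ = gammaRatio (ξ + ε) s₁ * (√Real.pi : ℝ) * (gammaRatio ξ s₂ * (√Real.pi : ℝ)) *
          (gammaRatio ε s₃ * (√Real.pi : ℝ)) := by ring
      _ = _ := by
        rw [g1, g2, g3, hP, hT]
        ring
  rw [← mul_right_inj' hpi]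
  field_simp
  linear_combination P * ht - (-1) ^ ((ε.val + ξ.val) / 2) * hg

/-! ### The kernel identity and Fubini in the strip -/

/-- The first column of h w₀ n̄_x is (h₀₀x - h₀₁, h₁₀x - h₁₁). Since det h = 1, the second zero
minus the first is 1/(h₀₀h₁₀), so y = h₀₀h₁₀(x - h₀₁/h₀₀) sends them to 0 and 1. D collects the
scaling factors, and with the Jacobian |h₀₀h₁₀|⁻¹ it is exactly the target kernel. -/
lemma kernelK_w0_nbar (ε ξ : ZMod 2) (l μ : ℂ) {h : G} (h0 : h 0 0 ≠ 0) (h1 : h 1 0 ≠ 0) :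
    ∃ D : ℂ, (((|h 0 0 * h 1 0|)⁻¹ : ℝ) : ℂ) * D = kernelK ε (ξ + ε) (-l) μ h ∧
      ∀ x : ℝ, kernelK ε ξ (-l) (-μ) (h * w0 * nbarG x) =
        D * (spow (ξ + ε) ((1 - l - μ) / 2 - 1) (h 0 0 * h 1 0 * (x - h 0 1 / h 0 0)) *
          spow ξ ((1 + l - μ) / 2 - 1) (h 0 0 * h 1 0 * (x - h 0 1 / h 0 0) - 1)) := by
  refine ⟨spow (ξ + ε) ((1 - l - μ) / 2 - 1) (h 1 0)⁻¹ * spow ξ ((1 + l - μ) / 2 - 1) (h 0 0)⁻¹,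
    ?_, fun x => ?_⟩
  · have e1 : ∀ x : ℝ, x ≠ 0 → ((|x|⁻¹ : ℝ) : ℂ) = spow 0 (-1) x := by
      intro x hx
      rw [spow_zero_left, apow, Complex.cpow_neg_one]
      push_cast
      rfl
    have e2 : ξ + ε + ε = ξ := by
      rw [add_assoc, CharTwo.add_self_eq_zero, add_zero]
    have e3 : ∀ (δ : ZMod 2) (s : ℂ) {x : ℝ}, x ≠ 0 → (spow δ s x)⁻¹ = spow δ (-s) x := by
      intro δ s x hx
      have := spow_add_mul δ δ s (-s) hx
      rw [CharTwo.add_self_eq_zero, add_neg_cancel, spow_zero_left, apow, Complex.cpow_zero] at this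
      exact (eq_inv_of_mul_eq_one_right this).symm
    rw [abs_mul, mul_inv, Complex.ofReal_mul, e1 _ h0, e1 _ h1, spow_inv _ _ h0, spow_inv _ _ h1,
      e3 _ _ h0, e3 _ _ h1, kernelK, e2]
    calc _ = (spow 0 (-1) (h 0 0) * spow ξ (-((1 + l - μ) / 2 - 1)) (h 0 0)) *
          (spow 0 (-1) (h 1 0) * spow (ξ + ε) (-((1 - l - μ) / 2 - 1)) (h 1 0)) := by ring
      _ = _ := by
        rw [spow_add_mul _ _ _ _ h0, spow_add_mul _ _ _ _ h1, zero_add, zero_add]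
        congr 2 <;> ring
  · have hdet := G.det_eq h
    rw [kernelK]
    have e1 : (h * w0 * nbarG x) 0 0 = (h 1 0)⁻¹ * (h 0 0 * h 1 0 * (x - h 0 1 / h 0 0)) := by
      simp only [G.mul_apply, w0_00, w0_01, w0_10, w0_11, nbarG_00, nbarG_10]
      field_simp
      ring
    have e2 : (h * w0 * nbarG x) 1 0 =
        (h 0 0)⁻¹ * (h 0 0 * h 1 0 * (x - h 0 1 / h 0 0) - 1) := by
      simp only [G.mul_apply, w0_00, w0_01, w0_10, w0_11, nbarG_00, nbarG_10]
      field_simp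
      linear_combination -hdet
    rw [e1, e2]
    generalize h 0 0 * h 1 0 * (x - h 0 1 / h 0 0) = y
    rw [spow_mul, spow_mul, show (-l + -μ - 1) / 2 = (1 - l - μ) / 2 - 1 by ring,
      show (-μ - -l - 1) / 2 = (1 + l - μ) / 2 - 1 by ring]
    ring

/-- The integral of the norm is recorded in the same closed form because it provides the absolute
integrability that Fubini requires. -/
lemma integral_kernelK_w0_nbar (ε ξ : ZMod 2) (l μ : ℂ)
    (hk : Integrable fun y : ℝ => spow (ξ + ε) ((1 - l - μ) / 2 - 1) y *
      spow ξ ((1 + l - μ) / 2 - 1) (y - 1)) {h : G} (h0 : h 0 0 ≠ 0) (h1 : h 1 0 ≠ 0) :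
    (Integrable fun x => kernelK ε ξ (-l) (-μ) (h * w0 * nbarG x)) ∧
      ∫ x, kernelK ε ξ (-l) (-μ) (h * w0 * nbarG x) =
        (∫ y : ℝ, spow (ξ + ε) ((1 - l - μ) / 2 - 1) y * spow ξ ((1 + l - μ) / 2 - 1) (y - 1)) *
          kernelK ε (ξ + ε) (-l) μ h ∧
      ∫ x, ‖kernelK ε ξ (-l) (-μ) (h * w0 * nbarG x)‖ =
        (∫ y : ℝ, ‖spow (ξ + ε) ((1 - l - μ) / 2 - 1) y *
          spow ξ ((1 + l - μ) / 2 - 1) (y - 1)‖) * ‖kernelK ε (ξ + ε) (-l) μ h‖ := by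
  obtain ⟨D, hD, hx⟩ := kernelK_w0_nbar ε ξ l μ h0 h1
  set k : ℝ → ℂ := fun y => spow (ξ + ε) ((1 - l - μ) / 2 - 1) y *
      spow ξ ((1 + l - μ) / 2 - 1) (y - 1) with hkdef
  have hx' : ∀ x, kernelK ε ξ (-l) (-μ) (h * w0 * nbarG x) =
      D * k (h 0 0 * h 1 0 * (x - h 0 1 / h 0 0)) := hx
  have hac : h 0 0 * h 1 0 ≠ 0 := mul_ne_zero h0 h1
  simp_rw [hx', ← hD]
  refine ⟨((hk.comp_mul_left' hac).comp_sub_right (h 0 1 / h 0 0)).const_mul D, ?_, ?_⟩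
  · rw [integral_const_mul,
      integral_sub_right_eq_self (fun x => k (h 0 0 * h 1 0 * x)) (h 0 1 / h 0 0),
      Measure.integral_comp_mul_left k, Complex.real_smul, abs_inv]
    ring
  · simp_rw [norm_mul D]
    rw [integral_const_mul,
      integral_sub_right_eq_self (fun x => ‖k (h 0 0 * h 1 0 * x)‖) (h 0 1 / h 0 0),
      Measure.integral_comp_mul_left (fun x => ‖k x‖), smul_eq_mul, norm_mul, Complex.norm_real,
      abs_inv, Real.norm_of_nonneg (by positivity)]
    ring

lemma subsingleton_hyperbolic_zero {p q : ℝ} (h : p ≠ 0 ∨ q ≠ 0) :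
    {u : ℝ | Real.cosh u * p + Real.sinh u * q = 0}.Subsingleton := by
  intro u hu v hv
  rw [mem_ofPred_eq] at hu hv
  have hs : Real.sinh (u - v) = 0 := by
    have hp : p * Real.sinh (u - v) = 0 := by
      rw [Real.sinh_sub]
      linear_combination Real.sinh u * hv - Real.sinh v * hu
    have hq : q * Real.sinh (u - v) = 0 := by
      rw [Real.sinh_sub]
      linear_combination Real.cosh v * hu - Real.cosh u * hv
    rcases h with h | h
    · exact (mul_eq_zero.1 hp).resolve_left h
    · exact (mul_eq_zero.1 hq).resolve_left h
  linarith [Real.sinh_eq_zero.1 hs]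

lemma ae_hyperbolic_ne_zero {p q : ℝ → ℝ} (hp : Continuous p) (hq : Continuous q)
    (h : ∀ θ, p θ ≠ 0 ∨ q θ ≠ 0) :
    ∀ᵐ x : ℝ × ℝ, Real.cosh x.2 * p x.1 + Real.sinh x.2 * q x.1 ≠ 0 := by
  have hc : Continuous fun x : ℝ × ℝ => Real.cosh x.2 * p x.1 + Real.sinh x.2 * q x.1 := by
    fun_prop
  have hm : MeasurableSet {x : ℝ × ℝ | Real.cosh x.2 * p x.1 + Real.sinh x.2 * q x.1 = 0} :=
    (isClosed_eq hc continuous_const).measurableSet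
  have h0 : (volume : Measure (ℝ × ℝ))
      {x : ℝ × ℝ | Real.cosh x.2 * p x.1 + Real.sinh x.2 * q x.1 = 0} = 0 := by
    rw [Measure.volume_eq_prod, Measure.measure_prod_null hm]
    exact Filter.Eventually.of_forall fun θ => (subsingleton_hyperbolic_zero (h θ)).measure_zero _
  exact measure_eq_zero_iff_ae_notMem.1 h0

/-- For fixed θ each entry is p cosh u + q sinh u with (p, q) ≠ 0, because g has nonzero first
column. Such a function has at most one zero, so the exceptional set is null. -/
lemma ae_inv_mul_ne_zero (g : G) :
    ∀ᵐ p : ℝ × ℝ, ((kG p.1 * bG p.2)⁻¹ * g) 0 0 ≠ 0 ∧ ((kG p.1 * bG p.2)⁻¹ * g) 1 0 ≠ 0 := by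
  have hdet := G.det_eq g
  have key : ∀ p q θ : ℝ, p = Real.cos θ * g 0 0 - Real.sin θ * g 1 0 →
      q = -Real.sin θ * g 0 0 - Real.cos θ * g 1 0 → p = 0 → q = 0 → False := by
    intro p q θ hp hq hp0 hq0
    have h1 := Real.sin_sq_add_cos_sq θ
    rw [hp0] at hp
    rw [hq0] at hq
    have h2 : g 0 0 = 0 := by
      linear_combination (-g 0 0) * h1 - Real.cos θ * hp + Real.sin θ * hq
    have h3 : g 1 0 = 0 := by
      linear_combination (-g 1 0) * h1 + Real.sin θ * hp + Real.cos θ * hq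
    rw [h2, h3] at hdet
    simp at hdet
  have a0 := ae_hyperbolic_ne_zero (p := fun θ => Real.cos θ * g 0 0 - Real.sin θ * g 1 0)
    (q := fun θ => -Real.sin θ * g 0 0 - Real.cos θ * g 1 0) (by fun_prop) (by fun_prop)
    fun θ => by
      by_contra! hh
      exact key _ _ θ rfl rfl hh.1 hh.2
  have a1 := ae_hyperbolic_ne_zero (p := fun θ => Real.sin θ * g 0 0 + Real.cos θ * g 1 0)
    (q := fun θ => -(Real.cos θ * g 0 0 - Real.sin θ * g 1 0)) (by fun_prop) (by fun_prop)
    fun θ => by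
      by_contra! hh
      exact key _ _ θ rfl rfl (neg_eq_zero.1 hh.2) (by linarith [hh.1])
  filter_upwards [a0, a1] with p h0 h1
  constructor
  · convert h0 using 1
    simp only [G.mul_apply, G.inv_00, G.inv_01, kG_00, kG_01, kG_10, kG_11, bG_01, bG_11]
    ring
  · convert h1 using 1
    simp only [G.mul_apply, G.inv_10, G.inv_11, kG_00, kG_01, kG_10, kG_11, bG_00, bG_10]
    ring

/-- The constant of the regularized functional equation. -/
def functionalConst (ε ξ : ZMod 2) (μ : ℂ) : ℂ :=
  (-1) ^ ((ε.val + ξ.val) / 2) * ((Real.sqrt Real.pi : ℝ) : ℂ) /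
    Complex.Gamma ((1 - μ + (ε.val : ℂ)) / 2)

variable {ε ξ : ZMod 2} {l μ : ℂ} {f : G → ℂ}

lemma measurable_integrandA_uncurry (hf : SmoothG f) (g : G) :
    Measurable fun q : ℝ × (ℝ × ℝ) =>
      coordDensity (integrandA ε ξ l μ f (g * w0 * nbarG q.1)) q.2 := by
  have h1 : Measurable fun q : ℝ × (ℝ × ℝ) => f (kG q.2.1 * bG q.2.2) :=
    hf.continuous_onCoord.measurable.comp measurable_snd
  unfold coordDensity integrandA kernelK
  refine Measurable.mul (Measurable.mul (Measurable.mul ?_ ?_) h1) ?_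
  · refine (measurable_spow _ _).comp (Continuous.measurable ?_)
    simp only [G.mul_apply, G.inv_00, G.inv_01, kG_00, kG_01, kG_10, kG_11, bG_01, bG_11,
      nbarG_00, nbarG_10]
    fun_prop
  · refine (measurable_spow _ _).comp (Continuous.measurable ?_)
    simp only [G.mul_apply, G.inv_10, G.inv_11, kG_00, kG_01, kG_10, kG_11, bG_00, bG_10,
      nbarG_00, nbarG_10]
    fun_prop
  · refine Continuous.measurable ?_
    fun_prop

/-- The functional equation in the strip where both integrals converge. -/
lemma knappSteinIntegral_normOpA (hl : l.re = 0) (hf : f ∈ IndHc ε l) (h0 : 0 < μ.re)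
    (h1 : μ.re < 1) (g : G) :
    knappSteinIntegral ε μ (normOpA ε ξ l μ f) g μ =
      functionalConst ε ξ μ * normOpA ε (ξ + ε) l (-μ) f g := by
  have r1 : 0 < ((1 - l - μ) / 2).re := by
    simp [hl]
    linarith
  have r2 : 0 < ((1 + l - μ) / 2).re := by
    simp [hl]
    linarith
  have hsum : (1 - l - μ) / 2 + (1 + l - μ) / 2 + μ = 1 := by ring
  obtain ⟨hk, -⟩ := integral_spow_mul_spow (ξ + ε) ξ r1 r2 h0 hsum
  have hB := integral_spow_mul_spow_eq ε ξ r1 r2 h0 hsum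
  set B := ∫ y : ℝ, spow (ξ + ε) ((1 - l - μ) / 2 - 1) y * spow ξ ((1 + l - μ) / 2 - 1) (y - 1)
  set C := ∫ y : ℝ, ‖spow (ξ + ε) ((1 - l - μ) / 2 - 1) y *
    spow ξ ((1 + l - μ) / 2 - 1) (y - 1)‖
  set K : ℝ → ℝ × ℝ → ℂ := fun x p =>
    coordDensity (integrandA ε ξ l μ f (g * w0 * nbarG x)) p with hK
  have hKeq : ∀ x p, K x p = kernelK ε ξ (-l) (-μ)
      ((kG p.1 * bG p.2)⁻¹ * g * w0 * nbarG x) *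
        (f (kG p.1 * bG p.2) * ((Real.cosh (2 * p.2) : ℝ) : ℂ)) := by
    intro x p
    simp only [hK, coordDensity, integrandA, mul_assoc]
  have hLeq : ∀ p, coordDensity (integrandA ε (ξ + ε) l (-μ) f g) p =
      kernelK ε (ξ + ε) (-l) μ ((kG p.1 * bG p.2)⁻¹ * g) *
        (f (kG p.1 * bG p.2) * ((Real.cosh (2 * p.2) : ℝ) : ℂ)) := by
    intro p
    simp only [coordDensity, integrandA, mul_assoc, neg_neg]
  have hint := (opADefined (ξ := ξ + ε) hl hf g).1 (-μ) (by simp; linarith)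
  have hae : ∀ᵐ p ∂(volume.restrict coordDomain : Measure (ℝ × ℝ)),
      Integrable (fun x => K x p) ∧
      ∫ x, K x p = B * coordDensity (integrandA ε (ξ + ε) l (-μ) f g) p ∧
      ∫ x, ‖K x p‖ = C * ‖coordDensity (integrandA ε (ξ + ε) l (-μ) f g) p‖ := by
    filter_upwards [ae_restrict_of_ae (ae_inv_mul_ne_zero g)] with p hp
    obtain ⟨i1, i2, i3⟩ := integral_kernelK_w0_nbar ε ξ l μ hk hp.1 hp.2
    simp_rw [hKeq, hLeq]
    refine ⟨i1.mul_const _, ?_, ?_⟩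
    · rw [integral_mul_const, i2, mul_assoc]
    · simp_rw [norm_mul (kernelK _ _ _ _ _)]
      rw [integral_mul_const, i3, mul_assoc]
  have hprod : Integrable (Function.uncurry K)
      ((volume : Measure ℝ).prod (volume.restrict coordDomain)) := by
    have hm : AEStronglyMeasurable (Function.uncurry K)
        ((volume : Measure ℝ).prod (volume.restrict coordDomain)) :=
      (measurable_integrandA_uncurry hf.1 g).aestronglyMeasurable
    -- Integrating the norm over x first gives a constant times the norm of the integrand of A at
    -- -μ, which is integrable over G/H since Re(-μ) < 1.
    rw [integrable_prod_iff' hm]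
    refine ⟨hae.mono fun p hp => hp.1, ?_⟩
    refine (hint.norm.const_mul C).congr (hae.mono fun p hp => ?_)
    exact hp.2.2.symm
  -- At ν = μ the flat section is the function itself, and Re μ < 1 allows it to be written as the
  -- convergent integral.
  have hflat : ∀ g' : G, flatSection μ μ (normOpA ε ξ l μ f) g' =
      (gammaA ε ξ l μ)⁻¹ * integralGH (integrandA ε ξ l μ f g') := by
    intro g'
    rw [flatSection, sub_self, zero_div, Complex.cpow_zero, one_mul, normOpA_eq_integral hl hf h1,
      normIntegralA]
  have hswap : ∫ x, integralGH (integrandA ε ξ l μ f (g * w0 * nbarG x)) =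
      B * integralGH (integrandA ε (ξ + ε) l (-μ) f g) := by
    simp_rw [integralGH]
    rw [← integral_const_mul]
    exact (integral_integral_swap hprod).trans (integral_congr_ae (hae.mono fun p hp => hp.2.1))
  rw [knappSteinIntegral]
  simp_rw [hflat]
  rw [integral_const_mul, hswap, hB, normOpA_eq_integral hl hf (by simp; linarith), normIntegralA,
    functionalConst, gammaRatio, gammaRatio, gammaRatio, gammaA, gammaA]
  have e0 : ξ + ε + ε = ξ := by rw [add_assoc, CharTwo.add_self_eq_zero, add_zero]
  have e1 : ∀ δ : ZMod 2, ((1 - l - μ) / 2 + (δ.val : ℂ)) / 2 =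
    (1 - l - μ + 2 * (δ.val : ℂ)) / 4 := fun δ => by ring
  have e2 : ∀ δ : ZMod 2, ((1 + l - μ) / 2 + (δ.val : ℂ)) / 2 =
    (1 + l - μ + 2 * (δ.val : ℂ)) / 4 := fun δ => by ring
  have e3 : ∀ δ : ZMod 2, (1 - (1 - l - μ) / 2 + (δ.val : ℂ)) / 2 =
    (1 + l - -μ + 2 * (δ.val : ℂ)) / 4 := fun δ => by ring
  have e4 : ∀ δ : ZMod 2, (1 - (1 + l - μ) / 2 + (δ.val : ℂ)) / 2 =
    (1 - l - -μ + 2 * (δ.val : ℂ)) / 4 := fun δ => by ring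
  rw [e0, e1, e2, e3, e4]
  have n1 : Complex.Gamma ((1 - l - μ + 2 * ((ξ + ε).val : ℂ)) / 4) ≠ 0 :=
    Gamma_quarter_ne_zero (by simp [hl]; linarith)
  have n2 : Complex.Gamma ((1 + l - μ + 2 * (ξ.val : ℂ)) / 4) ≠ 0 :=
    Gamma_quarter_ne_zero (by simp [hl]; linarith)
  have n3 : Complex.Gamma ((μ + (ε.val : ℂ)) / 2) ≠ 0 := by
    apply Complex.Gamma_ne_zero_of_re_pos
    have : (0 : ℝ) ≤ ε.val := Nat.cast_nonneg _
    rw [Complex.div_ofNat_re, Complex.add_re, Complex.natCast_re]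
    positivity
  generalize Complex.Gamma ((1 - l - μ + 2 * ((ξ + ε).val : ℂ)) / 4) = A1 at *
  generalize Complex.Gamma ((1 + l - μ + 2 * (ξ.val : ℂ)) / 4) = A2 at *
  generalize Complex.Gamma ((μ + (ε.val : ℂ)) / 2) = A3 at *
  rw [mul_inv, mul_inv]
  field_simp

/-! ### Analytic continuation in μ -/

lemma eq_of_eq_re_pos {E E' : ℂ → ℂ} (hE : Differentiable ℂ E) (hE' : Differentiable ℂ E')
    (h : ∀ ν : ℂ, 0 < ν.re → E ν = E' ν) : E = E' :=
  IsEntireExt.unique isOpen_re_pos ⟨1, by simp⟩ (F := E') ⟨hE, h⟩ ⟨hE', fun _ _ => rfl⟩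

/-- Linearity is visible for Re ν > 0, where `circT` is an honest integral, and is continued from
there. -/
lemma circT_const_mul {Φ : ℝ → ℂ} (hΦ : ContDiff ℝ ∞ Φ) (ε : ZMod 2) (ν c : ℂ) :
    circT ε ν (fun τ => c * Φ τ) = c * circT ε ν Φ := by
  have hc : ContDiff ℝ ∞ fun τ => c * Φ τ := contDiff_const.mul hΦ
  refine congrFun (eq_of_eq_re_pos (differentiable_circT hc ε)
    ((differentiable_circT hΦ ε).const_mul c) fun ν hν => ?_) ν
  rw [(circT_eq hc ε hν).2, (circT_eq hΦ ε hν).2, mul_left_comm, ← integral_const_mul c]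
  refine congrArg _ (setIntegral_congr_fun measurableSet_Ioo fun τ _ => ?_)
  ring

lemma circT_add {Φ Ψ : ℝ → ℂ} (hΦ : ContDiff ℝ ∞ Φ) (hΨ : ContDiff ℝ ∞ Ψ) (ε : ZMod 2) (ν : ℂ) :
    circT ε ν (fun τ => Φ τ + Ψ τ) = circT ε ν Φ + circT ε ν Ψ := by
  refine congrFun (eq_of_eq_re_pos (differentiable_circT (hΦ.add hΨ) ε)
    ((differentiable_circT hΦ ε).add (differentiable_circT hΨ ε)) fun ν hν => ?_) ν
  simp only [Pi.add_apply]
  rw [(circT_eq (Φ := fun τ => Φ τ + Ψ τ) (hΦ.add hΨ) ε hν).2, (circT_eq hΦ ε hν).2,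
    (circT_eq hΨ ε hν).2, ← mul_add, ← integral_add (circT_eq hΦ ε hν).1 (circT_eq hΨ ε hν).1]
  congr 1
  refine setIntegral_congr_fun measurableSet_Ioo fun τ _ => ?_
  ring

lemma circT_zero (ε : ZMod 2) (ν : ℂ) : circT ε ν (fun _ => 0) = 0 := by
  simpa using circT_const_mul (Φ := fun _ => 0) contDiff_const ε ν 0

/-- Holomorphy of the pairing of `|c|^{s(z)}` with a compactly supported family holomorphic
in `z`. -/
lemma differentiableAt_integral_apow_mul {W : ℂ → ℝ → ℂ} {R : ℝ} {s : ℂ → ℂ} {z₀ : ℂ}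
    (hW : Continuous fun q : ℂ × ℝ => W q.1 q.2) (hd : ∀ c, Differentiable ℂ fun z => W z c)
    (hsupp : ∀ z c, R < |c| → W z c = 0) (hs : Differentiable ℂ s) (h0 : -1 < (s z₀).re) :
    DifferentiableAt ℂ (fun z => ∫ c, apow (s z) c * W z c) z₀ := by
  obtain ⟨B, hB⟩ := ((isCompact_closedBall z₀ 1).prod (isCompact_Icc (a := -R) (b := R))
    ).exists_bound_of_continuousOn hW.continuousOn
  refine differentiableAt_integral_of_bound (V := s ⁻¹' nearStrip (s z₀) ∩ Metric.closedBall z₀ 1)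
    (Filter.inter_mem (hs.continuous.continuousAt (nearStrip_mem_nhds h0))
      (Metric.closedBall_mem_nhds z₀ one_pos))
    (fun z _ => ?_) (integrable_indicator_stripBound h0 R B) ?_ ?_
  · exact (measurable_apow _).aestronglyMeasurable.mul
      (hW.comp (continuous_const.prodMk continuous_id)).aestronglyMeasurable
  · filter_upwards [ae_ne_zero] with c hc z hz
    by_cases hcR : c ∈ Icc (-R) R
    · rw [indicator_of_mem hcR, norm_mul]
      exact mul_le_mul (norm_apow_le_stripBound hz.1 hc) (hB (z, c) ⟨hz.2, hcR⟩) (norm_nonneg _)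
        (stripBound_nonneg _ c)
    · rw [indicator_of_notMem hcR, hsupp z c (by
        by_contra! hlt
        exact hcR (abs_le.1 hlt))]
      simp
  · filter_upwards [ae_ne_zero] with c hc
    exact (((differentiable_apow hc).comp hs).mul (hd c)).differentiableOn

section Exchange

variable {R : ℝ} {h : ℝ → ℝ → ℂ}

lemma Fam.contDiff_swap (H : Fam R h) : ContDiff ℝ ∞ fun q : ℝ × ℝ => h q.2 q.1 :=
  H.smooth.comp (contDiff_snd.prodMk contDiff_fst)

lemma Fam.contDiff_left (H : Fam R h) (c : ℝ) : ContDiff ℝ ∞ fun τ => h τ c :=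
  H.smooth.comp (contDiff_id.prodMk contDiff_const)

lemma Fam.circT_eq_zero (H : Fam R h) (ε : ZMod 2) (ν : ℂ) {c : ℝ} (hc : R < |c|) :
    circT ε ν (fun τ => h τ c) = 0 := by
  simp_rw [fun τ => H.supp τ c hc]
  exact circT_zero ε ν

lemma Fam.differentiableAt_integral_circT (H : Fam R h) (ε : ZMod 2) {s u : ℂ → ℂ} {z₀ : ℂ}
    (hs : Differentiable ℂ s) (hu : Differentiable ℂ u) (h0 : -1 < (s z₀).re) :
    DifferentiableAt ℂ (fun z => ∫ c, apow (s z) c * circT ε (u z) (fun τ => h τ c)) z₀ := by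
  refine differentiableAt_integral_apow_mul (R := R)
    (W := fun z c => circT ε (u z) fun τ => h τ c) ?_ (fun c => ?_)
    (fun z c hc => H.circT_eq_zero ε _ hc) hs h0
  · exact Continuous.comp (g := fun q : ℂ × ℝ => circT ε q.1 fun τ => h τ q.2)
      (f := fun q : ℂ × ℝ => (u q.1, q.2))
      (continuous_circT (Φ := fun c τ => h τ c) H.contDiff_swap ε)
      ((hu.continuous.comp continuous_fst).prodMk continuous_snd)
  · exact (differentiable_circT (H.contDiff_left c) ε).comp hu

lemma Fam.integrable_prod_circle (H : Fam R h) (ε : ZMod 2) {s ν : ℂ} (hs : -1 < s.re)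
    (hν : 0 < ν.re) :
    Integrable (Function.uncurry fun τ c : ℝ =>
      spow ε (ν - 1) (Real.sin τ) * (apow s c * h τ c))
      ((volume.restrict (Ioo (-(Real.pi / 2)) (Real.pi / 2))).prod volume) := by
  have i1 : Integrable (fun τ => spow ε (ν - 1) (Real.sin τ))
      (volume.restrict (Ioo (-(Real.pi / 2)) (Real.pi / 2))) := by
    have := (circT_eq (Φ := fun _ => 1) contDiff_const ε hν).1
    simp only [mul_one] at this
    exact this
  have i2 : Integrable ((Icc (-R) R).indicator (apow s)) := by
    rw [integrable_indicator_iff measurableSet_Icc]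
    exact (locallyIntegrable_apow hs).integrableOn_isCompact isCompact_Icc
  obtain ⟨B, hB⟩ := ((isCompact_Icc (a := -(Real.pi / 2)) (b := Real.pi / 2)).prod
    (isCompact_Icc (a := -R) (b := R))).exists_bound_of_continuousOn
    H.smooth.continuous.continuousOn
  have hsupp : ∀ τ c, c ∉ Icc (-R) R → h τ c = 0 := fun τ c hc => H.supp τ c (by
    by_contra! hlt
    exact hc (abs_le.1 hlt))
  have i3 := (i1.mul_prod i2).bdd_mul (c := max B 0) (f := fun q : ℝ × ℝ => h q.1 q.2)
    H.smooth.continuous.aestronglyMeasurable (by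
      filter_upwards [Measure.quasiMeasurePreserving_fst.ae (ae_restrict_mem measurableSet_Ioo)]
        with q hq
      by_cases hc : q.2 ∈ Icc (-R) R
      · exact (hB q ⟨Ioo_subset_Icc_self hq, hc⟩).trans (le_max_left _ _)
      · rw [hsupp _ _ hc]
        simp)
  refine i3.congr (Filter.Eventually.of_forall fun q => ?_)
  simp only [Function.uncurry]
  by_cases hc : q.2 ∈ Icc (-R) R
  · rw [indicator_of_mem hc]
    ring
  · rw [hsupp _ _ hc]
    ring

/-- The convolution on the circle commutes with the pairing with `|c|^s`. -/
lemma Fam.circT_integral (H : Fam R h) (ε : ZMod 2) {s : ℂ} (hs : -1 < s.re) (ν : ℂ) :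
    circT ε ν (fun τ => ∫ c, apow s c * h τ c) =
      ∫ c, apow s c * circT ε ν (fun τ => h τ c) := by
  have hsm : ContDiff ℝ ∞ fun τ => ∫ c, apow s c * h τ c :=
    contDiff_integral_mul H (locallyIntegrable_apow hs)
  -- Both sides are entire in ν, and for Re ν > 0 the equality is Fubini's theorem on the product of
  -- the circle and the line.
  refine congrFun (eq_of_eq_re_pos (E' := fun ν => ∫ c, apow s c * circT ε ν (fun τ => h τ c))
    (differentiable_circT hsm ε) (fun z => ?_) fun ν hν => ?_) ν
  · exact H.differentiableAt_integral_circT ε (s := fun _ => s) (u := fun z => z)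
      (differentiable_const s) differentiable_id hs
  · have hprod := H.integrable_prod_circle ε hs hν
    rw [(circT_eq hsm ε hν).2]
    simp_rw [fun c => (circT_eq (H.contDiff_left c) ε hν).2, mul_left_comm (apow s _),
      integral_const_mul, ← integral_const_mul (apow s _), ← integral_const_mul (spow ε _ _)]
    rw [integral_integral_swap hprod]
    congr 2
    ext c
    refine setIntegral_congr_fun measurableSet_Ioo fun τ _ => ?_
    ring

/-- Here μ enters both the convolution and the function. With N frozen near z₀ the distribution is
an entire factor times an absolutely convergent integral, and `Fam.circT_integral` moves the
convolution inside it. The integrand is then holomorphic in μ with a local integrable bound. -/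
lemma Fam.differentiable_circT_riesz (H : Fam R h) (ε e : ZMod 2) {s : ℂ → ℂ}
    (hs : Differentiable ℂ s) :
    Differentiable ℂ fun μ => circT ε μ fun τ => riesz e (s μ) (h τ) := by
  intro z₀
  obtain ⟨N, hN⟩ := exists_nat_re (s z₀)
  have HN := H.rieszFam e N
  have h1 : DifferentiableAt ℂ (fun μ => rieszConst e N (s μ) *
      ∫ c, apow (s μ + e.val + 2 * N) c *
        circT ε μ (fun τ => SLTwo.rieszFam e N (h τ) c)) z₀ := by
    refine ((differentiable_rieszConst e N).comp hs z₀).mul ?_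
    exact HN.differentiableAt_integral_circT ε (s := fun μ => s μ + e.val + 2 * N)
      (u := fun μ => μ) (by fun_prop) differentiable_id (re_shift_mem hN)
  refine h1.congr_of_eventuallyEq ?_
  filter_upwards [hs.continuous.continuousAt.eventually (eventually_re_shift hN)] with z hz
  rw [← HN.circT_integral ε (re_shift_mem hz), ← circT_const_mul
    (contDiff_integral_mul HN (locallyIntegrable_apow (re_shift_mem hz)))]
  congr 1
  ext τ
  exact H.riesz_eq_integral τ e N hz

end Exchange

section Final

variable {ε ξ : ZMod 2} {l : ℂ} {f : G → ℂ}

lemma differentiable_circT_normOpK (hf : f ∈ IndHc ε l) (θ : ℝ) :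
    Differentiable ℂ fun μ => circT ε μ fun τ => normOpK ε ξ l f (θ + τ) μ := by
  obtain ⟨R, -, h1⟩ := exists_fam_fibreInt hf.1 hf.2.2
  obtain ⟨R', -, h2⟩ := exists_fam_fibreInt hf.1.w0Translate (CompactModH.w0Translate hf.2.2)
  have H1 := h1.comp (g := fun τ : ℝ => θ + τ) (by fun_prop)
  have H2 := h2.comp (g := fun τ : ℝ => θ + τ) (by fun_prop)
  have e : ∀ μ, circT ε μ (fun τ => normOpK ε ξ l f (θ + τ) μ) =
      2⁻¹ * (-1) ^ ξ.val * (Complex.Gamma ((1 - l - μ + 2 * ((ξ + ε).val : ℂ)) / 4))⁻¹ *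
        circT ε μ (fun τ => riesz ξ ((l - μ - 1) / 2) (fibreInt f (θ + τ))) +
      2⁻¹ * (Complex.Gamma ((1 + l - μ + 2 * (ξ.val : ℂ)) / 4))⁻¹ *
        circT ε μ (fun τ => riesz (ξ + ε) ((-l - μ - 1) / 2)
          (fibreInt (w0Translate f) (θ + τ))) := by
    intro μ
    have s1 := H1.contDiff_riesz ξ ((l - μ - 1) / 2)
    have s2 := H2.contDiff_riesz (ξ + ε) ((-l - μ - 1) / 2)
    rw [← circT_const_mul s1, ← circT_const_mul s2,
      ← circT_add (contDiff_const.mul s1) (contDiff_const.mul s2)]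
    congr 1
    ext τ
    rw [normOpK]
    ring
  simp_rw [e]
  have k1 : Differentiable ℂ fun ν : ℂ =>
      (Complex.Gamma ((1 - l - ν + 2 * ((ξ + ε).val : ℂ)) / 4))⁻¹ :=
    differentiable_inv_Gamma_comp (by fun_prop)
  have k2 : Differentiable ℂ fun ν : ℂ =>
      (Complex.Gamma ((1 + l - ν + 2 * (ξ.val : ℂ)) / 4))⁻¹ :=
    differentiable_inv_Gamma_comp (by fun_prop)
  have g1 := H1.differentiable_circT_riesz ε ξ (s := fun μ : ℂ => (l - μ - 1) / 2) (by fun_prop)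
  have g2 := H2.differentiable_circT_riesz ε (ξ + ε) (s := fun μ : ℂ => (-l - μ - 1) / 2)
    (by fun_prop)
  exact ((k1.const_mul _).mul g1).add ((k2.const_mul _).mul g2)

lemma differentiable_functionalConst : Differentiable ℂ (functionalConst ε ξ) := by
  unfold functionalConst
  simp_rw [div_eq_mul_inv]
  exact (differentiable_inv_Gamma_comp (by fun_prop)).const_mul _

/-- The regularized functional equation. -/
lemma knappStein_normOpA (hl : l.re = 0) (hf : f ∈ IndHc ε l) (μ : ℂ) :
    knappStein ε μ (normOpA ε ξ l μ f) =
      functionalConst ε ξ μ • normOpA ε (ξ + ε) l (-μ) f := by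
  ext g
  obtain ⟨θ, t, ht, h0, h1⟩ := exists_polar g
  have e : ∀ ν, knappStein ε ν (normOpA ε ξ l ν f) g =
      (t : ℂ) ^ (ν - 1) * circT ε ν (fun τ => normOpK ε ξ l f (θ + τ) ν) := by
    intro ν
    rw [IndP.knappStein_eq (normOpA_mem_IndP hl hf ν) ht h0 h1]
    simp_rw [normOpA_kG hl hf]
  have d1 : Differentiable ℂ fun ν => knappStein ε ν (normOpA ε ξ l ν f) g := by
    simp_rw [e]
    exact (differentiable_cpow_pos ht (by fun_prop)).mul (differentiable_circT_normOpK hf θ)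
  have d2 : Differentiable ℂ fun ν =>
      functionalConst ε ξ ν * normOpA ε (ξ + ε) l (-ν) f g :=
    differentiable_functionalConst.mul ((differentiable_normOpA hl hf g).comp differentiable_neg)
  -- Both sides are entire, so agreement on the nonempty open strip 0 < Re ν < 1, which contains
  -- 1/2, suffices.
  have hU : IsOpen ({ν : ℂ | 0 < ν.re} ∩ {ν : ℂ | ν.re < 1}) := isOpen_re_pos.inter isOpen_re_lt
  refine congrFun (IsEntireExt.unique hU ⟨(1 / 2 : ℂ), by norm_num, by norm_num⟩
    (E := fun ν => knappStein ε ν (normOpA ε ξ l ν f) g) ⟨d1, fun ν hν => ?_⟩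
    ⟨d2, fun _ _ => rfl⟩) μ
  have hφ := normOpA_mem_IndP (ξ := ξ) hl hf ν
  simp only []
  rw [← knappSteinIntegral_normOpA hl hf hν.1 hν.2,
    (IndP.knappSteinIntegral_eq hφ ht h0 h1 hν.1).2, IndP.knappStein_eq hφ ht h0 h1]

lemma gammaA_ne_zero {μ : ℂ} (h : RegularA ε ξ l μ) : gammaA ε ξ l μ ≠ 0 :=
  mul_ne_zero (Complex.Gamma_ne_zero fun n => (h n).1) (Complex.Gamma_ne_zero fun n => (h n).2)

/-- Because ξ + ε + ε = ξ, the Gamma factors of `gammaA` at (ξ+ε, -μ) are the first two in the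
denominator of `dConst`. Regularity at -μ makes them nonzero, so they cancel. -/
lemma dConst_mul_gammaA {μ : ℂ} (h : RegularA ε (ξ + ε) l (-μ)) :
    dConst ε ξ l μ * gammaA ε (ξ + ε) l (-μ) = gammaA ε ξ l μ * functionalConst ε ξ μ := by
  have hne := gammaA_ne_zero h
  rw [gammaA] at hne
  have e0 : ξ + ε + ε = ξ := by rw [add_assoc, CharTwo.add_self_eq_zero, add_zero]
  rw [dConst, gammaA, gammaA, functionalConst]
  rw [e0, sub_neg_eq_add, sub_neg_eq_add] at hne ⊢
  have n1 := left_ne_zero_of_mul hne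
  have n2 := right_ne_zero_of_mul hne
  generalize Complex.Gamma ((1 - l + μ + 2 * (ξ.val : ℂ)) / 4) = A1 at *
  generalize Complex.Gamma ((1 + l + μ + 2 * ((ξ + ε).val : ℂ)) / 4) = A2 at *
  field_simp

lemma knappStein_opA (hl : l.re = 0) (hf : f ∈ IndHc ε l) {μ : ℂ}
    (h : RegularA ε (ξ + ε) l (-μ)) :
    knappStein ε μ (opA ε ξ l μ f) = dConst ε ξ l μ • opA ε (ξ + ε) l (-μ) f := by
  have h1 : opA ε ξ l μ f = fun g => gammaA ε ξ l μ * normOpA ε ξ l μ f g := rfl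
  rw [h1, IndP.knappStein_smul (normOpA_mem_IndP hl hf μ), knappStein_normOpA hl hf, smul_smul,
    ← dConst_mul_gammaA h, mul_smul]
  rfl

end Final

end SLTwo

end

theorem mainTheorem7 (ε ξ : ZMod 2) (l : ℂ) (hl : l.re = 0) (f : G → ℂ) (hf : f ∈ IndHc ε l) :
    -- the operators are well defined
    OpADefined ε ξ l f ∧
    (∀ μ : ℂ, normOpA ε ξ l μ f ∈ IndP ε μ ∧ KnappSteinDefined ε μ (normOpA ε ξ l μ f)) ∧
    -- the identity, at every `μ` where both sides are regular
    (∀ μ : ℂ, RegularA ε ξ l μ → RegularA ε (ξ + ε) l (-μ) →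
      knappStein ε μ (opA ε ξ l μ f) = dConst ε ξ l μ • opA ε (ξ + ε) l (-μ) f) ∧
    -- its regularized form, at every `μ`
    (∀ μ : ℂ, knappStein ε μ (normOpA ε ξ l μ f) =
      ((-1) ^ ((ε.val + ξ.val) / 2) * ((Real.sqrt Real.pi : ℝ) : ℂ) /
        Complex.Gamma ((1 - μ + (ε.val : ℂ)) / 2)) • normOpA ε (ξ + ε) l (-μ) f) := by
  exact ⟨opADefined hl hf, fun μ => ⟨normOpA_mem_IndP hl hf μ,
    IndP.knappSteinDefined (normOpA_mem_IndP hl hf μ)⟩,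
    fun μ _ h => knappStein_opA hl hf h, fun μ => knappStein_normOpA hl hf μ⟩
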